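/- For all constants $A>0$, $c>1$ and $\alpha>0$ there are two word-RAM programs, $\mathrm{Setup}$ and $\mathrm{Eval}$, and constants $b,C,D,T\in\mathbb N$, all depending only on $A,c,\alpha$, such that the following holds for all integers $n\ge 2$, all integers $k$ with $n^{\alpha}\le k\le n$, and all integers $w\ge 0$ with $w\le A\log n$. Here a word RAM is a unit cost random access machine whose words have $B=b(\lfloor\log_2 n\rfloor+1)=O(\log n)$ bits; each of the following is one step: loading a constant, addition, subtraction, multiplication, integer division and remainder, bitwise Boolean operations and shifts of words, reading or writing a memory cell addressed by a word, and a conditional jump on the comparison of two words. On input $(n,k,w)$, $\mathrm{Setup}$ stops after at most $D\,n^{D}$ steps (polynomial time). It outputs a collection $\Pi=(\pi_s)_s$ of permutations of $\{0,1\}^w$, in the form of a list of words common to all members and a seed length $\ell$; the seed $s$ ranges over all lists of $\ell$ words, and a random member of $\Pi$ is $\pi_s$ for uniformly random $s$. The collection has the following properties. 1. For every set $S\subset\{0,1\}^w$ of size $k$ there is an event $G$ (a nonempty set of seeds) of probability at least $1-n^{-c}$ over the random choice of $\pi\in\Pi$ such that, conditioned on $G$, the joint distribution of the values $(\pi(x))_{x\in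 S}$ is $\delta$-close in statistical (total variation) distance to the joint distribution of the values $(\sigma(x))_{x\in S}$ of a truly random permutation $\sigma$ of $\{0,1\}^w$, where $$\delta=\frac{k^2}{2^{w/2}}+\frac{k^2}{2^w}.$$ 2. Every $\pi_s\in\Pi$ is represented by the common words followed by the words of $s$, which are at most $C\,k\log n$ bits altogether; and $\mathrm{Eval}$, given this representation in memory and any $x\in\{0,1\}^w$ in a register, outputs $\pi_s(x)$ after at most $T$ steps (constant time). -/

import Mathlib

/-! ### Word RAM

A unit cost random access machine with words of `B` bits.  It has registers, and a memory of `2 ^ B`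
words which is addressed by words.  Every executed instruction costs one step. -/

namespace WordRAM

/-- Binary operations on words; arithmetic is modulo `2 ^ B`, `div` and `mod` are unsigned. -/
inductive BinOp where
  | add | sub | mul | div | mod | and | or | xor | shl | shr

def BinOp.eval {B : ℕ} : BinOp → BitVec B → BitVec B → BitVec B
  | .add, x, y => x + y
  | .sub, x, y => x - y
  | .mul, x, y => x * y
  | .div, x, y => x / y
  | .mod, x, y => x % y
  | .and, x, y => x &&& y
  | .or, x, y => x ||| y
  | .xor, x, y => x ^^^ y
  | .shl, x, y => x <<< y
  | .shr, x, y => x >>> y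

/-- Instructions; `R[i]` denotes register `i` and `M[a]` the memory cell with address `a`. -/
inductive Instr where
  /-- `R[d] := v` -/
  | const (d v : ℕ)
  /-- `R[d] := R[a] op R[b]` -/
  | bin (op : BinOp) (d a b : ℕ)
  /-- `R[d] := M[R[a]]` -/
  | load (d a : ℕ)
  /-- `M[R[a]] := R[b]` -/
  | store (a b : ℕ)
  /-- if `R[a] < R[b]` (as unsigned numbers) then go to instruction number `l` -/
  | jlt (a b l : ℕ)

/-- A program is a finite list of instructions.  It stops when the program counter leaves it. -/
abbrev Program := List Instr

/-- A configuration of the machine with words of `B` bits. -/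
structure Config (B : ℕ) where
  pc : ℕ
  reg : ℕ → BitVec B
  mem : BitVec B → BitVec B

/-- Execution of one instruction. -/
def Instr.exec {B : ℕ} (i : Instr) (c : Config B) : Config B :=
  match i with
  | .const d v => ⟨c.pc + 1, Function.update c.reg d (BitVec.ofNat B v), c.mem⟩
  | .bin op d a b => ⟨c.pc + 1, Function.update c.reg d (op.eval (c.reg a) (c.reg b)), c.mem⟩
  | .load d a => ⟨c.pc + 1, Function.update c.reg d (c.mem (c.reg a)), c.mem⟩
  | .store a b => ⟨c.pc + 1, c.reg, Function.update c.mem (c.reg a) (c.reg b)⟩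
  | .jlt a b l => ⟨if (c.reg a).toNat < (c.reg b).toNat then l else c.pc + 1, c.reg, c.mem⟩

/-- One step of a program; a configuration in which the program has stopped does not change. -/
def step {B : ℕ} (P : Program) (c : Config B) : Config B :=
  match P[c.pc]? with
  | some i => i.exec c
  | none => c

/-- Started in `c`, the program `P` stops after at most `t` steps, in the configuration `c'`. -/
def StopsWithin {B : ℕ} (P : Program) (t : ℕ) (c c' : Config B) : Prop :=
  (step P)^[t] c = c' ∧ P.length ≤ c'.pc

/-- The configuration with the words of `args` in the first registers, the words of `data` in the
first memory cells, and zero everywhere else. -/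
def initial {B : ℕ} (args data : List (BitVec B)) : Config B where
  pc := 0
  reg i := args.getD i 0
  mem a := data.getD a.toNat 0

end WordRAM

/-! ### Families of permutations given by seeds -/

/-- The data that determine a family of functions, relative to an evaluation program: a list of
words common to all members, and the number of words of the seed that selects a member. -/
structure SeededFamily (B : ℕ) where
  params : List (BitVec B)
  seedLength : ℕ

namespace SeededFamily

variable {B : ℕ}

/-- The seeds, that is, all lists of `seedLength` words; a random member has a uniform seed. -/
abbrev Seed (F : SeededFamily B) : Type := Fin F.seedLength → BitVec B

/-- The words that represent the member with seed `s`. -/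
def description (F : SeededFamily B) (s : F.Seed) : List (BitVec B) :=
  F.params ++ List.ofFn s

/-- The number of bits in the representation of a member. -/
def descriptionBits (F : SeededFamily B) : ℕ := (F.params.length + F.seedLength) * B

/-- The family that is left as output in a configuration: `R[0]` holds the number of common words,
which stand in the first memory cells, and `R[1]` holds the length of the seeds. -/
def ofConfig (c : WordRAM.Config B) : SeededFamily B where
  params := List.ofFn fun i : Fin (c.reg 0).toNat => c.mem (BitVec.ofNat B i)
  seedLength := (c.reg 1).toNat

/-- On input `n, k, w` the program `setup` outputs the family `F` after at most `t` steps. -/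
def IsOutput (setup : WordRAM.Program) (t n k w : ℕ) (F : SeededFamily B) : Prop :=
  ∃ c : WordRAM.Config B, WordRAM.StopsWithin setup t
    (WordRAM.initial [BitVec.ofNat B n, BitVec.ofNat B k, BitVec.ofNat B w] []) c ∧
    F = ofConfig c

/-- For every seed `s` and every `x`, the program `eval`, started with the representation of the
member with seed `s` in the memory and with `x` in `R[0]`, stops after at most `t` steps with
`π s x` in `R[0]`. -/
def Evaluates (eval : WordRAM.Program) (t : ℕ) (F : SeededFamily B) {w : ℕ}
    (π : F.Seed → Equiv.Perm (BitVec w)) : Prop :=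
  ∀ (s : F.Seed) (x : BitVec w), ∃ c : WordRAM.Config B,
    WordRAM.StopsWithin eval t
      (WordRAM.initial [BitVec.ofNat B x.toNat] (F.description s)) c ∧
    (c.reg 0).toNat = (π s x).toNat

end SeededFamily

/-! ### Statistical distance -/

/-- The statistical (total variation) distance of two distributions on a finite type. -/
noncomputable def statDist {Y : Type*} [Fintype Y] (p q : PMF Y) : ℝ :=
  (1 / 2) * ∑ y, |(p y).toReal - (q y).toReal|

/-- The joint distribution of the values on `S` of the permutation `π s`, for `s` uniform in the
nonempty finite set `G`. -/
noncomputable def valuesOn {w : ℕ} {Seed : Type*} (π : Seed → Equiv.Perm (BitVec w))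
    (G : Finset Seed) (hG : G.Nonempty) (S : Finset (BitVec w)) : PMF (S → BitVec w) :=
  (PMF.uniformOfFinset G hG).map fun s x => π s x

/-- The joint distribution of the values on `S` of a truly random permutation. -/
noncomputable def trulyRandomValuesOn {w : ℕ} (S : Finset (BitVec w)) : PMF (S → BitVec w) :=
  valuesOn (fun σ : Equiv.Perm (BitVec w) => σ) Finset.univ Finset.univ_nonempty S

/-!
The permutations are Feistel networks of four rounds on words of `w` bits. A word is split into a
left part and a right part of `w / 2` bits and, if `w` is odd, one extra bit; each round masks some
of the parts, by exclusive or, with the value of a hash function at the remaining ones. A round is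
an involution, so every seed gives a permutation.

*The hash functions.* Let `τ` be the least power of two, other than one, with `k ≤ τ ^ 5`. One copy
of the hash function (`bucketHash`) distributes the `k` points over `τ ^ 3` buckets by a cubic
polynomial, computes four positions of each point within its bucket, and adds up the entries of
four random tables at these positions. By linear algebra over the field with two elements
(`exists_tables_eq`) the sum is uniformly random on the `k` points, unless in some bucket there is
a nonempty set of points that takes each of the positions an even number of times. This exception
has probability at most `1 / τ` (`prob_not_interpolates_le`): the fourth moment of the load shows
that all buckets are likely to have at most `4 * τ ^ 2` points
(`KWiseIndependent.prob_overflow_le`); the positions are themselves sums of table entries, which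
are independent on a bucket as soon as one of four polynomials is injective on it; and four
independent random functions with sufficiently many values are unlikely to be all even on a common
nonempty set (`prob_exists_evenOn_le`). The sum of `L` copies is uniformly random if one of them
is, so that it fails with probability at most `τ ^ (-L)` (`expect_sumHash_le`). Since `k ≥ n ^ α`,
a constant number `L` of copies makes this smaller than any given power of `1 / n`, and a seed has
`O(k)` words.

*The distance.* The first two rounds make it unlikely that two points have equal arguments in the
second or third one, and the second and third rounds randomize the argument of the last one. In the
absence of such collisions the last three rounds add independent random values to all parts
(`AlmostUniform.expect_feistel_le`), and independent random values differ from those of a random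
permutation by the probability of a collision (`expect_le_expect_perm`). Summed over the
`k * (k - 1) / 2` pairs of points, the collisions account for less than the allowed distance
`k ^ 2 / 2 ^ (w / 2) + k ^ 2 / 2 ^ w` if `w ≥ 2`, and what remains absorbs the errors of the hash
functions (`error_le`). Therefore no seed has to be excluded: the event of the theorem consists of
all seeds. All distances are compared by the expectations of test functions with values in `[0, 1]`
(`statDist_le`).

*The programs.* Evaluation is a fixed expression in the argument, the seven common words and the
seed, because the number of copies is constant; `WordRAM.Expr.compile` turns it into instructions
without jumps. The setup finds `τ` in a short loop (`exists_loopState`) and stores the common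
words.
-/

open scoped BigOperators

/-! ### Probability on finite types -/

open Classical in
/-- The probability of the event `p` for a uniformly distributed element of the finite type `Ω`. -/
noncomputable def prob {Ω : Type*} [Fintype Ω] (p : Ω → Prop) : ℝ :=
  𝔼 ω, if p ω then (1 : ℝ) else 0

section Probability

variable {Ω Ω' : Type*} [Fintype Ω] [Fintype Ω']

theorem expect_mono {f g : Ω → ℝ} (h : ∀ ω, f ω ≤ g ω) : 𝔼 ω, f ω ≤ 𝔼 ω, g ω :=
  Finset.expect_le_expect fun ω _ => h ω

theorem prob_nonneg (p : Ω → Prop) : 0 ≤ prob p :=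
  Finset.expect_nonneg fun ω _ => by split_ifs <;> norm_num

theorem prob_mono {p q : Ω → Prop} (h : ∀ ω, p ω → q ω) : prob p ≤ prob q := by
  refine expect_mono fun ω => ?_
  by_cases hp : p ω
  · simp [hp, h ω hp]
  · simp only [hp, if_false]; split_ifs <;> norm_num

theorem prob_congr {p q : Ω → Prop} (h : ∀ ω, p ω ↔ q ω) : prob p = prob q :=
  congrArg prob (funext fun ω => propext (h ω))

theorem prob_eq_zero {p : Ω → Prop} (h : ∀ ω, ¬ p ω) : prob p = 0 := by
  simp [prob, h]

theorem expect_le_of_forall_le [Nonempty Ω] {f : Ω → ℝ} {c : ℝ} (h : ∀ ω, f ω ≤ c) :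
    𝔼 ω, f ω ≤ c :=
  (expect_mono h).trans_eq (Fintype.expect_const c)

theorem prob_le_one [Nonempty Ω] (p : Ω → Prop) : prob p ≤ 1 :=
  expect_le_of_forall_le fun ω => by split_ifs <;> norm_num

theorem prob_or_le (p q : Ω → Prop) : prob (fun ω => p ω ∨ q ω) ≤ prob p + prob q := by
  unfold prob
  rw [← Finset.expect_add_distrib]
  refine expect_mono fun ω => ?_
  by_cases hp : p ω <;> by_cases hq : q ω <;> simp [hp, hq]

/-- The union bound. -/
theorem prob_exists_mem_le {ι : Type*} (s : Finset ι) (p : ι → Ω → Prop) :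
    prob (fun ω => ∃ i ∈ s, p i ω) ≤ ∑ i ∈ s, prob (p i) := by
  unfold prob
  rw [← Finset.expect_sum_comm]
  refine expect_mono fun ω => ?_
  by_cases h : ∃ i ∈ s, p i ω
  · obtain ⟨i, hi, hp⟩ := h
    rw [if_pos ⟨i, hi, hp⟩]
    classical
    calc (1 : ℝ) = if p i ω then 1 else 0 := by simp [hp]
      _ ≤ _ := Finset.single_le_sum (f := fun i => if p i ω then (1 : ℝ) else 0)
        (fun j _ => by split_ifs <;> norm_num) hi
      _ = _ := Finset.sum_congr rfl fun j _ => by congr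
  · rw [if_neg h]
    exact Finset.sum_nonneg fun j _ => by split_ifs <;> norm_num

theorem prob_equiv (e : Ω ≃ Ω') (p : Ω' → Prop) : prob (fun ω => p (e ω)) = prob p :=
  Fintype.expect_equiv e _ _ fun _ => rfl

theorem expect_prod (f : Ω × Ω' → ℝ) : 𝔼 x, f x = 𝔼 a, 𝔼 b, f (a, b) := by
  rw [← Finset.univ_product_univ, Finset.expect_product]

theorem prob_prod (p : Ω × Ω' → Prop) : prob p = 𝔼 a, prob fun b => p (a, b) := expect_prod _

theorem prob_fst [Nonempty Ω'] (p : Ω → Prop) : prob (fun x : Ω × Ω' => p x.1) = prob p := by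
  rw [prob_prod]
  unfold prob
  refine Finset.expect_congr rfl fun a _ => ?_
  exact Fintype.expect_const (ι := Ω') (M := ℝ) (@ite ℝ (p a) (Classical.propDecidable _) 1 0)

theorem prob_prod_le [Nonempty Ω] {p : Ω × Ω' → Prop} {ε : ℝ}
    (h : ∀ a, prob (fun b => p (a, b)) ≤ ε) : prob p ≤ ε := by
  rw [prob_prod]
  exact expect_le_of_forall_le h

/-- Events that concern different coordinates are independent. -/
theorem prob_forall_pi {ι : Type*} [Fintype ι] [DecidableEq ι] (p : ι → Ω → Prop) :
    prob (fun ω : ι → Ω => ∀ i, p i (ω i)) = ∏ i, prob (p i) := by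
  classical
  unfold prob
  simp only [Fintype.expect_eq_sum_div_card, Finset.prod_div_distrib, Finset.prod_univ_sum,
    Fintype.piFinset_univ, Fintype.card_fun, Finset.prod_const, Finset.card_univ, Nat.cast_pow]
  congr 1
  refine Finset.sum_congr rfl fun ω _ => ?_
  by_cases h : ∀ i, p i (ω i)
  · simp [h]
  · rw [if_neg h]
    push Not at h
    obtain ⟨i, hi⟩ := h
    exact (Finset.prod_eq_zero (Finset.mem_univ i) (by simp [hi])).symm

/-- Markov's inequality. -/
theorem prob_le_expect_div {f : Ω → ℝ} (hf : ∀ ω, 0 ≤ f ω) {p : Ω → Prop} {c : ℝ} (hc : 0 < c)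
    (h : ∀ ω, p ω → c ≤ f ω) : prob p ≤ (𝔼 ω, f ω) / c := by
  unfold prob
  rw [Finset.expect_div]
  refine expect_mono fun ω => ?_
  split_ifs with hp
  · rw [le_div_iff₀ hc]; linarith [h ω hp]
  · exact div_nonneg (hf ω) hc.le

/-- A function whose values can be translated by bijections of its domain takes uniformly
distributed values. -/
theorem expect_comp_eq_of_shift {Y : Type*} [Fintype Y] [AddGroup Y] [Nonempty Ω] (Φ : Ω → Y)
    (h : ∀ d, ∃ e : Ω ≃ Ω, ∀ ω, Φ (e ω) = Φ ω + d) (f : Y → ℝ) : 𝔼 ω, f (Φ ω) = 𝔼 y, f y := by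
  have h1 : ∀ d : Y, 𝔼 ω, f (Φ ω) = 𝔼 ω, f (Φ ω + d) := fun d => by
    obtain ⟨e, he⟩ := h d
    rw [← Fintype.expect_equiv e (fun ω => f (Φ ω + d)) (fun ω => f (Φ ω)) fun ω => by rw [he]]
  calc 𝔼 ω, f (Φ ω) = 𝔼 _d : Y, 𝔼 ω, f (Φ ω) := (Fintype.expect_const _).symm
    _ = 𝔼 d : Y, 𝔼 ω, f (Φ ω + d) := Finset.expect_congr rfl fun d _ => h1 d
    _ = 𝔼 ω, 𝔼 d : Y, f (Φ ω + d) := Finset.expect_comm _ _ _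
    _ = 𝔼 _ω : Ω, 𝔼 y, f y := Finset.expect_congr rfl fun ω _ =>
        Fintype.expect_equiv (Equiv.addLeft (Φ ω)) _ _ fun d => rfl
    _ = _ := Fintype.expect_const _

/-- A surjective homomorphism of finite groups maps the uniform distribution to the uniform
distribution. -/
theorem expect_comp_eq_of_surjective {G Y : Type*} [Fintype G] [Fintype Y] [AddGroup G]
    [AddGroup Y] (Φ : G →+ Y) (h : Function.Surjective Φ) (f : Y → ℝ) :
    𝔼 x, f (Φ x) = 𝔼 y, f y :=
  expect_comp_eq_of_shift Φ (fun d => by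
    obtain ⟨c, rfl⟩ := h d
    exact ⟨Equiv.addRight c, fun x => map_add Φ x c⟩) f

theorem prob_comp_eq_of_surjective {G Y : Type*} [Fintype G] [Fintype Y] [AddGroup G]
    [AddGroup Y] (Φ : G →+ Y) (h : Function.Surjective Φ) (p : Y → Prop) :
    prob (fun x => p (Φ x)) = prob p := by
  classical exact expect_comp_eq_of_surjective Φ h fun y => if p y then 1 else 0

theorem prob_eq_div {p : Ω → Prop} [DecidablePred p] :
    prob p = ((Finset.univ.filter p).card : ℝ) / Fintype.card Ω := by
  classical
  unfold prob
  rw [Fintype.expect_eq_sum_div_card, Finset.card_filter]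
  push_cast
  congr 1
  exact Finset.sum_congr rfl fun ω _ => by congr

theorem prob_eq_const {Y : Type*} [Fintype Y] (y₀ : Y) :
    prob (fun y : Y => y = y₀) = 1 / Fintype.card Y := by
  classical
  have h : Finset.univ.filter (fun y => y = y₀) = {y₀} := by ext; simp
  rw [prob_eq_div, h, Finset.card_singleton, Nat.cast_one]

end Probability

/-! ### Polynomial hashing modulo a power of two -/

/-- A random function `h` is `k`-wise independent: its values at any `j ≤ k` distinct points are
jointly uniform. -/
def KWiseIndependent {Ω U Y : Type*} [Fintype Ω] [Fintype Y] (k : ℕ) (h : Ω → U → Y) : Prop :=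
  ∀ j ≤ k, ∀ e : Fin j ↪ U, ∀ f : (Fin j → Y) → ℝ,
    𝔼 ω, f (fun i => h ω (e i)) = 𝔼 y, f y

/-- The value at `x` of the cubic polynomial with coefficients `a`, modulo `2 ^ B`. -/
def cubic {B : ℕ} (a : Fin 4 → BitVec B) (x : BitVec B) : BitVec B :=
  a 0 + x * (a 1 + x * (a 2 + x * a 3))

/-- The hash value consists of middle bits of the value of a cubic polynomial modulo `2 ^ B`, where
`D` and `N` are powers of two. -/
def cubicHash {B : ℕ} (D N : ℕ) [NeZero N] (a : Fin 4 → BitVec B) (x : BitVec B) : Fin N :=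
  Fin.ofNat N ((cubic a x).toNat / D)

theorem cubic_add {B : ℕ} (a c : Fin 4 → BitVec B) (x : BitVec B) :
    cubic (a + c) x = cubic a x + cubic c x := by
  simp only [cubic, Pi.add_apply]; ring

theorem cubic_coeff {B : ℕ} (Q : Polynomial ℤ) (hQ : Q.natDegree < 4) (x : ℕ) :
    cubic (fun k : Fin 4 => ((Q.coeff k : ℤ) : BitVec B)) (x : BitVec B)
      = ((Q.eval (x : ℤ) : ℤ) : BitVec B) := by
  rw [Polynomial.eval_eq_sum_range' hQ]
  simp only [cubic, Finset.sum_range_succ, Finset.sum_range_zero]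
  push_cast
  simp
  ring

theorem natCast_two_pow_self (B : ℕ) : ((2 ^ B : ℕ) : BitVec B) = 0 := by
  apply BitVec.eq_of_toNat_eq
  rw [BitVec.natCast_eq_ofNat, BitVec.toNat_ofNat, Nat.mod_self]
  rfl

/-- A product of at most three nonzero numbers below `2 ^ w` can be completed to `2 ^ (3 * w)`
modulo `2 ^ B`. -/
theorem exists_mul_prod_eq {B w : ℕ} {ι : Type*} (s : Finset ι) (hs : s.card ≤ 3) (f : ι → ℤ)
    (h0 : ∀ i ∈ s, f i ≠ 0) (hf : ∀ i ∈ s, |f i| < 2 ^ w) :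
    ∃ u : ℤ, ((u * ∏ i ∈ s, f i : ℤ) : BitVec B) = ((2 ^ (3 * w) : ℤ) : BitVec B) := by
  set P := ∏ i ∈ s, f i with hP
  have hP0 : P ≠ 0 := Finset.prod_ne_zero_iff.2 h0
  have hlt : |P| ≤ 2 ^ (3 * w) := by
    rw [hP, Finset.abs_prod]
    calc ∏ i ∈ s, |f i| ≤ ∏ _i ∈ s, (2 : ℤ) ^ w :=
          Finset.prod_le_prod (fun i _ => abs_nonneg _) fun i hi => (hf i hi).le
      _ = 2 ^ (w * s.card) := by rw [Finset.prod_const, pow_mul]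
      _ ≤ _ := pow_le_pow_right₀ (by norm_num) (by nlinarith)
  have hdvd : (Int.gcd P (2 ^ B) : ℤ) ∣ 2 ^ (3 * w) := by
    obtain ⟨v, -, hv⟩ := (Nat.dvd_prime_pow Nat.prime_two).1
      (show Int.gcd P (2 ^ B) ∣ 2 ^ B by
        have := Int.gcd_dvd_natAbs_right P (2 ^ B)
        rwa [Int.natAbs_pow] at this)
    rw [hv]
    have h1 : ((2 ^ v : ℕ) : ℤ) ∣ P := hv ▸ Int.gcd_dvd_left ..
    have h2 : ((2 ^ v : ℕ) : ℤ) ≤ |P| :=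
      Int.le_of_dvd (abs_pos.2 hP0) ((dvd_abs _ _).2 h1)
    have h3 : (2 : ℤ) ^ v ≤ 2 ^ (3 * w) := by push_cast at h2; linarith
    have h4 : v ≤ 3 * w := (pow_le_pow_iff_right₀ (by norm_num)).1 h3
    push_cast
    exact pow_dvd_pow 2 h4
  obtain ⟨m, hm⟩ := hdvd
  refine ⟨Int.gcdA P (2 ^ B) * m, ?_⟩
  -- by Bézout's identity, the gcd of `P` and `2 ^ B` is a multiple of `P` modulo `2 ^ B`
  have hb := Int.gcd_eq_gcd_ab P (2 ^ B)
  have : (2 : ℤ) ^ (3 * w) = Int.gcdA P (2 ^ B) * m * P + 2 ^ B * (Int.gcdB P (2 ^ B) * m) := by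
    rw [hm, hb]; ring
  rw [this, Int.cast_add, Int.cast_mul (2 ^ B)]
  have hz : (((2 : ℤ) ^ B : ℤ) : BitVec B) = 0 := by
    have := natCast_two_pow_self B
    push_cast at this ⊢
    exact this
  rw [hz, zero_mul, add_zero]

/-- The Lagrange basis polynomials, scaled so that they are integral, translate the values of a
cubic polynomial at different points independently by multiples of `2 ^ (3 * w)`. -/
theorem exists_cubic_eq {B w j : ℕ} (hj : j ≤ 4) (e : Fin j ↪ ℕ) (he : ∀ i, e i < 2 ^ w)
    (d : Fin j → ℕ) : ∃ c : Fin 4 → BitVec B,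
      ∀ i, cubic c (e i : BitVec B) = ((2 ^ (3 * w) * d i : ℕ) : BitVec B) := by
  have hu : ∀ i : Fin j, ∃ u : ℤ, ((u * ∏ i' ∈ Finset.univ.erase i, ((e i : ℤ) - e i') : ℤ) :
      BitVec B) = ((2 ^ (3 * w) : ℤ) : BitVec B) := fun i => by
    refine exists_mul_prod_eq _ ?_ _ (fun i' hi' => ?_) fun i' _ => ?_
    · rw [Finset.card_erase_of_mem (Finset.mem_univ _), Finset.card_univ, Fintype.card_fin]
      omega
    · rw [sub_ne_zero]
      intro h
      exact Finset.ne_of_mem_erase hi' (e.injective (Nat.cast_injective h).symm)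
    · have h1 := he i
      have h2 := he i'
      rw [abs_lt]
      zify at h1 h2
      constructor <;> linarith [Int.natCast_nonneg (e i), Int.natCast_nonneg (e i')]
  choose u hu using hu
  let Q : Polynomial ℤ := ∑ i, Polynomial.C (u i * d i) *
    ∏ i' ∈ Finset.univ.erase i, (Polynomial.X - Polynomial.C (e i' : ℤ))
  have hdeg : Q.natDegree < 4 := by
    have : Q.natDegree ≤ 3 := Polynomial.natDegree_sum_le_of_forall_le _ _ fun i _ => by
      refine (Polynomial.natDegree_C_mul_le _ _).trans ?_
      rw [Polynomial.natDegree_finsetProd_X_sub_C_eq_card,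
        Finset.card_erase_of_mem (Finset.mem_univ _), Finset.card_univ, Fintype.card_fin]
      omega
    omega
  refine ⟨fun k => ((Q.coeff k : ℤ) : BitVec B), fun i => ?_⟩
  rw [cubic_coeff Q hdeg]
  have hev : Q.eval (e i : ℤ) = (u i * ∏ i' ∈ Finset.univ.erase i, ((e i : ℤ) - e i')) * d i := by
    simp only [Q, Polynomial.eval_finsetSum, Polynomial.eval_mul, Polynomial.eval_C,
      Polynomial.eval_prod, Polynomial.eval_sub, Polynomial.eval_X]
    rw [Finset.sum_eq_single i]
    · ring
    · intro b _ hb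
      rw [Finset.prod_eq_zero (i := i) (Finset.mem_erase.2 ⟨hb.symm, Finset.mem_univ _⟩)
        (sub_self _), mul_zero]
    · simp
  rw [hev, Int.cast_mul, hu]
  push_cast
  rfl

/-- Adding a polynomial with value `D * d` at `x` translates the hash value of `x` by `d`, since
lower bits are not affected and carries leave the range modulo `N`. -/
theorem cubicHash_shift {B D N : ℕ} [NeZero N] (hD : 0 < D) (hDN : D * N ∣ 2 ^ B)
    (a c : Fin 4 → BitVec B) (x : BitVec B) (d : Fin N)
    (hc : cubic c x = ((D * d : ℕ) : BitVec B)) :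
    cubicHash D N (a + c) x = cubicHash D N a x + d := by
  unfold cubicHash
  rw [cubic_add, hc]
  apply Fin.ext
  obtain ⟨M, hM⟩ := hDN
  generalize (cubic a x) = y
  simp only [BitVec.toNat_add, Fin.val_add, Fin.val_ofNat, BitVec.natCast_eq_ofNat,
    BitVec.toNat_ofNat, Nat.add_mod_mod, Nat.mod_add_mod]
  rw [hM, mul_assoc, Nat.mod_mul_right_div_self, Nat.mod_mod_of_dvd _ (dvd_mul_right N M),
    Nat.add_mul_div_left _ _ hD]

/-- Cubic polynomials modulo `2 ^ B` give a `4`-wise independent hash function on the numbers below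
`2 ^ w`, if words are long enough. -/
theorem kWiseIndependent_cubicHash {B w N : ℕ} [NeZero N] {U : Type*} (emb : U ↪ ℕ)
    (hemb : ∀ x, emb x < 2 ^ w) (hN : 2 ^ (3 * w) * N ∣ 2 ^ B) :
    KWiseIndependent 4 fun (a : Fin 4 → BitVec B) (x : U) =>
      cubicHash (2 ^ (3 * w)) N a (emb x : BitVec B) := by
  intro j hj e f
  refine expect_comp_eq_of_shift
    (fun a i => cubicHash (2 ^ (3 * w)) N a (emb (e i) : BitVec B)) (fun d => ?_) f
  obtain ⟨c, hc⟩ := exists_cubic_eq (B := B) hj (e.trans emb) (fun i => hemb _) fun i => (d i : ℕ)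
  refine ⟨Equiv.addRight c, fun a => funext fun i => ?_⟩
  exact cubicHash_shift (by positivity) hN a c _ (d i) (hc i)

theorem KWiseIndependent.comp_surjective {Ω Ω' U Y : Type*} [Fintype Ω] [Fintype Ω'] [Fintype Y]
    {k : ℕ} {h : Ω → U → Y} (hh : KWiseIndependent k h) (r : Ω' → Ω)
    (hr : ∀ f : Ω → ℝ, 𝔼 ω', f (r ω') = 𝔼 ω, f ω) : KWiseIndependent k fun ω' => h (r ω') :=
  fun j hj e f => (hr fun ω => f fun i => h ω (e i)).trans (hh j hj e f)

/-- Under a pairwise independent hash function, distinct points collide with probability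
`1 / card Y`. -/
theorem KWiseIndependent.prob_collision {Ω U Y : Type*} [Fintype Ω] [Fintype Y] [Nonempty Y]
    {k : ℕ} (hk : 2 ≤ k) {h : Ω → U → Y} (hh : KWiseIndependent k h) {x y : U} (hxy : x ≠ y) :
    prob (fun ω => h ω x = h ω y) = 1 / Fintype.card Y := by
  classical
  let e : Fin 2 ↪ U := ⟨![x, y], by
    intro i i' hi
    fin_cases i <;> fin_cases i' <;> simp_all [eq_comm]⟩
  have h1 := hh 2 hk e fun v => if v 0 = v 1 then 1 else 0
  have h2 : prob (fun ω => h ω x = h ω y) = prob fun v : Fin 2 → Y => v 0 = v 1 := by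
    unfold prob; convert h1 <;> rfl
  rw [h2, ← prob_equiv (finTwoArrowEquiv Y).symm, prob_prod]
  have h3 : ∀ a : Y, prob (fun b => (finTwoArrowEquiv Y).symm (a, b) 0 =
      (finTwoArrowEquiv Y).symm (a, b) 1) = 1 / Fintype.card Y := fun a =>
    (prob_congr fun b => eq_comm).trans (prob_eq_const a)
  simp_rw [h3]
  exact Fintype.expect_const _

/-! ### Loads of buckets -/

section Moments

variable {Ω U Y : Type*} [Fintype Ω] [Fintype Y] {h : Ω → U → Y}

/-- The number of injective sequences of length `j` of elements with a property. -/
theorem card_embedding_filter {α : Type*} [Fintype α] (p : α → Prop) [DecidablePred p] (j : ℕ) :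
    Fintype.card {e : Fin j ↪ α // ∀ t, p (e t)}
      = (Finset.univ.filter p).card.descFactorial j := by
  classical
  have e : {e : Fin j ↪ α // ∀ t, p (e t)} ≃ (Fin j ↪ {x : α // p x}) :=
    { toFun := fun e => ⟨fun t => ⟨e.1 t, e.2 t⟩, fun a b hab =>
        e.1.injective (congrArg Subtype.val hab)⟩
      invFun := fun e => ⟨e.trans (Function.Embedding.subtype p), fun t => (e t).2⟩
      left_inv := fun e => rfl
      right_inv := fun e => rfl }
  rw [Fintype.card_congr e, Fintype.card_embedding_eq, Fintype.card_fin, Fintype.card_subtype]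

/-- The factorial moments of the load of a bucket are those of the binomial distribution. -/
theorem KWiseIndependent.expect_descFactorial [DecidableEq Y] {k : ℕ} (hh : KWiseIndependent k h)
    (S : Finset U) (i : Y) {j : ℕ} (hj : j ≤ k) :
    𝔼 ω, (((S.filter fun x => h ω x = i).card.descFactorial j : ℕ) : ℝ)
      = (S.card.descFactorial j : ℕ) * (1 / (Fintype.card Y : ℝ)) ^ j := by
  classical
  have h1 : ∀ ω, (((S.filter fun x => h ω x = i).card.descFactorial j : ℕ) : ℝ)
      = ∑ e : Fin j ↪ S, if (fun t => h ω (e t)) = fun _ => i then (1 : ℝ) else 0 := fun ω => by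
    rw [Finset.sum_boole, ← Fintype.card_subtype]
    have h2 : (S.filter fun x => h ω x = i).card
        = (Finset.univ.filter fun x : S => h ω x = i).card := by
      rw [← Finset.card_map (Function.Embedding.subtype _)]
      congr 1
      ext x
      simp [and_comm]
    rw [h2, ← card_embedding_filter]
    norm_cast
    refine Fintype.card_congr (Equiv.subtypeEquivRight fun e => ?_)
    exact funext_iff.symm
  simp_rw [h1]
  rw [Finset.expect_sum_comm]
  have h3 : ∀ e : Fin j ↪ S, (𝔼 ω, if (fun t => h ω (e t)) = fun _ => i then (1 : ℝ) else 0)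
      = (1 / (Fintype.card Y : ℝ)) ^ j := fun e => by
    have := hh j hj (e.trans (Function.Embedding.subtype _)) fun y =>
      if y = fun _ => i then (1 : ℝ) else 0
    refine Eq.trans this ?_
    have h4 := prob_eq_const (Y := Fin j → Y) fun _ => i
    unfold prob at h4
    rw [Fintype.card_fun, Fintype.card_fin, Nat.cast_pow, ← one_div_pow] at h4
    rw [← h4]
    congr! 2
  simp_rw [h3]
  rw [Finset.sum_const, Finset.card_univ, Fintype.card_embedding_eq, Fintype.card_fin,
    Fintype.card_coe, nsmul_eq_mul]

theorem cast_descFactorial_two (x : ℕ) : ((x.descFactorial 2 : ℕ) : ℝ) = x * (x - 1) := by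
  rcases x with _ | x
  · simp
  · simp [Nat.descFactorial]; ring

theorem cast_descFactorial_three (x : ℕ) :
    ((x.descFactorial 3 : ℕ) : ℝ) = x * (x - 1) * (x - 2) := by
  rcases x with _ | _ | x
  · simp
  · simp
  · simp [Nat.descFactorial]; ring

theorem cast_descFactorial_four (x : ℕ) :
    ((x.descFactorial 4 : ℕ) : ℝ) = x * (x - 1) * (x - 2) * (x - 3) := by
  rcases x with _ | _ | _ | x
  · simp
  · simp
  · simp [Nat.descFactorial]
  · simp [Nat.descFactorial]; ring

/-- The fourth central moment of the load of a bucket, bounded as for the binomial distribution. -/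
theorem KWiseIndependent.fourth_moment_le [DecidableEq Y] [Nonempty Y] [Nonempty Ω]
    (hh : KWiseIndependent 4 h) (S : Finset U) (i : Y) {μ : ℝ}
    (hμ : μ = S.card * (1 / (Fintype.card Y : ℝ))) :
    𝔼 ω, (((S.filter fun x => h ω x = i).card : ℝ) - μ) ^ 4 ≤ 3 * μ ^ 2 + μ := by
  set p : ℝ := 1 / (Fintype.card Y : ℝ) with hp
  have hcard : (1 : ℝ) ≤ Fintype.card Y := by exact_mod_cast Fintype.card_pos
  have hp0 : 0 ≤ p := by positivity
  have hp1 : p ≤ 1 := by rw [hp, div_le_one (by linarith)]; exact hcard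
  have m1 := hh.expect_descFactorial S i (j := 1) (by norm_num)
  have m2 := hh.expect_descFactorial S i (j := 2) (by norm_num)
  have m3 := hh.expect_descFactorial S i (j := 3) (by norm_num)
  have m4 := hh.expect_descFactorial S i (j := 4) (by norm_num)
  simp only [Nat.descFactorial_one, cast_descFactorial_two, cast_descFactorial_three,
    cast_descFactorial_four, ← hp] at m1 m2 m3 m4
  set k : ℝ := (S.card : ℝ) with hk
  have hk0 : 0 ≤ k := Nat.cast_nonneg _
  -- the fourth central power in terms of descending factorials
  have expand : ∀ ω, (((S.filter fun x => h ω x = i).card : ℝ) - μ) ^ 4 =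
      (fun X : ℝ => X * (X - 1) * (X - 2) * (X - 3) + (6 - 4 * μ) * (X * (X - 1) * (X - 2))
        + (7 - 12 * μ + 6 * μ ^ 2) * (X * (X - 1)) + (1 - 4 * μ + 6 * μ ^ 2 - 4 * μ ^ 3) * X
        + μ ^ 4) ((S.filter fun x => h ω x = i).card : ℝ) := fun ω => by ring
  simp_rw [expand]
  simp only [Finset.expect_add_distrib, ← Finset.mul_expect, m1, m2, m3, m4, Fintype.expect_const]
  have hq : 0 ≤ k * p := by positivity
  have hle : (1 - p) * (1 - 6 * p + 6 * p ^ 2) ≤ 1 := by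
    nlinarith [mul_nonneg hp0 hp0, mul_nonneg (mul_nonneg hp0 hp0) hp0]
  have hle2 : (1 - p) ^ 2 ≤ 1 := by nlinarith
  rw [hμ]
  calc _ = 3 * (k * p) ^ 2 * (1 - p) ^ 2 + k * p * ((1 - p) * (1 - 6 * p + 6 * p ^ 2)) := by ring
    _ ≤ 3 * (k * p) ^ 2 * 1 + k * p * 1 := by gcongr
    _ = _ := by ring

/-- With `card Y = τ ^ 3` buckets for at most `τ ^ 5` points, the expected load of a bucket is at
most `τ ^ 2`, and it is unlikely that some load exceeds four times this value. -/
theorem KWiseIndependent.prob_overflow_le [DecidableEq Y] [Nonempty Y] [Nonempty Ω]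
    (hh : KWiseIndependent 4 h) {τ : ℕ} (hτ : 0 < τ) (hY : Fintype.card Y = τ ^ 3)
    (S : Finset U) (hS : S.card ≤ τ ^ 5) :
    prob (fun ω => ∃ i : Y, 4 * τ ^ 2 < (S.filter fun x => h ω x = i).card)
      ≤ (4 / 81) * (1 / τ) := by
  have ht : (0 : ℝ) < τ := by exact_mod_cast hτ
  have ht1 : (1 : ℝ) ≤ τ := by exact_mod_cast hτ
  set μ : ℝ := S.card * (1 / (Fintype.card Y : ℝ)) with hμ
  have hμ0 : 0 ≤ μ := by positivity
  have hμ1 : μ ≤ τ ^ 2 := by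
    rw [hμ, hY]
    push_cast
    rw [mul_one_div, div_le_iff₀ (by positivity), ← pow_add]
    exact_mod_cast hS
  have hone : ∀ i : Y, prob (fun ω => 4 * τ ^ 2 < (S.filter fun x => h ω x = i).card)
      ≤ (4 / 81) * (1 / τ) ^ 4 := fun i => by
    refine (prob_le_expect_div (f := fun ω => (((S.filter fun x => h ω x = i).card : ℝ) - μ) ^ 4)
      (fun ω => by positivity) (c := (3 * τ ^ 2) ^ 4) (by positivity) fun ω hω => ?_).trans ?_
    · have : (4 * τ ^ 2 : ℝ) < (S.filter fun x => h ω x = i).card := by exact_mod_cast hω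
      gcongr
      linarith
    · rw [div_le_iff₀ (by positivity)]
      refine (hh.fourth_moment_le S i hμ).trans ?_
      have e1 : (4 / 81) * (1 / (τ : ℝ)) ^ 4 * (3 * τ ^ 2) ^ 4 = 4 * τ ^ 4 := by field_simp; ring
      rw [e1]
      have e2 : (1 : ℝ) ≤ τ ^ 2 := one_le_pow₀ ht1
      nlinarith [mul_le_mul hμ1 hμ1 hμ0 (by positivity)]
  have hex := prob_exists_mem_le Finset.univ
    fun (i : Y) ω => 4 * τ ^ 2 < (S.filter fun x => h ω x = i).card
  simp only [Finset.mem_univ, true_and] at hex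
  refine hex.trans ((Finset.sum_le_sum fun i _ => hone i).trans_eq ?_)
  rw [Finset.sum_const, Finset.card_univ, hY, nsmul_eq_mul]
  push_cast
  field_simp

end Moments

/-! ### Even sets and linear algebra -/

/-- Every value is taken an even number of times by `f` on the set `X`. -/
def EvenOn {U Y : Type*} [DecidableEq Y] (X : Finset U) (f : U → Y) : Prop :=
  ∀ c, Even (X.filter fun x => f x = c).card

section LinearAlgebra

variable {U J C W : Type*} [Fintype J] [DecidableEq J] [DecidableEq C]
  [AddCommGroup W] [Module (ZMod 2) W]

/-- If no nonempty subset of `S` meets every table cell evenly, then the incidence vectors of the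
points of `S` are linearly independent over the field with two elements, so that the tables can be
filled to produce any given values on `S`. -/
theorem exists_tables_eq (pos : J → U → C) (S : Finset U)
    (h : ∀ X ⊆ S, X.Nonempty → ¬ ∀ j, EvenOn X (pos j)) (z : U → W) :
    ∃ T : J → C → W, ∀ x ∈ S, ∑ j, T j (pos j x) = z x := by
  classical
  let v : S → J × C → ZMod 2 := fun x => ∑ j, Pi.single (j, pos j x) 1
  have hv : ∀ x j c, v x (j, c) = if pos j x = c then 1 else 0 := fun x j c => by
    simp only [v, Finset.sum_apply, Pi.single_apply, Prod.mk.injEq]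
    rw [Finset.sum_eq_single j]
    · simp [eq_comm]
    · intro b _ hb
      rw [if_neg fun hh => hb hh.1.symm]
    · simp
  have hli : LinearIndependent (ZMod 2) v := by
    rw [Fintype.linearIndependent_iff]
    intro g hg
    by_contra hne
    push Not at hne
    obtain ⟨x₀, hx₀⟩ := hne
    let X : Finset U := (Finset.univ.filter fun x : S => g x ≠ 0).map (Function.Embedding.subtype _)
    refine h X (fun x hx => ?_) ⟨x₀, ?_⟩ fun j c => ?_
    · obtain ⟨y, -, rfl⟩ := Finset.mem_map.1 hx
      exact y.2
    · exact Finset.mem_map.2 ⟨x₀, by simpa using hx₀, rfl⟩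
    · have h1 := congrFun hg (j, c)
      simp only [Finset.sum_apply, Pi.smul_apply, hv, smul_eq_mul, Pi.zero_apply] at h1
      have h2 : ((X.filter fun x => pos j x = c).card : ZMod 2) = 0 := by
        rw [← h1]
        simp only [X, Finset.filter_map, Finset.card_map, Finset.filter_filter]
        rw [Finset.card_filter, Nat.cast_sum]
        refine Finset.sum_congr rfl fun x _ => ?_
        have h3 : g x = 0 ∨ g x = 1 := by
          generalize g x = y
          revert y; decide
        rcases h3 with h3 | h3 <;> simp [h3]
      rwa [ZMod.natCast_eq_zero_iff_even] at h2
  obtain ⟨g, hg⟩ := LinearMap.exists_leftInverse_of_injective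
    (Finsupp.linearCombination (ZMod 2) v) (LinearMap.ker_eq_bot.2 hli)
  let φ : (J × C → ZMod 2) →ₗ[ZMod 2] W :=
    (Finsupp.linearCombination (ZMod 2) fun x : S => z x) ∘ₗ g
  have hφ : ∀ x : S, φ (v x) = z x := fun x => by
    have h1 := LinearMap.congr_fun hg (Finsupp.single x 1)
    rw [LinearMap.comp_apply, Finsupp.linearCombination_single, one_smul] at h1
    simp [φ, h1]
  refine ⟨fun j c => φ (Pi.single (j, c) 1), fun x hx => ?_⟩
  rw [← hφ ⟨x, hx⟩, map_sum]

end LinearAlgebra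

/-- The value of a random function at one point may be chosen anew. -/
theorem expect_eq_expect_update {U Y : Type*} [Fintype U] [DecidableEq U] [Fintype Y] [Nonempty Y]
    (x : U) (φ : (U → Y) → ℝ) :
    𝔼 f, φ f = 𝔼 f, 𝔼 y, φ (Function.update f x y) := by
  have hup : ∀ (y y' : Y) (r : {j // j ≠ x} → Y),
      Function.update ((Equiv.funSplitAt x Y).symm (y', r)) x y
        = (Equiv.funSplitAt x Y).symm (y, r) := fun y y' r => by
    ext j
    by_cases hj : j = x
    · subst hj; simp
    · simp [hj]
  rw [← Fintype.expect_equiv (Equiv.funSplitAt x Y).symm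
      (fun q => φ ((Equiv.funSplitAt x Y).symm q)) φ fun _ => rfl,
    ← Fintype.expect_equiv (Equiv.funSplitAt x Y).symm
      (fun q => 𝔼 y, φ (Function.update ((Equiv.funSplitAt x Y).symm q) x y)) _ fun _ => rfl,
    expect_prod, expect_prod]
  simp_rw [hup]
  rw [Fintype.expect_const, Finset.expect_comm]

section EvenSets

variable {U Y : Type*} [DecidableEq Y]

theorem evenOn_update [DecidableEq U] {X : Finset U} {x : U} (hx : x ∉ X) (f : U → Y) (c : Y) :
    EvenOn X (Function.update f x c) ↔ EvenOn X f := by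
  refine forall_congr' fun d => ?_
  have h : (X.filter fun y => Function.update f x c y = d) = X.filter fun y => f y = d :=
    Finset.filter_congr fun y hy => by
      rw [Function.update_of_ne]
      rintro rfl
      exact hx hy
  rw [h]

theorem not_evenOn_of_card_eq_one {X : Finset U} (hX : X.card = 1) (f : U → Y) : ¬ EvenOn X f := by
  obtain ⟨x, rfl⟩ := Finset.card_eq_one.1 hX
  intro h
  have h1 := h (f x)
  rw [Finset.filter_singleton, if_pos rfl, Finset.card_singleton] at h1
  exact absurd h1 (by decide)

/-- Each point of an even set has a partner with the same value; the two can be removed. -/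
theorem EvenOn.exists_partner [DecidableEq U] {X : Finset U} {x : U} (hx : x ∈ X) {f : U → Y}
    (h : EvenOn X f) :
    ∃ y ∈ X.erase x, f x = f y ∧ EvenOn ((X.erase x).erase y) f := by
  have h1 := h (f x)
  have hmem : x ∈ X.filter fun y => f y = f x := by simp [hx]
  have h2 : ∃ y ∈ (X.filter fun y => f y = f x), y ≠ x := by
    apply Finset.exists_mem_ne
    have := Finset.card_pos.2 ⟨x, hmem⟩
    rcases h1 with ⟨r, hr⟩
    omega
  obtain ⟨y, hy, hyx⟩ := h2
  rw [Finset.mem_filter] at hy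
  have hy' : y ∈ X.erase x := Finset.mem_erase.2 ⟨hyx, hy.1⟩
  refine ⟨y, hy', hy.2.symm, fun c => ?_⟩
  rw [Finset.filter_erase, Finset.filter_erase]
  by_cases hc : f x = c
  · have hxm : x ∈ X.filter fun z => f z = c := by simp [hx, hc]
    have hym : y ∈ (X.filter fun z => f z = c).erase x := by simp [hy.1, hyx, hy.2, hc]
    rw [Finset.card_erase_of_mem hym, Finset.card_erase_of_mem hxm]
    obtain ⟨r, hr⟩ := h c
    exact ⟨r - 1, by omega⟩
  · rw [Finset.erase_eq_of_notMem (a := x), Finset.erase_eq_of_notMem]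
    · exact h c
    · simp [hy.2, hc]
    · simp [hc]

variable [Fintype U] [DecidableEq U] [Fintype Y] [Nonempty Y]

/-- If the event `A` does not depend on the value at `x`, then it is independent of the event that
`x` and `y` have equal values. -/
theorem prob_eq_and {x y : U} (hxy : y ≠ x) (A : (U → Y) → Prop)
    (hA : ∀ f c, A (Function.update f x c) ↔ A f) :
    prob (fun f : U → Y => f x = f y ∧ A f) = 1 / Fintype.card Y * prob A := by
  classical
  unfold prob
  rw [expect_eq_expect_update x, Finset.mul_expect]
  refine Finset.expect_congr rfl fun f _ => ?_
  have h1 := prob_eq_const (f y)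
  unfold prob at h1
  rw [← h1, Finset.expect_mul]
  refine Finset.expect_congr rfl fun c _ => ?_
  simp only [Function.update_self, Function.update_of_ne hxy, hA]
  by_cases h1 : c = f y <;> by_cases h2 : A f <;> simp [h1, h2]

/-- A random function is even on a set of `s` points only if the points are matched into pairs with
equal values; there are `(s - 1) * (s - 3) * ⋯ * 1` matchings, the square of which is at most
`s!`. -/
theorem prob_evenOn_sq_le (X : Finset U) :
    prob (fun f : U → Y => EvenOn X f) ^ 2
      ≤ (X.card.factorial : ℝ) / (Fintype.card Y : ℝ) ^ X.card := by
  induction hs : X.card using Nat.strong_induction_on generalizing X with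
  | _ s ih =>
    have hm : (0 : ℝ) < Fintype.card Y := by exact_mod_cast Fintype.card_pos
    rcases s with _ | _ | s
    · simpa using pow_le_one₀ (n := 2) (prob_nonneg _)
        (prob_le_one fun f : U → Y => EvenOn X f)
    · have : prob (fun f : U → Y => EvenOn X f) = 0 := prob_eq_zero fun f =>
        not_evenOn_of_card_eq_one hs f
      rw [this, zero_pow two_ne_zero]
      positivity
    · obtain ⟨x, hx⟩ := Finset.card_pos.1 (by omega : 0 < X.card)
      set K : ℝ := √((s.factorial : ℝ) / (Fintype.card Y : ℝ) ^ s) with hK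
      have hK2 : K ^ 2 = (s.factorial : ℝ) / (Fintype.card Y : ℝ) ^ s :=
        Real.sq_sqrt (by positivity)
      have h1 : prob (fun f : U → Y => EvenOn X f) ≤ (s + 1) * (1 / Fintype.card Y * K) := by
        calc prob (fun f : U → Y => EvenOn X f)
            ≤ prob fun f : U → Y => ∃ y ∈ X.erase x, f x = f y ∧ EvenOn ((X.erase x).erase y) f :=
              prob_mono fun f h => h.exists_partner hx
          _ ≤ ∑ y ∈ X.erase x, prob fun f : U → Y => f x = f y ∧ EvenOn ((X.erase x).erase y) f :=
              prob_exists_mem_le _ _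
          _ ≤ ∑ y ∈ X.erase x, 1 / Fintype.card Y * K := by
              refine Finset.sum_le_sum fun y hy => ?_
              rw [prob_eq_and (Finset.ne_of_mem_erase hy) _
                fun f c => evenOn_update (by simp) f c]
              gcongr
              have hc : ((X.erase x).erase y).card = s := by
                rw [Finset.card_erase_of_mem hy, Finset.card_erase_of_mem hx]
                omega
              exact Real.le_sqrt_of_sq_le (ih s (by omega) _ hc)
          _ = _ := by
              rw [Finset.sum_const, Finset.card_erase_of_mem hx, hs, nsmul_eq_mul]
              push_cast
              simp
      calc prob (fun f : U → Y => EvenOn X f) ^ 2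
          ≤ ((s + 1) * (1 / Fintype.card Y * K)) ^ 2 := by
            gcongr
            exact prob_nonneg _
        _ = (s + 1) * (s + 1) * s.factorial / (Fintype.card Y : ℝ) ^ (s + 2) := by
            rw [mul_pow, mul_pow, hK2, pow_add]
            field_simp
        _ ≤ _ := by
            rw [Nat.factorial_succ, Nat.factorial_succ]
            push_cast
            have hf : (0 : ℝ) ≤ (s + 1) * s.factorial := by positivity
            gcongr ?_ / _
            nlinarith

theorem factorial_mul_sq_le {s q : ℕ} (h2 : 2 ≤ s) (hq : s ≤ q) :
    s.factorial * q ^ 2 ≤ 2 * q ^ s := by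
  induction s, h2 using Nat.le_induction with
  | base => simp
  | succ s hs ih =>
    rw [Nat.factorial_succ, pow_succ]
    calc (s + 1) * s.factorial * q ^ 2 = (s + 1) * (s.factorial * q ^ 2) := by ring
      _ ≤ q * (2 * q ^ s) := Nat.mul_le_mul hq (ih (by omega))
      _ = _ := by ring

/-- Four independent random functions from at most `q` points to `4 * q` values are unlikely to be
even on a common nonempty set. The sets of size `s` contribute at most
`q ^ s / s! * (s! / (4 * q) ^ s) ^ 2`, which decreases geometrically. -/
theorem prob_exists_evenOn_le {q : ℕ} (hq : 0 < q) (hU : Fintype.card U ≤ q)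
    (hY : Fintype.card Y = 4 * q) :
    prob (fun f : Fin 4 → U → Y => ∃ X : Finset U, X.Nonempty ∧ ∀ j, EvenOn X (f j))
      ≤ 32 / 15 / (q : ℝ) ^ 2 := by
  have hq0 : (0 : ℝ) < q := by exact_mod_cast hq
  -- the bound for a single set with `s` points; a set with one point is never even
  let g : ℕ → ℝ := fun s => if 2 ≤ s then ((s.factorial : ℝ) / (4 * q) ^ s) ^ 2 else 0
  have hg : ∀ X : Finset U, X.Nonempty →
      prob (fun f : Fin 4 → U → Y => ∀ j, EvenOn X (f j)) ≤ g X.card := fun X hX => by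
    rw [prob_forall_pi (fun (_ : Fin 4) (f : U → Y) => EvenOn X f)]
    simp only [Finset.prod_const, Finset.card_univ, Fintype.card_fin]
    by_cases h2 : 2 ≤ X.card
    · simp only [g, if_pos h2]
      have := prob_evenOn_sq_le (Y := Y) X
      rw [hY] at this
      push_cast at this
      calc _ = (prob (fun f : U → Y => EvenOn X f) ^ 2) ^ 2 := by ring
        _ ≤ _ := by gcongr
    · have : X.card = 1 := by have := Finset.card_pos.2 hX; omega
      rw [prob_eq_zero fun f => not_evenOn_of_card_eq_one this f]
      simp [g, h2]
  calc _ ≤ prob (fun f : Fin 4 → U → Y => ∃ X ∈ (Finset.univ : Finset (Finset U)).filter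
            (fun X => X.Nonempty), ∀ j, EvenOn X (f j)) :=
        prob_mono fun f ⟨X, hX, h⟩ => ⟨X, by simpa using hX, h⟩
    _ ≤ ∑ X ∈ (Finset.univ : Finset (Finset U)).filter (fun X => X.Nonempty), g X.card :=
        (prob_exists_mem_le _ _).trans (Finset.sum_le_sum fun X hX => hg X (by simpa using hX))
    _ ≤ ∑ X ∈ (Finset.univ : Finset U).powerset, g X.card := by
        refine Finset.sum_le_sum_of_subset_of_nonneg (by simp) fun X _ _ => ?_
        simp only [g]; split_ifs <;> positivity
    _ = ∑ s ∈ Finset.range (Fintype.card U + 1), (Fintype.card U).choose s • g s := by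
        rw [Finset.sum_powerset_apply_card, Finset.card_univ]
    _ ≤ ∑ s ∈ Finset.range (Fintype.card U + 1), 2 / (q : ℝ) ^ 2 * (1 / 16) ^ s := by
        refine Finset.sum_le_sum fun s hs => ?_
        have hsU : s ≤ q := by have := Finset.mem_range.1 hs; omega
        simp only [g]
        split_ifs with h2
        · have hc : ((Fintype.card U).choose s : ℝ) * s.factorial ≤ (q : ℝ) ^ s := by
            have h1 : (Fintype.card U).choose s * s.factorial ≤ q ^ s := by
              rw [mul_comm, ← Nat.descFactorial_eq_factorial_mul_choose]
              exact (Nat.descFactorial_le_pow _ _).trans (Nat.pow_le_pow_left hU s)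
            exact_mod_cast h1
          have hf : (s.factorial : ℝ) * q ^ 2 ≤ 2 * q ^ s := by
            exact_mod_cast factorial_mul_sq_le h2 hsU
          have hf' : (s.factorial : ℝ) ≤ 2 * q ^ s / q ^ 2 := by
            rw [le_div_iff₀ (by positivity)]; exact hf
          rw [nsmul_eq_mul]
          calc ((Fintype.card U).choose s : ℝ) * ((s.factorial : ℝ) / (4 * q) ^ s) ^ 2
              = ((Fintype.card U).choose s * s.factorial) * s.factorial / ((4 * q) ^ s) ^ 2 := by
                ring
            _ ≤ (q : ℝ) ^ s * (2 * q ^ s / q ^ 2) / ((4 * q) ^ s) ^ 2 := by gcongr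
            _ = 2 / (q : ℝ) ^ 2 * (1 / 16) ^ s := by
                rw [mul_pow, one_div, inv_pow, show (16 : ℝ) = 4 ^ 2 by norm_num, ← pow_mul,
                  mul_comm 2 s, pow_mul]
                field_simp
        · simp only [smul_zero]
          positivity
    _ = 2 / (q : ℝ) ^ 2 * ∑ s ∈ Finset.range (Fintype.card U + 1), (1 / 16 : ℝ) ^ s := by
        rw [Finset.mul_sum]
    _ ≤ 2 / (q : ℝ) ^ 2 * (16 / 15) := by
        gcongr
        refine ((summable_geometric_of_lt_one (by norm_num) (by norm_num)).sum_le_tsum _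
          fun _ _ => by positivity).trans_eq ?_
        rw [tsum_geometric_of_lt_one (by norm_num) (by norm_num)]
        norm_num
    _ = _ := by ring

end EvenSets

/-! ### Hash functions that are uniformly random on a set -/

/-- The tables `t` can be filled so that `F t` takes any prescribed values on `S`. -/
def Interpolates {T U W : Type*} (F : T → U → W) (S : Finset U) : Prop :=
  ∀ z : U → W, ∃ t, ∀ x ∈ S, F t x = z x

/-- A function that depends additively on its tables, and can interpolate on `S`, is uniformly
random on `S` for random tables. -/
theorem Interpolates.expect_eq {T U W : Type*} [Fintype T] [AddCommGroup T] [Fintype W]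
    [AddCommGroup W] [DecidableEq U] {F : T → U → W} {S : Finset U} (hF : Interpolates F S)
    (hadd : ∀ t t' x, F (t + t') x = F t x + F t' x) (φ : (S → W) → ℝ) :
    𝔼 t, φ (fun x => F t x) = 𝔼 u, φ u := by
  let Φ : T →+ (S → W) := AddMonoidHom.mk' (fun t (x : S) => F t x) fun t t' =>
    funext fun x => hadd t t' x
  refine expect_comp_eq_of_surjective Φ (fun z => ?_) φ
  obtain ⟨t, ht⟩ := hF fun x => if h : x ∈ S then z ⟨x, h⟩ else 0
  exact ⟨t, funext fun x => (ht x x.2).trans (dif_pos x.2)⟩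

section Inner

variable {U X C W : Type} [AddCommGroup W] {g : X → U → C}

/-- The sum of four tables, each addressed by a hash function. -/
def tableSum (g : X → U → C) (b : Fin 4 → X) (t : Fin 4 → C → W) (x : U) : W :=
  ∑ l, t l (g (b l) x)

theorem tableSum_add (b : Fin 4 → X) (t t' : Fin 4 → C → W) (x : U) :
    tableSum g b (t + t') x = tableSum g b t x + tableSum g b t' x := by
  simp [tableSum, Finset.sum_add_distrib]

/-- One injective hash function suffices: the other tables can be left zero. -/
theorem interpolates_tableSum {b : Fin 4 → X} {S : Finset U} {l : Fin 4}
    (hl : Set.InjOn (g (b l)) S) : Interpolates (tableSum (W := W) g b) S := by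
  classical
  intro z
  refine ⟨Pi.single l fun c => if h : ∃ x ∈ S, g (b l) x = c then z h.choose else 0,
    fun x hx => ?_⟩
  have hex : ∃ y ∈ S, g (b l) y = g (b l) x := ⟨x, hx, rfl⟩
  rw [tableSum, Finset.sum_eq_single l]
  · rw [Pi.single_eq_same, dif_pos hex]
    exact congrArg z (hl hex.choose_spec.1 hx hex.choose_spec.2)
  · intro j _ hj
    rw [Pi.single_eq_of_ne hj, Pi.zero_apply]
  · simp

/-- The birthday bound for the points of one bucket. -/
theorem KWiseIndependent.prob_not_injOn_le [Fintype X] [Fintype C] [Nonempty C]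
    (hg : KWiseIndependent 4 g) {τ : ℕ}
    (hτ : 0 < τ) (hC : Fintype.card C = 32 * τ ^ 5) (S : Finset U) (hS : S.card ≤ 4 * τ ^ 2) :
    prob (fun a => ¬ Set.InjOn (g a) S) ≤ 1 / (2 * τ) := by
  classical
  have ht : (0 : ℝ) < τ := by exact_mod_cast hτ
  calc prob (fun a => ¬ Set.InjOn (g a) S)
      ≤ prob fun a => ∃ p ∈ S.offDiag, g a p.1 = g a p.2 := prob_mono fun a ha => by
        simp only [Set.InjOn] at ha
        push Not at ha
        obtain ⟨x, hx, y, hy, h1, h2⟩ := ha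
        exact ⟨(x, y), Finset.mem_offDiag.2 ⟨hx, hy, h2⟩, h1⟩
    _ ≤ ∑ p ∈ S.offDiag, prob fun a => g a p.1 = g a p.2 := prob_exists_mem_le _ _
    _ = ∑ _p ∈ S.offDiag, (1 / Fintype.card C : ℝ) := Finset.sum_congr rfl fun p hp =>
        hg.prob_collision (by norm_num) (Finset.mem_offDiag.1 hp).2.2
    _ ≤ (4 * τ ^ 2) * (4 * τ ^ 2) * (1 / Fintype.card C : ℝ) := by
        rw [Finset.sum_const, nsmul_eq_mul]
        gcongr
        have : S.offDiag.card ≤ (4 * τ ^ 2) * (4 * τ ^ 2) := by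
          rw [Finset.offDiag_card]
          exact (Nat.sub_le _ _).trans (Nat.mul_le_mul hS hS)
        exact_mod_cast this
    _ = _ := by
        rw [hC]
        push_cast
        field_simp
        norm_num

end Inner

/-- A map that sends uniformly random families to uniformly random families. -/
def PreservesUniform {W Z : Type} [Fintype W] [Fintype Z] (ρ : W → Z) : Prop :=
  ∀ (ι : Type) [Fintype ι] [DecidableEq ι] (φ : (ι → Z) → ℝ),
    𝔼 u : ι → W, φ (fun i => ρ (u i)) = 𝔼 v, φ v

/-- If for each of the four positions one of the four hash functions is injective on `S`, then the
positions are independent random functions on `S`, and `prob_exists_evenOn_le` applies. -/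
theorem prob_exists_evenOn_tableSum_le {U X C W Z : Type} [DecidableEq U] [Fintype C]
    [DecidableEq C] [Fintype W] [AddCommGroup W] [Fintype Z] [DecidableEq Z] [Nonempty Z]
    {g : X → U → C} {ρ : W → Z} (hρ : PreservesUniform ρ) {q : ℕ} (hq : 0 < q)
    (hZ : Fintype.card Z = 4 * q) {S : Finset U} (hS : S.card ≤ q) {b : Fin 4 → Fin 4 → X}
    (hb : ∀ j, ∃ l, Set.InjOn (g (b j l)) S) :
    prob (fun t : Fin 4 → Fin 4 → C → W => ∃ V ⊆ S, V.Nonempty ∧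
      ∀ j, EvenOn V fun x => ρ (tableSum g (b j) (t j) x)) ≤ 32 / 15 / (q : ℝ) ^ 2 := by
  classical
  let Φ : (Fin 4 → Fin 4 → C → W) →+ (Fin 4 × S → W) :=
    AddMonoidHom.mk' (fun t p => tableSum g (b p.1) (t p.1) p.2) fun t t' =>
      funext fun p => tableSum_add _ _ _ _
  have hΦ : Function.Surjective Φ := fun z => by
    have h1 : ∀ j, ∃ t : Fin 4 → C → W, ∀ x ∈ S, tableSum g (b j) t x =
        if h : x ∈ S then z (j, ⟨x, h⟩) else 0 := fun j => by
      obtain ⟨l, hl⟩ := hb j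
      exact interpolates_tableSum hl _
    choose t ht using h1
    exact ⟨t, funext fun p => (ht p.1 p.2 p.2.2).trans (dif_pos p.2.2)⟩
  let E : (Fin 4 × S → Z) → Prop := fun v => ∃ V : Finset S, V.Nonempty ∧
    ∀ j, EvenOn V fun x => v (j, x)
  have hE : ∀ t, (∃ V ⊆ S, V.Nonempty ∧ ∀ j, EvenOn V fun x => ρ (tableSum g (b j) (t j) x)) →
      E fun p => ρ (Φ t p) := by
    rintro t ⟨V, hVS, hV, heven⟩
    have hmap : (V.subtype (· ∈ S)).map (Function.Embedding.subtype _) = V := by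
      rw [Finset.subtype_map, Finset.filter_true_of_mem fun x hx => hVS hx]
    refine ⟨V.subtype (· ∈ S), ?_, fun j c => ?_⟩
    · rw [← Finset.map_nonempty (f := Function.Embedding.subtype _), hmap]
      exact hV
    · have h1 := heven j c
      rw [← hmap, Finset.filter_map, Finset.card_map] at h1
      exact h1
  have h1 : prob (fun t => E fun p => ρ (Φ t p)) = prob fun u : Fin 4 × S → W =>
      E fun p => ρ (u p) :=
    prob_comp_eq_of_surjective Φ hΦ fun u => E fun p => ρ (u p)
  have h2 : prob (fun u : Fin 4 × S → W => E fun p => ρ (u p)) = prob E :=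
    hρ (Fin 4 × S) fun v => @ite ℝ (E v) (Classical.propDecidable _) 1 0
  have h3 : prob (fun f : Fin 4 → S → Z => ∃ V : Finset S, V.Nonempty ∧ ∀ j, EvenOn V (f j))
      = prob E := by
    rw [← prob_equiv (Equiv.curry (Fin 4) S Z).symm E]
    exact prob_congr fun f => by simp only [E, Equiv.curry_symm_apply, Function.uncurry]
  refine (prob_mono hE).trans ?_
  rw [h1, h2, ← h3]
  exact prob_exists_evenOn_le hq (by simpa using hS) hZ

section Copy

variable {U X C W Y Z : Type} [DecidableEq C] [AddCommGroup W] [Module (ZMod 2) W] [DecidableEq Y]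
  [DecidableEq Z]
  {h : X → U → Y} {g : X → U → C} {ρ : W → Z} {cell : Y → Z → C}

/-- The random choices that determine the table positions: the coefficients of the hash function
that splits the points into buckets, and the coefficients and tables of the hash functions that
give the positions within a bucket. -/
abbrev PositionSeed (X C W : Type) : Type := X × (Fin 4 → Fin 4 → X) × (Fin 4 → Fin 4 → C → W)

/-- The `j`-th table position of a point. -/
def position (h : X → U → Y) (g : X → U → C) (ρ : W → Z) (cell : Y → Z → C)
    (s : PositionSeed X C W) (j : Fin 4) (x : U) : C :=
  cell (h s.1 x) (ρ (tableSum g (s.2.1 j) (s.2.2 j) x))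

/-- The sum of the entries of four tables at the positions of a point. -/
def bucketHash (h : X → U → Y) (g : X → U → C) (ρ : W → Z) (cell : Y → Z → C)
    (s : PositionSeed X C W) (T : Fin 4 → C → W) (x : U) : W :=
  ∑ j, T j (position h g ρ cell s j x)

/-- If `bucketHash` does not interpolate, then some bucket contains a nonempty set on which all four
position functions are even. -/
theorem exists_evenOn_of_not_interpolates (hcell : Function.Injective2 cell)
    {s : PositionSeed X C W} {S : Finset U}
    (hs : ¬ Interpolates (bucketHash h g ρ cell s) S) :
    ∃ i, ∃ V ⊆ S.filter fun x => h s.1 x = i, V.Nonempty ∧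
      ∀ j, EvenOn V fun x => ρ (tableSum g (s.2.1 j) (s.2.2 j) x) := by
  have : ¬ ∀ V ⊆ S, V.Nonempty → ¬ ∀ j, EvenOn V (position h g ρ cell s j) := fun hV =>
    hs fun z => exists_tables_eq _ S hV z
  push Not at this
  obtain ⟨V, hVS, ⟨x₀, hx₀⟩, heven⟩ := this
  refine ⟨h s.1 x₀, V.filter fun x => h s.1 x = h s.1 x₀, Finset.filter_subset_filter _ hVS,
    ⟨x₀, by simp [hx₀]⟩, fun j c => ?_⟩
  have h1 := heven j (cell (h s.1 x₀) c)
  rw [Finset.filter_filter]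
  have h2 : (V.filter fun x => h s.1 x = h s.1 x₀ ∧
      ρ (tableSum g (s.2.1 j) (s.2.2 j) x) = c) =
      V.filter fun x => position h g ρ cell s j x = cell (h s.1 x₀) c :=
    Finset.filter_congr fun x _ => by
      rw [position]
      exact ⟨fun hh => by rw [hh.1, hh.2], fun hh => hcell hh⟩
  rw [h2]
  exact h1

variable [DecidableEq U] [Fintype X] [Fintype C] [Fintype W] [Fintype Y] [Fintype Z]

/-- The function `bucketHash` is uniformly random on a given set of at most `τ ^ 5` points, except
with probability `1 / τ`. The exceptions are an overflowing bucket (`O`), a bucket on which the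
arguments of some position are not separated by any of its four hash functions (not `I`), and a
nonempty set in a bucket on which all positions are even (`E`). -/
theorem prob_not_interpolates_le [Nonempty C] [Nonempty Y] [Nonempty Z] [Nonempty X]
    (hh : KWiseIndependent 4 h) (hg : KWiseIndependent 4 g) (hρ : PreservesUniform ρ)
    (hcell : Function.Injective2 cell) {τ : ℕ} (hτ : 0 < τ) (hY : Fintype.card Y = τ ^ 3)
    (hZ : Fintype.card Z = 16 * τ ^ 2) (hC : Fintype.card C = 32 * τ ^ 5) (S : Finset U)
    (hS : S.card ≤ τ ^ 5) :
    prob (fun s : PositionSeed X C W => ¬ Interpolates (bucketHash h g ρ cell s) S) ≤ 1 / τ := by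
  have ht : (0 : ℝ) < τ := by exact_mod_cast hτ
  let bucket : X → Y → Finset U := fun a i => S.filter fun x => h a x = i
  let O : X → Prop := fun a => ∃ i : Y, 4 * τ ^ 2 < (bucket a i).card
  let I : X → Y → (Fin 4 → Fin 4 → X) → Prop := fun a i b =>
    ∀ j, ∃ l, Set.InjOn (g (b j l)) (bucket a i)
  let E : X → Y → (Fin 4 → Fin 4 → X) → (Fin 4 → Fin 4 → C → W) → Prop := fun a i b t =>
    ∃ V ⊆ bucket a i, V.Nonempty ∧ ∀ j, EvenOn V fun x => ρ (tableSum g (b j) (t j) x)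
  have hbad : ∀ s : PositionSeed X C W, ¬ Interpolates (bucketHash h g ρ cell s) S →
      O s.1 ∨ ((¬ O s.1 ∧ ∃ i ∈ Finset.univ, ¬ I s.1 i s.2.1) ∨
        (¬ O s.1 ∧ ∃ i ∈ Finset.univ, I s.1 i s.2.1 ∧ E s.1 i s.2.1 s.2.2)) := fun s hs => by
    by_cases hO : O s.1
    · exact Or.inl hO
    · obtain ⟨i, hi⟩ := exists_evenOn_of_not_interpolates hcell hs
      by_cases hI : I s.1 i s.2.1
      · exact Or.inr (Or.inr ⟨hO, i, Finset.mem_univ _, hI, hi⟩)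
      · exact Or.inr (Or.inl ⟨hO, i, Finset.mem_univ _, hI⟩)
  have h1 : prob (fun s : PositionSeed X C W => O s.1) ≤ (4 / 81) * (1 / τ) := by
    rw [prob_fst]
    exact hh.prob_overflow_le hτ hY S hS
  have h2 : prob (fun s : PositionSeed X C W => ¬ O s.1 ∧ ∃ i ∈ Finset.univ, ¬ I s.1 i s.2.1)
      ≤ (1 / 4) * (1 / τ) := by
    refine prob_prod_le fun a => ?_
    rw [prob_fst (Ω := Fin 4 → Fin 4 → X) fun b => ¬ O a ∧ ∃ i ∈ Finset.univ, ¬ I a i b]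
    by_cases hO : O a
    · rw [prob_eq_zero fun b => by tauto]
      positivity
    have hcard : ∀ i, (bucket a i).card ≤ 4 * τ ^ 2 := fun i => not_lt.1 fun hlt => hO ⟨i, hlt⟩
    have h3 : ∀ i, prob (fun b => ¬ I a i b) ≤ 4 * (1 / (2 * τ)) ^ 4 := fun i =>
      calc prob (fun b => ¬ I a i b)
          ≤ prob fun b : Fin 4 → Fin 4 → X =>
              ∃ j ∈ Finset.univ, ∀ l, ¬ Set.InjOn (g (b j l)) (bucket a i) :=
            prob_mono fun b hb => by
              simp only [I] at hb
              push Not at hb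
              obtain ⟨j, hj⟩ := hb
              exact ⟨j, Finset.mem_univ _, hj⟩
        _ ≤ ∑ j : Fin 4, prob fun b : Fin 4 → Fin 4 → X =>
              ∀ l, ¬ Set.InjOn (g (b j l)) (bucket a i) := prob_exists_mem_le _ _
        _ ≤ ∑ _j : Fin 4, (1 / (2 * τ : ℝ)) ^ 4 := Finset.sum_le_sum fun j _ => by
            -- only the coefficients with index `j` matter
            let D : (Fin 4 → X) → Prop := fun b => ∀ l, ¬ Set.InjOn (g (b l)) (bucket a i)
            have h4 := prob_forall_pi fun (j' : Fin 4) (b : Fin 4 → X) => j' = j → D b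
            have h5 : prob (fun b : Fin 4 → Fin 4 → X => D (b j))
                = prob fun b : Fin 4 → Fin 4 → X => ∀ j', j' = j → D (b j') :=
              prob_congr fun b => by simp
            have h6 : prob D ≤ (1 / (2 * τ : ℝ)) ^ 4 := by
              have h7 := prob_forall_pi fun (_ : Fin 4) (c : X) =>
                ¬ Set.InjOn (g c) (bucket a i)
              rw [h7, Finset.prod_const, Finset.card_univ, Fintype.card_fin]
              exact pow_le_pow_left₀ (prob_nonneg _)
                (hg.prob_not_injOn_le hτ hC _ (hcard i)) 4
            change prob (fun b : Fin 4 → Fin 4 → X => D (b j)) ≤ _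
            rw [h5, h4, Finset.prod_eq_single j]
            · exact (prob_mono fun b hb => hb rfl).trans h6
            · intro j' _ hj'
              refine (prob_congr (q := fun _ => True) fun b => by simp [hj']).trans ?_
              simp [prob]
            · simp
        _ = _ := by simp
    calc _ ≤ prob fun b => ∃ i ∈ Finset.univ, ¬ I a i b := prob_mono fun b hb => hb.2
      _ ≤ ∑ i, prob fun b => ¬ I a i b := prob_exists_mem_le _ _
      _ ≤ ∑ _i : Y, 4 * (1 / (2 * τ : ℝ)) ^ 4 := Finset.sum_le_sum fun i _ => h3 i
      _ = _ := by
        rw [Finset.sum_const, Finset.card_univ, hY, nsmul_eq_mul]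
        push_cast
        field_simp
        norm_num
  have h3 : prob (fun s : PositionSeed X C W => ¬ O s.1 ∧ ∃ i ∈ Finset.univ,
      I s.1 i s.2.1 ∧ E s.1 i s.2.1 s.2.2) ≤ (2 / 15) * (1 / τ) := by
    refine prob_prod_le fun a => prob_prod_le fun b => ?_
    by_cases hO : O a
    · rw [prob_eq_zero fun t => by tauto]
      positivity
    have hcard : ∀ i, (bucket a i).card ≤ 4 * τ ^ 2 := fun i => not_lt.1 fun hlt => hO ⟨i, hlt⟩
    calc _ ≤ prob fun t => ∃ i ∈ Finset.univ, I a i b ∧ E a i b t := prob_mono fun t ht => ht.2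
      _ ≤ ∑ i, prob fun t => I a i b ∧ E a i b t := prob_exists_mem_le _ _
      _ ≤ ∑ _i : Y, 32 / 15 / ((4 * τ ^ 2 : ℕ) : ℝ) ^ 2 := Finset.sum_le_sum fun i _ => by
          by_cases hI : I a i b
          · exact (prob_mono fun t ht => ht.2).trans (prob_exists_evenOn_tableSum_le hρ
              (by positivity) (by rw [hZ]; ring) (hcard i) hI)
          · rw [prob_eq_zero fun t => by tauto]
            positivity
      _ = _ := by
        rw [Finset.sum_const, Finset.card_univ, hY, nsmul_eq_mul]
        push_cast
        field_simp
        norm_num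
  have hpos : (0 : ℝ) < 1 / τ := by positivity
  calc _ ≤ _ := prob_mono hbad
    _ ≤ _ := prob_or_le _ _
    _ ≤ _ := add_le_add h1 ((prob_or_le _ _).trans (add_le_add h2 h3))
    _ ≤ 1 / τ := by linarith

/-- The random choices of `L` independent copies of `bucketHash`. -/
abbrev RoundSeed (L : ℕ) (X C W : Type) : Type :=
  Fin L → PositionSeed X C W × (Fin 4 → C → W)

/-- The sum of `L` independent copies of `bucketHash`. -/
def sumHash (h : X → U → Y) (g : X → U → C) (ρ : W → Z) (cell : Y → Z → C) {L : ℕ}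
    (ω : RoundSeed L X C W) (x : U) : W :=
  ∑ l, bucketHash h g ρ cell (ω l).1 (ω l).2 x

/-- A sum of independent copies is uniformly random on a set as soon as one of them is, so that the
error decreases exponentially with the number of copies. -/
theorem expect_sumHash_le [Nonempty C] [Nonempty Y] [Nonempty Z] [Nonempty X]
    (hh : KWiseIndependent 4 h) (hg : KWiseIndependent 4 g) (hρ : PreservesUniform ρ)
    (hcell : Function.Injective2 cell) {τ : ℕ} (hτ : 0 < τ) (hY : Fintype.card Y = τ ^ 3)
    (hZ : Fintype.card Z = 16 * τ ^ 2) (hC : Fintype.card C = 32 * τ ^ 5) (L : ℕ) (S : Finset U)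
    (hS : S.card ≤ τ ^ 5) (φ : (S → W) → ℝ) (h0 : ∀ u, 0 ≤ φ u) (h1 : ∀ u, φ u ≤ 1) :
    𝔼 ω : RoundSeed L X C W, φ (fun x => sumHash h g ρ cell ω x)
      ≤ (𝔼 u, φ u) + (1 / τ) ^ L := by
  classical
  let F : (Fin L → PositionSeed X C W) → (Fin L → Fin 4 → C → W) → U → W :=
    fun s T x => ∑ l, bucketHash h g ρ cell (s l) (T l) x
  have hadd : ∀ s T T' x, F s (T + T') x = F s T x + F s T' x := fun s T T' x => by
    simp only [F, bucketHash, Pi.add_apply, Finset.sum_add_distrib]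
  have hint : ∀ s, (∃ l, Interpolates (bucketHash h g ρ cell (s l)) S) → Interpolates (F s) S := by
    rintro s ⟨l, hl⟩ z
    obtain ⟨t, ht⟩ := hl z
    refine ⟨Pi.single l t, fun x hx => ?_⟩
    simp only [F]
    rw [Finset.sum_eq_single l]
    · rw [Pi.single_eq_same, ht x hx]
    · intro j _ hj
      simp [Pi.single_eq_of_ne hj, bucketHash]
    · simp
  have hbad : prob (fun s : Fin L → PositionSeed X C W =>
      ∀ l, ¬ Interpolates (bucketHash h g ρ cell (s l)) S) ≤ (1 / τ) ^ L := by
    rw [prob_forall_pi fun (_ : Fin L) (s : PositionSeed X C W) =>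
      ¬ Interpolates (bucketHash h g ρ cell s) S, Finset.prod_const, Finset.card_univ,
      Fintype.card_fin]
    exact pow_le_pow_left₀ (prob_nonneg _)
      (prob_not_interpolates_le hh hg hρ hcell hτ hY hZ hC S hS) L
  calc 𝔼 ω : RoundSeed L X C W, φ (fun x => sumHash h g ρ cell ω x)
      = 𝔼 p : (Fin L → PositionSeed X C W) × (Fin L → Fin 4 → C → W), φ (fun x => F p.1 p.2 x) :=
        Fintype.expect_equiv (Equiv.arrowProdEquivProdArrow (Fin L) (fun _ => PositionSeed X C W)
          fun _ => Fin 4 → C → W) _ _ fun ω => rfl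
    _ = 𝔼 s, 𝔼 T, φ (fun x => F s T x) := expect_prod _
    _ ≤ 𝔼 s : Fin L → PositionSeed X C W, ((𝔼 u, φ u) +
          if ∀ l, ¬ Interpolates (bucketHash h g ρ cell (s l)) S then 1 else 0) := by
        refine expect_mono fun s => ?_
        split_ifs with hs
        · have : (0 : ℝ) ≤ 𝔼 u, φ u := Finset.expect_nonneg fun u _ => h0 u
          linarith [expect_le_of_forall_le (f := fun T => φ (fun x => F s T x)) fun T => h1 _]
        · push Not at hs
          rw [(hint s hs).expect_eq (hadd s) φ, add_zero]
    _ = (𝔼 u, φ u) + prob (fun s : Fin L → PositionSeed X C W =>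
          ∀ l, ¬ Interpolates (bucketHash h g ρ cell (s l)) S) := by
        rw [Finset.expect_add_distrib, Fintype.expect_const]
        unfold prob
        congr! 3
    _ ≤ _ := by gcongr

end Copy

/-! ### Feistel networks -/

/-- Up to an error `ε`, the random function `F` takes independent uniform values on every set of at
most `k` points, as seen by all tests with values in `[0, 1]`. -/
def AlmostUniform {Ω V W : Type*} [Fintype Ω] [DecidableEq V] [Fintype W]
    (F : Ω → V → W) (k : ℕ) (ε : ℝ) : Prop :=
  ∀ S : Finset V, S.card ≤ k → ∀ φ : (S → W) → ℝ, (∀ u, 0 ≤ φ u) → (∀ u, φ u ≤ 1) →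
    𝔼 ω, φ (fun x => F ω x) ≤ (𝔼 u, φ u) + ε

theorem AlmostUniform.expect_comp_le {Ω V W ι : Type*} [Fintype Ω] [DecidableEq V] [Fintype W]
    [Fintype ι] [DecidableEq ι] {F : Ω → V → W} {k : ℕ} {ε : ℝ}
    (hF : AlmostUniform F k ε) {p : ι → V} (hp : Function.Injective p)
    (hk : Fintype.card ι ≤ k) (φ : (ι → W) → ℝ) (h0 : ∀ u, 0 ≤ φ u)
    (h1 : ∀ u, φ u ≤ 1) : 𝔼 ω, φ (fun i => F ω (p i)) ≤ (𝔼 u, φ u) + ε := by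
  classical
  let S := Finset.univ.map ⟨p, hp⟩
  let e : ι ≃ S := Equiv.ofBijective (fun i => ⟨p i, Finset.mem_map.2 ⟨i, Finset.mem_univ _, rfl⟩⟩)
    ⟨fun i j h => hp (congrArg Subtype.val h), fun ⟨x, hx⟩ => by
      obtain ⟨i, -, rfl⟩ := Finset.mem_map.1 hx
      exact ⟨i, rfl⟩⟩
  refine (hF S (by simpa [S] using hk) (fun u => φ fun i => u (e i)) (fun u => h0 _)
    fun u => h1 _).trans_eq ?_
  congr 1
  exact Fintype.expect_equiv (e.arrowCongr (Equiv.refl W)).symm _ _ fun u => rfl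

/-- A splitting of the bits of the elements of `V` into a left, a right and an extra part, given by
the projections to these parts; `pL`, `pR` and `pE` bound the probability that a part of a random
element has a given value. -/
structure Splitting (V : Type*) [AddCommGroup V] [Fintype V] (pL pR pE : ℝ) where
  L : V →+ V
  R : V →+ V
  E : V →+ V
  sum_eq : ∀ x, L x + R x + E x = x
  LL : ∀ x, L (L x) = L x
  LR : ∀ x, L (R x) = 0
  LE : ∀ x, L (E x) = 0
  RL : ∀ x, R (L x) = 0
  RR : ∀ x, R (R x) = R x
  RE : ∀ x, R (E x) = 0
  EL : ∀ x, E (L x) = 0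
  ER : ∀ x, E (R x) = 0
  EE : ∀ x, E (E x) = E x
  prob_L : ∀ v, prob (fun u => L u = v) ≤ pL
  prob_E : ∀ v, prob (fun u => E u = v) ≤ pE
  prob_LR : ∀ v, prob (fun u => L u + R u = v) ≤ pL * pR
  prob_RE : ∀ v, prob (fun u => R u + E u = v) ≤ pR * pE

/-- One Feistel round: the part `Q` of `x` is masked with the value of `f` at the part `P`. -/
def feistelRound {V : Type*} [Add V] (P Q : V → V) (f : V → V) (x : V) : V := x + Q (f (P x))

/-- Four Feistel rounds. The first randomizes the right and extra part, in order to avoid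
collisions in the argument of the second; the others change one part each. -/
def feistel {V : Type*} [AddCommGroup V] [Fintype V] {pL pR pE : ℝ} (σ : Splitting V pL pR pE)
    (f₀ f₁ f₂ f₃ : V → V) (x : V) : V :=
  feistelRound (σ.L + σ.R) σ.E f₃ (feistelRound (σ.L + σ.E) σ.R f₂
    (feistelRound (σ.R + σ.E) σ.L f₁ (feistelRound σ.L (σ.R + σ.E) f₀ x)))

section Feistel

variable {V : Type*} [AddCommGroup V] [Fintype V]

open Classical in
/-- The indicator of the event that `p` is not injective. -/
noncomputable def collision {ι V : Type*} (p : ι → V) : ℝ := if Function.Injective p then 0 else 1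

/-- The number of ordered pairs with equal values is at least two if `p` is not injective. -/
theorem collision_le {ι V : Type*} [Fintype ι] [DecidableEq ι] [DecidableEq V] (p : ι → V) :
    collision p ≤ 1 / 2 * ∑ q ∈ (Finset.univ : Finset ι).offDiag,
      if p q.1 = p q.2 then (1 : ℝ) else 0 := by
  unfold collision
  split_ifs with h
  · exact mul_nonneg (by norm_num) (Finset.sum_nonneg fun q _ => by split_ifs <;> norm_num)
  · simp only [Function.Injective] at h
    push Not at h
    obtain ⟨x, y, hxy, hne⟩ := h
    have hsub : ({(x, y), (y, x)} : Finset (ι × ι)) ⊆ (Finset.univ : Finset ι).offDiag := by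
      intro q hq
      simp only [Finset.mem_insert, Finset.mem_singleton] at hq
      rcases hq with rfl | rfl <;> simp [hne, hne.symm]
    have h1 := Finset.sum_le_sum_of_subset_of_nonneg hsub
      (f := fun q => if p q.1 = p q.2 then (1 : ℝ) else 0)
      fun q _ _ => by split_ifs <;> norm_num
    rw [Finset.sum_pair (by simp [hne])] at h1
    simp only [hxy, if_true] at h1
    linarith

theorem expect_collision_le {Ω ι V : Type*} [Fintype Ω] [Fintype ι] [DecidableEq ι] (p : Ω → ι → V)
    (c : ι → ι → ℝ) (h : ∀ x y, x ≠ y → prob (fun ω => p ω x = p ω y) ≤ c x y) :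
    𝔼 ω, collision (p ω) ≤ 1 / 2 * ∑ q ∈ (Finset.univ : Finset ι).offDiag, c q.1 q.2 := by
  classical
  calc 𝔼 ω, collision (p ω) ≤ 𝔼 ω, 1 / 2 * ∑ q ∈ (Finset.univ : Finset ι).offDiag,
        (if p ω q.1 = p ω q.2 then (1 : ℝ) else 0) := expect_mono fun ω => collision_le (p ω)
    _ = 1 / 2 * ∑ q ∈ (Finset.univ : Finset ι).offDiag, prob fun ω => p ω q.1 = p ω q.2 := by
        rw [← Finset.mul_expect, Finset.expect_sum_comm]
        unfold prob
        congr! 4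
    _ ≤ _ := by
        gcongr with q hq
        exact h _ _ (by simpa using hq)

/-- The difference of two independent random elements is uniformly random. -/
theorem prob_sub_eq {ι : Type*} [Fintype ι] [DecidableEq ι] {x y : ι} (hxy : x ≠ y)
    (p : V → Prop) : prob (fun u : ι → V => p (u x - u y)) = prob p := by
  let Φ : (ι → V) →+ V := AddMonoidHom.mk' (fun u => u x - u y) fun u u' => by
    simp only [Pi.add_apply]; abel
  refine prob_comp_eq_of_surjective Φ (fun v => ⟨Pi.single x v, ?_⟩) p
  simp [Φ, hxy.symm]

/-- A round adds fresh random bits, provided that its argument is injective. -/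
theorem AlmostUniform.expect_round_le {Ω ι : Type*} [Fintype Ω] [Nonempty Ω] [Fintype ι]
    [DecidableEq ι] [DecidableEq V] {F : Ω → V → V} {k : ℕ} {ε : ℝ}
    (hF : AlmostUniform F k ε) (hε : 0 ≤ ε) (P Q : V → V)
    (hk : Fintype.card ι ≤ k) (s : ι → V) (φ : (ι → V) → ℝ) (h0 : ∀ u, 0 ≤ φ u)
    (h1 : ∀ u, φ u ≤ 1) :
    𝔼 ω, φ (fun i => feistelRound P Q (F ω) (s i))
      ≤ (𝔼 u : ι → V, φ fun i => s i + Q (u i)) + ε + collision fun i => P (s i) := by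
  unfold collision
  split_ifs with h
  · rw [add_zero]
    exact hF.expect_comp_le h hk (fun u => φ fun i => s i + Q (u i)) (fun u => h0 _) fun u => h1 _
  · have : (0 : ℝ) ≤ 𝔼 u : ι → V, φ fun i => s i + Q (u i) :=
      Finset.expect_nonneg fun u _ => h0 _
    linarith [expect_le_of_forall_le (f := fun ω => φ (fun i => feistelRound P Q (F ω) (s i)))
      fun ω => h1 _]

variable {pL pR pE : ℝ} (σ : Splitting V pL pR pE)

/-- In the idealized network, in which all rounds but the first add fresh random bits, the result
is uniformly random. -/
theorem Splitting.expect_ideal {ι : Type*} [Fintype ι] [DecidableEq ι] (s : ι → V)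
    (φ : (ι → V) → ℝ) :
    𝔼 u₁ : ι → V, 𝔼 u₂ : ι → V, 𝔼 u₃ : ι → V,
      φ (fun i => s i + σ.L (u₁ i) + σ.R (u₂ i) + σ.E (u₃ i)) = 𝔼 u, φ u := by
  let Φ : (ι → V) × (ι → V) × (ι → V) →+ (ι → V) :=
    AddMonoidHom.mk' (fun u i => σ.L (u.1 i) + σ.R (u.2.1 i) + σ.E (u.2.2 i)) fun u u' => by
      ext i
      simp only [Prod.fst_add, Prod.snd_add, Pi.add_apply, map_add]
      abel
  have hΦ : Function.Surjective Φ := fun v => ⟨(v, v, v), funext fun i => σ.sum_eq (v i)⟩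
  calc _ = 𝔼 u : (ι → V) × (ι → V) × (ι → V), φ (s + Φ u) := by
        rw [expect_prod]
        simp_rw [expect_prod]
        simp only [Φ, AddMonoidHom.mk'_apply, Pi.add_def, add_assoc]
    _ = 𝔼 v, φ (s + v) := expect_comp_eq_of_surjective Φ hΦ fun v => φ (s + v)
    _ = _ := Fintype.expect_equiv (Equiv.addLeft s) _ _ fun v => rfl

/-- After the first round, points with different left parts have random differences in the other
parts. -/
theorem AlmostUniform.prob_first_round_le {Ω : Type*} [Fintype Ω] [DecidableEq V]
    {F : Ω → V → V} {k : ℕ} {ε : ℝ} (hF : AlmostUniform F k ε) (hk : 2 ≤ k) {x y : V}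
    (hxy : σ.L x ≠ σ.L y) (Q P : V →+ V) {p : ℝ} (hp : ∀ v, prob (fun u => P (Q u) = v) ≤ p) :
    prob (fun ω => P (feistelRound σ.L Q (F ω) x) = P (feistelRound σ.L Q (F ω) y)) ≤ p + ε := by
  classical
  let A : V → Prop := fun u => P (Q u) = P y - P x
  have h1 := hF.expect_comp_le (p := ![σ.L x, σ.L y]) (fun i j hij => by
    fin_cases i <;> fin_cases j <;> simp_all [eq_comm]) (by simpa using hk)
    (fun u => if A (u 0 - u 1) then 1 else 0) (fun u => by split_ifs <;> norm_num)
    fun u => by split_ifs <;> norm_num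
  have h2 := prob_sub_eq (V := V) (ι := Fin 2) (x := 0) (y := 1) (by decide) A
  have h3 : prob (fun ω => P (feistelRound σ.L Q (F ω) x) = P (feistelRound σ.L Q (F ω) y))
      = prob fun ω => A (F ω (σ.L x) - F ω (σ.L y)) := prob_congr fun ω => by
    simp only [A, feistelRound, map_add, map_sub]
    constructor
    · intro h; rw [sub_eq_sub_iff_add_eq_add, add_comm, h, add_comm]
    · intro h; rw [sub_eq_sub_iff_add_eq_add] at h; rw [add_comm, h, add_comm]
  have h4 : prob (fun ω => A (F ω (σ.L x) - F ω (σ.L y))) ≤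
      prob (fun u : Fin 2 → V => A (u 0 - u 1)) + ε := by
    unfold prob
    convert h1 <;> rfl
  rw [h3]
  linarith [hp (P y - P x)]

section Collisions

variable {Ω : Type*} [Fintype Ω] [Nonempty Ω] [DecidableEq V] {F : Ω → V → V} {k : ℕ} {ε : ℝ}

set_option maxHeartbeats 1000000 in
/-- Four Feistel rounds map a fixed set of points to almost uniformly random values. Here `κ` bounds
the probability that two points collide in the argument of the second or third round: if their left
parts are equal, only the third round is concerned, otherwise the first one has randomized
the other parts. -/
theorem AlmostUniform.expect_feistel_le (hF : AlmostUniform F k ε) (hε : 0 ≤ ε) (hk : 2 ≤ k)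
    (S : Finset V) (hS : S.card = k) {κ : ℝ} (hκL : pL ≤ κ) (hκ : pR * pE + pL * pE ≤ κ)
    (hL0 : 0 ≤ pL) (hL1 : pL ≤ 1) (φ : (S → V) → ℝ) (h0 : ∀ u, 0 ≤ φ u) (h1 : ∀ u, φ u ≤ 1) :
    𝔼 ω₀, 𝔼 ω₁, 𝔼 ω₂, 𝔼 ω₃, φ (fun x => feistel σ (F ω₀) (F ω₁) (F ω₂) (F ω₃) x)
      ≤ (𝔼 u, φ u) + 3 * ε + (k * (k - 1)) / 2 * (κ + 2 * ε + pL * pR) := by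
  classical
  have hcard : Fintype.card S ≤ k := by simp [hS]
  let s₁ : Ω → S → V := fun ω x => feistelRound σ.L (σ.R + σ.E) (F ω) x
  let c₁ : (S → V) → ℝ := fun s => collision fun i => (⇑σ.R + ⇑σ.E) (s i)
  let c₂ : (S → V) → ℝ := fun s => collision fun i => (⇑σ.L + ⇑σ.E) (s i)
  let c₃ : (S → V) → ℝ := fun s => collision fun i => (⇑σ.L + ⇑σ.R) (s i)
  let φ₃ : (S → V) → ℝ := fun s => 𝔼 ω, φ fun x => feistelRound (σ.L + σ.R) σ.E (F ω) (s x)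
  let φ₂ : (S → V) → ℝ := fun s => 𝔼 ω, φ₃ fun x => feistelRound (σ.L + σ.E) σ.R (F ω) (s x)
  have r₃ : ∀ s, φ₃ s ≤ (𝔼 u : S → V, φ fun i => s i + σ.E (u i)) + ε + c₃ s := fun s =>
    hF.expect_round_le hε (σ.L + σ.R) σ.E hcard s φ h0 h1
  have h0₃ : ∀ s, 0 ≤ φ₃ s := fun s => Finset.expect_nonneg fun u _ => h0 _
  have h1₃ : ∀ s, φ₃ s ≤ 1 := fun s => expect_le_of_forall_le fun u => h1 _
  have r₂ : ∀ s, φ₂ s ≤ (𝔼 u : S → V, φ₃ fun i => s i + σ.R (u i)) + ε + c₂ s := fun s =>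
    hF.expect_round_le hε (σ.L + σ.E) σ.R hcard s φ₃ h0₃ h1₃
  have h0₂ : ∀ s, 0 ≤ φ₂ s := fun s => Finset.expect_nonneg fun u _ => h0₃ _
  have h1₂ : ∀ s, φ₂ s ≤ 1 := fun s => expect_le_of_forall_le fun u => h1₃ _
  have r₁ : ∀ s : S → V, 𝔼 ω, φ₂ (fun x => feistelRound (σ.R + σ.E) σ.L (F ω) (s x))
      ≤ (𝔼 u : S → V, φ₂ fun i => s i + σ.L (u i)) + ε + c₁ s := fun s =>
    hF.expect_round_le hε (σ.R + σ.E) σ.L hcard s φ₂ h0₂ h1₂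
  -- the number of ordered pairs of different points
  have hpairs : ((Finset.univ : Finset S).offDiag.card : ℝ) = k * (k - 1) := by
    rw [Finset.offDiag_card, Finset.card_univ, Fintype.card_coe, hS,
      Nat.cast_sub (Nat.le_mul_self k)]
    push_cast; ring
  -- collisions in the argument of the last round
  have k₃ : ∀ s : S → V, 𝔼 u₁ : S → V, 𝔼 u₂ : S → V,
      c₃ (fun i => s i + σ.L (u₁ i) + σ.R (u₂ i)) ≤ (k * (k - 1)) / 2 * (pL * pR) := fun s => by
    have hsplit : ∀ u₁ u₂ : S → V, ∀ i, (⇑σ.L + ⇑σ.R) (s i + σ.L (u₁ i) + σ.R (u₂ i))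
        = (σ.L (s i) + σ.R (s i)) + (σ.L (u₁ i) + σ.R (u₂ i)) := fun u₁ u₂ i => by
      simp only [Pi.add_apply, map_add, σ.LL, σ.LR, σ.RL, σ.RR]
      abel
    have hu : 𝔼 u₁ : S → V, 𝔼 u₂ : S → V, c₃ (fun i => s i + σ.L (u₁ i) + σ.R (u₂ i))
        = 𝔼 u : S → V, collision fun i => (σ.L (s i) + σ.R (s i)) + (σ.L (u i) + σ.R (u i)) := by
      have := σ.expect_ideal s fun v => collision fun i => (⇑σ.L + ⇑σ.R) (v i)
      have h2 : ∀ u₁ u₂ : S → V, c₃ (fun i => s i + σ.L (u₁ i) + σ.R (u₂ i)) = 𝔼 u₃ : S → V,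
          collision fun i => (⇑σ.L + ⇑σ.R) (s i + σ.L (u₁ i) + σ.R (u₂ i) + σ.E (u₃ i)) :=
        fun u₁ u₂ => by
          simp only [c₃, Pi.add_apply, map_add, σ.LE, σ.RE, add_zero]
          rw [Fintype.expect_const]
      simp_rw [h2]
      rw [this]
      refine (Fintype.expect_equiv (Equiv.addLeft s) _ _ fun u => ?_).symm
      simp only [Equiv.coe_addLeft, Pi.add_apply, map_add]
      congr 1
      ext i
      abel
    rw [hu]
    refine (expect_collision_le _ (fun _ _ => pL * pR) fun x y hxy => ?_).trans_eq ?_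
    · refine (prob_congr fun u => ?_).trans_le ((prob_sub_eq hxy fun v => σ.L v + σ.R v =
        (σ.L (s y) + σ.R (s y)) - (σ.L (s x) + σ.R (s x))).trans_le (σ.prob_LR _))
      simp only [map_sub]
      constructor
      · intro h
        rw [eq_sub_iff_add_eq]
        have h' := sub_eq_zero.2 h
        rw [← sub_eq_zero, ← h']
        abel
      · intro h
        rw [eq_sub_iff_add_eq] at h
        have h' := sub_eq_zero.2 h
        rw [← sub_eq_zero, ← h']
        abel
    · rw [Finset.sum_const, nsmul_eq_mul, hpairs]; ring
  -- collisions in the argument of the third round, for a given result of the first one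
  have k₂ : ∀ s : S → V, 𝔼 u₁ : S → V, c₂ (fun i => s i + σ.L (u₁ i)) ≤ 1 / 2 *
      ∑ q ∈ (Finset.univ : Finset S).offDiag,
        pL * if σ.E (s q.1) = σ.E (s q.2) then 1 else 0 := fun s => by
    refine expect_collision_le _ (fun x y => pL * if σ.E (s x) = σ.E (s y) then 1 else 0)
      fun x y hxy => ?_
    have himp : ∀ u : S → V, (⇑σ.L + ⇑σ.E) (s x + σ.L (u x)) = (⇑σ.L + ⇑σ.E) (s y + σ.L (u y)) →
        σ.E (s x) = σ.E (s y) ∧ σ.L (u x - u y) = σ.L (s y) - σ.L (s x) := fun u h => by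
      have hE := congrArg σ.E h
      have hL := congrArg σ.L h
      simp only [Pi.add_apply, map_add, σ.EL, σ.EE, add_zero, zero_add, σ.LL, σ.LE] at hE hL
      refine ⟨hE, ?_⟩
      rw [map_sub, sub_eq_sub_iff_add_eq_add, add_comm, hL, add_comm]
    by_cases hE : σ.E (s x) = σ.E (s y)
    · rw [if_pos hE, mul_one]
      exact (prob_mono fun u h => (himp u h).2).trans
        ((prob_sub_eq hxy fun v => σ.L v = σ.L (s y) - σ.L (s x)).trans_le (σ.prob_L _))
    · rw [prob_eq_zero fun u h => hE (himp u h).1, if_neg hE, mul_zero]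
  -- collisions in the arguments of the second and third round
  have k₁ : 𝔼 ω, (c₁ (s₁ ω) + 1 / 2 * ∑ q ∈ (Finset.univ : Finset S).offDiag,
      pL * if σ.E (s₁ ω q.1) = σ.E (s₁ ω q.2) then 1 else 0)
      ≤ (k * (k - 1)) / 2 * (κ + 2 * ε) := by
    calc _ ≤ 𝔼 ω, (1 / 2 * ∑ q ∈ (Finset.univ : Finset S).offDiag,
          ((if (σ.R + σ.E) (s₁ ω q.1) = (σ.R + σ.E) (s₁ ω q.2) then (1 : ℝ) else 0) +
            pL * if σ.E (s₁ ω q.1) = σ.E (s₁ ω q.2) then 1 else 0)) := by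
          refine expect_mono fun ω => ?_
          rw [Finset.sum_add_distrib, mul_add]
          gcongr
          exact collision_le _
      _ = 1 / 2 * ∑ q ∈ (Finset.univ : Finset S).offDiag,
          (prob (fun ω => (σ.R + σ.E) (s₁ ω q.1) = (σ.R + σ.E) (s₁ ω q.2)) +
            pL * prob fun ω => σ.E (s₁ ω q.1) = σ.E (s₁ ω q.2)) := by
          rw [← Finset.mul_expect, Finset.expect_sum_comm]
          simp_rw [Finset.expect_add_distrib, ← Finset.mul_expect]
          unfold prob
          beta_reduce
          congr! 7
      _ ≤ 1 / 2 * ∑ _q ∈ (Finset.univ : Finset S).offDiag, (κ + 2 * ε) := by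
          refine mul_le_mul_of_nonneg_left (Finset.sum_le_sum fun q hq => ?_) (by norm_num)
          have hne : (q.1 : V) ≠ q.2 := fun h => (Finset.mem_offDiag.1 hq).2.2 (Subtype.ext h)
          by_cases hL : σ.L q.1 = σ.L q.2
          · have hz : prob (fun ω => (σ.R + σ.E) (s₁ ω q.1) = (σ.R + σ.E) (s₁ ω q.2)) = 0 :=
              prob_eq_zero fun ω h => hne <| by
                simp only [s₁, feistelRound, hL, map_add, add_left_inj] at h
                rw [← σ.sum_eq q.1, ← σ.sum_eq q.2, hL, add_assoc, add_assoc]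
                exact congrArg _ h
            -- equal left parts, hence equal masks in the first round
            have hp := prob_le_one fun ω => σ.E (s₁ ω q.1) = σ.E (s₁ ω q.2)
            rw [hz]
            nlinarith
          · have ha := hF.prob_first_round_le σ hk hL (σ.R + σ.E) (σ.R + σ.E) (p := pR * pE)
              fun v => by
                refine (prob_congr fun u => ?_).trans_le (σ.prob_RE v)
                simp only [AddMonoidHom.add_apply, map_add, σ.RR, σ.RE, σ.ER, σ.EE, add_zero,
                  zero_add]
            have hb := hF.prob_first_round_le σ hk hL (σ.R + σ.E) σ.E (p := pE) fun v => by
              refine (prob_congr fun u => ?_).trans_le (σ.prob_E v)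
              simp only [AddMonoidHom.add_apply, map_add, σ.ER, σ.EE, zero_add]
            have hb' := mul_le_mul_of_nonneg_left hb hL0
            have hε' : pL * ε ≤ 1 * ε := by gcongr
            refine (add_le_add ha hb').trans ?_
            linarith
      _ = _ := by rw [Finset.sum_const, nsmul_eq_mul, hpairs]; ring
  calc _ = 𝔼 ω₀, 𝔼 ω₁, φ₂ (fun x => feistelRound (σ.R + σ.E) σ.L (F ω₁) (s₁ ω₀ x)) := rfl
    _ ≤ 𝔼 ω₀, ((𝔼 u₁ : S → V, φ₂ fun i => s₁ ω₀ i + σ.L (u₁ i)) + ε + c₁ (s₁ ω₀)) :=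
        expect_mono fun ω₀ => r₁ _
    _ ≤ 𝔼 ω₀, ((𝔼 u₁ : S → V, ((𝔼 u₂ : S → V, ((𝔼 u₃ : S → V, φ fun i =>
          s₁ ω₀ i + σ.L (u₁ i) + σ.R (u₂ i) + σ.E (u₃ i)) + ε +
            c₃ fun i => s₁ ω₀ i + σ.L (u₁ i) + σ.R (u₂ i))) + ε +
              c₂ fun i => s₁ ω₀ i + σ.L (u₁ i))) + ε + c₁ (s₁ ω₀)) := by
        refine expect_mono fun ω₀ => add_le_add (add_le_add (expect_mono fun u₁ =>
          (r₂ _).trans (add_le_add (add_le_add (expect_mono fun u₂ => r₃ _) le_rfl) le_rfl))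
            le_rfl) le_rfl
    _ = 𝔼 ω₀, ((𝔼 u, φ u) + 3 * ε + (𝔼 u₁ : S → V, 𝔼 u₂ : S → V,
          c₃ fun i => s₁ ω₀ i + σ.L (u₁ i) + σ.R (u₂ i)) +
            ((𝔼 u₁ : S → V, c₂ fun i => s₁ ω₀ i + σ.L (u₁ i)) + c₁ (s₁ ω₀))) := by
        refine Finset.expect_congr rfl fun ω₀ _ => ?_
        simp only [Finset.expect_add_distrib, σ.expect_ideal (s₁ ω₀) φ, Fintype.expect_const]
        ring
    _ ≤ 𝔼 ω₀, (((𝔼 u, φ u) + 3 * ε + (k * (k - 1)) / 2 * (pL * pR)) +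
          (c₁ (s₁ ω₀) + 1 / 2 * ∑ q ∈ (Finset.univ : Finset S).offDiag,
            pL * if σ.E (s₁ ω₀ q.1) = σ.E (s₁ ω₀ q.2) then 1 else 0)) :=
        expect_mono fun ω₀ => by linarith [k₂ (s₁ ω₀), k₃ (s₁ ω₀)]
    _ ≤ _ := by
        rw [Finset.expect_add_distrib, Fintype.expect_const]
        linarith

end Collisions

end Feistel

/-- Uniformly random values on `S` differ little from the values of a random permutation. -/
theorem expect_le_expect_perm {V : Type*} [Fintype V] [DecidableEq V] [Nonempty V] (S : Finset V)
    {k : ℕ} (hS : S.card = k) (φ : (S → V) → ℝ) (h0 : ∀ u, 0 ≤ φ u) (h1 : ∀ u, φ u ≤ 1) :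
    𝔼 u, φ u ≤ (𝔼 τ : Equiv.Perm V, φ fun x => τ x)
      + (k * (k - 1)) / 2 * (1 / Fintype.card V) := by
  classical
  have hpairs : ((Finset.univ : Finset S).offDiag.card : ℝ) = k * (k - 1) := by
    rw [Finset.offDiag_card, Finset.card_univ, Fintype.card_coe, hS,
      Nat.cast_sub (Nat.le_mul_self k)]
    push_cast; ring
  have hcol : 𝔼 u : S → V, collision u ≤ (k * (k - 1)) / 2 * (1 / Fintype.card V) := by
    refine (expect_collision_le (fun u : S → V => u) (fun _ _ => 1 / Fintype.card V)
      fun x y hxy => ?_).trans_eq ?_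
    · have h := prob_eq_and (Y := V) hxy.symm (fun _ => True) fun _ _ => Iff.rfl
      refine (prob_congr fun u => (and_true _).symm.to_iff).trans_le (h.trans_le ?_)
      exact mul_le_of_le_one_right (by positivity) (prob_le_one _)
    · rw [Finset.sum_const, nsmul_eq_mul, hpairs]; ring
  -- an injective family extends to a permutation
  have hinj : ∀ u : S → V, Function.Injective u →
      𝔼 τ : Equiv.Perm V, φ (fun x => τ (u x)) = 𝔼 τ : Equiv.Perm V, φ fun x => τ x :=
    fun u hu => by
      let e := Equiv.ofInjective u hu
      let ρ : Equiv.Perm V := Equiv.extendSubtype (p := (· ∈ S)) (q := (· ∈ Set.range u)) e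
      have hρ : ∀ x : S, ρ x = u x := fun x => Equiv.extendSubtype_apply_of_mem e x.1 x.2
      refine Fintype.expect_equiv (Equiv.mulRight ρ) _ _ fun τ => ?_
      simp only [Equiv.coe_mulRight, Equiv.Perm.mul_apply, hρ]
  calc 𝔼 u, φ u = 𝔼 _τ : Equiv.Perm V, 𝔼 u : S → V, φ u := (Fintype.expect_const _).symm
    _ = 𝔼 τ : Equiv.Perm V, 𝔼 u : S → V, φ (fun x => τ (u x)) :=
        Finset.expect_congr rfl fun τ _ =>
          (Fintype.expect_equiv ((Equiv.refl S).arrowCongr τ) _ _ fun u => rfl).symm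
    _ = 𝔼 u : S → V, 𝔼 τ : Equiv.Perm V, φ (fun x => τ (u x)) := Finset.expect_comm _ _ _
    _ ≤ 𝔼 u : S → V, ((𝔼 τ : Equiv.Perm V, φ fun x => τ x) + collision u) := by
        refine expect_mono fun u => ?_
        unfold collision
        split_ifs with hu
        · rw [hinj u hu, add_zero]
        · have : (0 : ℝ) ≤ 𝔼 τ : Equiv.Perm V, φ fun x => τ x :=
            Finset.expect_nonneg fun _ _ => h0 _
          linarith [expect_le_of_forall_le
            (f := fun τ : Equiv.Perm V => φ fun x => τ (u x)) fun τ => h1 _]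
    _ ≤ _ := by
        rw [Finset.expect_add_distrib, Fintype.expect_const]
        gcongr

/-! ### Words as a group -/

/-- Words of `B` bits as a group under the bitwise exclusive or. -/
def XorWord (B : ℕ) : Type := BitVec B

namespace XorWord

variable {B w : ℕ}

/-- A bit vector as an element of the group. -/
def ofBits (x : BitVec B) : XorWord B := x

/-- The bit vector of an element of the group. -/
def toBits (x : XorWord B) : BitVec B := x

instance : Fintype (XorWord B) := inferInstanceAs (Fintype (BitVec B))

instance : DecidableEq (XorWord B) := inferInstanceAs (DecidableEq (BitVec B))

instance : Add (XorWord B) := ⟨fun x y => ofBits (x.toBits ^^^ y.toBits)⟩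

instance : Zero (XorWord B) := ⟨ofBits 0⟩

instance : Neg (XorWord B) := ⟨id⟩

theorem toBits_add (x y : XorWord B) : (x + y).toBits = x.toBits ^^^ y.toBits := rfl

theorem add_self (x : XorWord B) : x + x = 0 := BitVec.xor_self (x := x.toBits)

instance : AddCommGroup (XorWord B) where
  add_assoc x y z := BitVec.xor_assoc x.toBits y.toBits z.toBits
  zero_add x := BitVec.zero_xor (x := x.toBits)
  add_zero x := BitVec.xor_zero (x := x.toBits)
  nsmul := nsmulRec
  zsmul := zsmulRec
  neg_add_cancel := add_self
  add_comm x y := BitVec.xor_comm x.toBits y.toBits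

instance : Module (ZMod 2) (XorWord B) :=
  AddCommGroup.zmodModule fun x => (two_nsmul x).trans (add_self x)

theorem card_eq : Fintype.card (XorWord B) = 2 ^ B := by
  rw [Fintype.card_congr (Equiv.ofBijective (BitVec.toFin : BitVec B → Fin (2 ^ B))
    ⟨BitVec.toFin_injective, fun x => ⟨BitVec.ofFin x, rfl⟩⟩ : XorWord B ≃ Fin (2 ^ B)),
    Fintype.card_fin]

/-- The bit number `i` of a word. -/
def bit (x : XorWord B) (i : ℕ) : Bool := x.toBits.getLsbD i

theorem bit_add (x y : XorWord B) (i : ℕ) : (x + y).bit i = (x.bit i ^^ y.bit i) :=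
  BitVec.getLsbD_xor (x := x.toBits) (y := y.toBits)

theorem bit_zero (i : ℕ) : (0 : XorWord B).bit i = false := BitVec.getLsbD_zero (w := B)

theorem bit_ofBits (x : BitVec B) (i : ℕ) : (ofBits x).bit i = x.getLsbD i := rfl

theorem ext_bit {x y : XorWord B} (h : ∀ i < B, x.bit i = y.bit i) : x = y :=
  BitVec.eq_of_getLsbD_eq (x := x.toBits) (y := y.toBits) h

/-- The bits of `x` that are selected by `m`. -/
def mask (m : XorWord B) : XorWord B →+ XorWord B :=
  AddMonoidHom.mk' (fun x => ofBits (x.toBits &&& m.toBits)) fun x y => ext_bit fun i _ => by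
    simp only [bit_add, bit_ofBits, BitVec.getLsbD_and, toBits_add, BitVec.getLsbD_xor,
      Bool.and_xor_distrib_right]

theorem bit_mask (m x : XorWord B) (i : ℕ) : (mask m x).bit i = (x.bit i && m.bit i) :=
  BitVec.getLsbD_and (x := x.toBits) (y := m.toBits)

/-- The lowest `w` bits of a word. -/
def truncate (w : ℕ) : XorWord B →+ XorWord w :=
  AddMonoidHom.mk' (fun x => ofBits (x.toBits.setWidth w)) fun x y => ext_bit fun i hi => by
    simp only [bit_add, bit_ofBits, BitVec.getLsbD_setWidth, toBits_add, BitVec.getLsbD_xor, hi,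
      decide_true, Bool.true_and]

theorem truncate_surjective (h : w ≤ B) : Function.Surjective (truncate (B := B) w) := fun x =>
  ⟨ofBits (x.toBits.setWidth B), (BitVec.setWidth_setWidth_of_le x.toBits h).trans
    (BitVec.setWidth_eq x.toBits)⟩

/-- The bits number `p, …, p + c - 1` of a word. -/
def extract (p c : ℕ) : XorWord w →+ XorWord c :=
  AddMonoidHom.mk' (fun x => ofBits (x.toBits.extractLsb' p c)) fun x y => ext_bit fun i hi => by
    simp only [bit_add, bit_ofBits, BitVec.getLsbD_extractLsb', toBits_add, BitVec.getLsbD_xor, hi,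
      decide_true, Bool.true_and]

theorem bit_extract {p c : ℕ} (x : XorWord w) {i : ℕ} (hi : i < c) :
    (extract p c x).bit i = x.bit (p + i) := by
  have : (extract p c x).bit i = (x.toBits.extractLsb' p c).getLsbD i := rfl
  rw [this, BitVec.getLsbD_extractLsb', decide_eq_true hi, Bool.true_and]
  rfl

theorem extract_surjective {p c : ℕ} (h : p + c ≤ w) :
    Function.Surjective (extract (w := w) p c) := fun x =>
  ⟨ofBits (x.toBits.setWidth w <<< p), ext_bit fun i hi => by
    rw [bit_extract _ hi, bit_ofBits, BitVec.getLsbD_shiftLeft, BitVec.getLsbD_setWidth,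
      show p + i - p = i by omega]
    simp [show p + i < w by omega, show i < w by omega, bit]⟩

/-- If the map `f` determines `c` consecutive bits of its argument, then it takes each value with
probability at most `2 ^ (-c)`. -/
theorem prob_eq_le {p c : ℕ} (h : p + c ≤ w) (f : XorWord w → XorWord w)
    (hf : ∀ x, ∀ i < c, (f x).bit (p + i) = x.bit (p + i)) (v : XorWord w) :
    prob (fun u => f u = v) ≤ (1 / 2) ^ c := by
  calc prob (fun u => f u = v) ≤ prob fun u : XorWord w => extract p c u = extract p c v :=
        prob_mono fun u hu => ext_bit fun i hi => by
          rw [bit_extract _ hi, bit_extract _ hi, ← hf u i hi, hu]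
    _ = prob fun y => y = extract p c v :=
        prob_comp_eq_of_surjective (extract p c) (extract_surjective h) fun y => y = extract p c v
    _ = _ := by rw [prob_eq_const, card_eq]; simp

/-- The word in which exactly the lowest `a` bits are set. -/
def lowMask (w a : ℕ) : XorWord w := ofBits (BitVec.ofNat w (2 ^ a - 1))

theorem bit_lowMask (w a i : ℕ) : (lowMask w a).bit i = (decide (i < w) && decide (i < a)) := by
  rw [lowMask, bit_ofBits, BitVec.getLsbD_ofNat, Nat.testBit_two_pow_sub_one]

/-- The splitting of words of `w` bits into two parts of `w / 2` bits and the remaining bit, if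
`w` is odd. -/
def splitting (w : ℕ) : Splitting (XorWord w) ((1 / 2) ^ (w / 2)) ((1 / 2) ^ (w / 2))
    ((1 / 2) ^ (w - 2 * (w / 2))) :=
  have bits : ∀ i, (i < w / 2 ∧ i < 2 * (w / 2)) ∨ (¬ i < w / 2 ∧ i < 2 * (w / 2)) ∨
    (¬ i < w / 2 ∧ ¬ i < 2 * (w / 2)) := fun i => by omega
  { L := mask (lowMask w (w / 2))
    R := mask (lowMask w (w / 2) + lowMask w (2 * (w / 2)))
    E := mask (lowMask w w + lowMask w (2 * (w / 2)))
    sum_eq := fun x => ext_bit fun i hi => by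
      rcases bits i with h | h | h <;> simp [bit_add, bit_mask, bit_lowMask, hi, h]
    LL := fun x => ext_bit fun i hi => by simp [bit_mask]
    LR := fun x => ext_bit fun i hi => by
      rcases bits i with h | h | h <;> simp [bit_add, bit_mask, bit_zero, bit_lowMask, hi, h]
    LE := fun x => ext_bit fun i hi => by
      rcases bits i with h | h | h <;> simp [bit_add, bit_mask, bit_zero, bit_lowMask, hi, h]
    RL := fun x => ext_bit fun i hi => by
      rcases bits i with h | h | h <;> simp [bit_add, bit_mask, bit_zero, bit_lowMask, hi, h]
    RR := fun x => ext_bit fun i hi => by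
      rcases bits i with h | h | h <;> simp [bit_add, bit_mask, bit_lowMask, hi, h]
    RE := fun x => ext_bit fun i hi => by
      rcases bits i with h | h | h <;> simp [bit_add, bit_mask, bit_zero, bit_lowMask, hi, h]
    EL := fun x => ext_bit fun i hi => by
      rcases bits i with h | h | h <;> simp [bit_add, bit_mask, bit_zero, bit_lowMask, hi, h]
    ER := fun x => ext_bit fun i hi => by
      rcases bits i with h | h | h <;> simp [bit_add, bit_mask, bit_zero, bit_lowMask, hi, h]
    EE := fun x => ext_bit fun i hi => by
      rcases bits i with h | h | h <;> simp [bit_add, bit_mask, bit_lowMask, hi, h]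
    prob_L := prob_eq_le (p := 0) (by omega) _ fun x i hi => by
      simp [bit_mask, bit_lowMask, hi, show i < w by omega]
    prob_E := prob_eq_le (p := 2 * (w / 2)) (by omega) _ fun x i hi => by
      simp [bit_add, bit_mask, bit_lowMask, show 2 * (w / 2) + i < w by omega]
    prob_LR := fun v => by
      rw [← pow_add]
      refine prob_eq_le (p := 0) (by omega) _ (fun x i hi => ?_) v
      by_cases h : i < w / 2 <;>
        simp [bit_add, bit_mask, bit_lowMask, show i < w by omega,
          show i < 2 * (w / 2) by omega, h]
    prob_RE := fun v => by
      rw [← pow_add]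
      refine prob_eq_le (p := w / 2) (by omega) _ (fun x i hi => ?_) v
      by_cases h : w / 2 + i < 2 * (w / 2) <;>
        simp [bit_add, bit_mask, bit_lowMask, show w / 2 + i < w by omega, h] }

/-- The remainder of a word modulo `m`. -/
def residue (m : ℕ) [NeZero m] (x : XorWord B) : Fin m := Fin.ofNat m x.toBits.toNat

theorem preservesUniform_residue {m : ℕ} [NeZero m] (hm : m ∣ 2 ^ B) :
    PreservesUniform (residue (B := B) m) := fun ι _ _ φ => by
  refine expect_comp_eq_of_shift (fun (u : ι → XorWord B) i => residue m (u i)) (fun d => ?_) φ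
  let e : (ι → BitVec B) ≃ (ι → BitVec B) := Equiv.addRight fun i => BitVec.ofNat B (d i)
  refine ⟨e, fun u => funext fun i => Fin.ext ?_⟩
  change ((u i).toBits + BitVec.ofNat B (d i)).toNat % m = _
  simp only [Pi.add_apply, residue, Fin.val_add, Fin.val_ofNat, BitVec.toNat_add,
    BitVec.toNat_ofNat, Nat.add_mod_mod, Nat.mod_add_mod]
  exact Nat.mod_mod_of_dvd _ hm

end XorWord

/-! ### The hash functions on words -/

section WordHash

open XorWord

variable {B w τ : ℕ}

/-- A block of the seed: it serves as a table, or holds the coefficients of a polynomial. -/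
abbrev Block (B τ : ℕ) : Type := Fin (32 * τ ^ 5) → XorWord B

instance [NeZero τ] : NeZero (16 * τ ^ 2) := ⟨by have := NeZero.ne τ; positivity⟩

instance [NeZero τ] : NeZero (32 * τ ^ 5) := ⟨by have := NeZero.ne τ; positivity⟩

/-- The first four words of a block. -/
def coefficients [NeZero τ] (a : Block B τ) (i : Fin 4) : BitVec B :=
  (a (Fin.ofNat (32 * τ ^ 5) i)).toBits

/-- The coefficients from a random block are independent and uniformly random. -/
theorem expect_coefficients [NeZero τ] (f : (Fin 4 → BitVec B) → ℝ) :
    𝔼 a : Block B τ, f (coefficients a) = 𝔼 a, f a := by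
  let Φ : Block B τ →+ (Fin 4 → XorWord B) :=
    AddMonoidHom.mk' (fun a i => a (Fin.ofNat (32 * τ ^ 5) i)) fun _ _ => rfl
  refine expect_comp_eq_of_surjective Φ (fun z => ?_) f
  have hτ : 0 < τ := Nat.pos_of_ne_zero (NeZero.ne τ)
  have h4 : 4 ≤ 32 * τ ^ 5 := by have : 0 < τ ^ 5 := by positivity
                                 omega
  refine ⟨fun c => if h : c.val < 4 then z ⟨c, h⟩ else 0, funext fun i => ?_⟩
  have hi : (Fin.ofNat (32 * τ ^ 5) i).val = i := Nat.mod_eq_of_lt (by omega)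
  simp only [Φ, AddMonoidHom.mk'_apply, hi, i.2, dif_pos]

/-- Polynomial hashing of words of `w` bits, with coefficients from a block. -/
def blockHash (w N : ℕ) [NeZero τ] [NeZero N] (a : Block B τ) (x : XorWord w) : Fin N :=
  cubicHash (2 ^ (3 * w)) N (coefficients a) (x.toBits.toNat : BitVec B)

theorem kWiseIndependent_blockHash {N : ℕ} [NeZero τ] [NeZero N]
    (hN : 2 ^ (3 * w) * N ∣ 2 ^ B) :
    KWiseIndependent 4 (blockHash (B := B) (τ := τ) w N) :=
  (kWiseIndependent_cubicHash (U := XorWord w) ⟨fun x => x.toBits.toNat, BitVec.toNat_injective⟩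
    (fun x => x.toBits.isLt) hN).comp_surjective coefficients expect_coefficients

/-- The cell of a table with number `z` in bucket number `y`. -/
def bucketCell [NeZero τ] (y : Fin (τ ^ 3)) (z : Fin (16 * τ ^ 2)) : Fin (32 * τ ^ 5) :=
  Fin.ofNat (32 * τ ^ 5) (y * (16 * τ ^ 2) + z)

theorem bucketCell_val [NeZero τ] (y : Fin (τ ^ 3)) (z : Fin (16 * τ ^ 2)) :
    (bucketCell y z).val = y * (16 * τ ^ 2) + z := by
  refine Nat.mod_eq_of_lt ?_
  have h1 : (y : ℕ) + 1 ≤ τ ^ 3 := y.2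
  have h2 := z.2
  calc (y : ℕ) * (16 * τ ^ 2) + z < (y + 1) * (16 * τ ^ 2) := by rw [add_mul]; omega
    _ ≤ τ ^ 3 * (16 * τ ^ 2) := Nat.mul_le_mul_right _ h1
    _ = 16 * τ ^ 5 := by ring
    _ ≤ _ := by omega

theorem bucketCell_injective [NeZero τ] : Function.Injective2 (bucketCell (τ := τ)) := by
  intro y y' z z' h
  have h1 := congrArg Fin.val h
  rw [bucketCell_val, bucketCell_val] at h1
  have hz := z.2
  have hz' := z'.2
  have hpos : 0 < 16 * τ ^ 2 := by omega
  have h2 : (y : ℕ) = y' := by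
    have h3 : ∀ (a b : ℕ), b < 16 * τ ^ 2 → (a * (16 * τ ^ 2) + b) / (16 * τ ^ 2) = a :=
      fun a b hb => by
        rw [add_comm, Nat.add_mul_div_right _ _ hpos, Nat.div_eq_of_lt hb, zero_add]
    rw [← h3 y z hz, h1, h3 y' z' hz']
  exact ⟨Fin.ext h2, Fin.ext (by rw [h2] at h1; omega)⟩

/-- The seed of one round. -/
abbrev WordSeed (B τ L : ℕ) : Type :=
  RoundSeed L (Block B τ) (Fin (32 * τ ^ 5)) (XorWord B)

set_option synthInstance.maxSize 1000 in
instance (B τ L : ℕ) : Fintype (WordSeed B τ L) := inferInstance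

/-- The function that is applied in one round, before truncation. -/
def wordHash [NeZero τ] {L : ℕ} (ω : WordSeed B τ L) (x : XorWord w) : XorWord B :=
  sumHash (blockHash w (τ ^ 3)) (blockHash w (32 * τ ^ 5)) (residue (16 * τ ^ 2)) bucketCell ω x

/-- On at most `τ ^ 5` points the round function is almost uniformly random. Words must have room
for the `3 * w` lowest bits of a polynomial value, which are dropped, and for the number of a
cell. -/
theorem almostUniform_wordHash [NeZero τ] {t : ℕ} (ht : τ = 2 ^ t) (hB : 3 * w + 5 * t + 5 ≤ B)
    {k : ℕ} (hk : k ≤ τ ^ 5) (L : ℕ) :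
    AlmostUniform (fun (ω : WordSeed B τ L) (x : XorWord w) => truncate w (wordHash ω x)) k
      ((1 / τ) ^ L) := by
  intro S hS φ h0 h1
  have hτ : 0 < τ := Nat.pos_of_ne_zero (NeZero.ne τ)
  have e3 : τ ^ 3 = 2 ^ (3 * t) := by rw [ht, ← pow_mul, mul_comm]
  have e2 : 16 * τ ^ 2 = 2 ^ (4 + 2 * t) := by
    rw [ht, ← pow_mul, mul_comm t, pow_add]; norm_num
  have e5 : 32 * τ ^ 5 = 2 ^ (5 + 5 * t) := by
    rw [ht, ← pow_mul, mul_comm t, pow_add]; norm_num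
  refine (expect_sumHash_le (U := XorWord w) (h := blockHash (B := B) (τ := τ) w (τ ^ 3))
    (g := blockHash (B := B) (τ := τ) w (32 * τ ^ 5)) (ρ := residue (B := B) (16 * τ ^ 2))
    (cell := bucketCell (τ := τ)) (kWiseIndependent_blockHash ?_) (kWiseIndependent_blockHash ?_)
    (preservesUniform_residue ?_) bucketCell_injective hτ (Fintype.card_fin _)
    (Fintype.card_fin _) (Fintype.card_fin _) L S (hS.trans hk)
    (fun u => φ fun x => truncate w (u x)) (fun u => h0 _) fun u => h1 _).trans_eq ?_
  · rw [e3, ← pow_add]; exact pow_dvd_pow 2 (by omega)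
  · rw [e5, ← pow_add]; exact pow_dvd_pow 2 (by omega)
  · rw [e2]; exact pow_dvd_pow 2 (by omega)
  · congr 1
    let Φ : (S → XorWord B) →+ (S → XorWord w) :=
      AddMonoidHom.mk' (fun u x => truncate w (u x)) fun u u' => funext fun x => map_add _ _ _
    refine expect_comp_eq_of_surjective Φ (fun z => ?_) φ
    choose u hu using fun x => truncate_surjective (B := B) (by omega) (z x)
    exact ⟨u, funext hu⟩

end WordHash

/-! ### Statistical distance -/

section Distance

/-- The distance of two distributions is the largest difference of the expectations of a test with
values in `[0, 1]`. -/
theorem statDist_le {Y : Type*} [Fintype Y] (p q : PMF Y) {δ : ℝ}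
    (h : ∀ φ : Y → ℝ, (∀ y, 0 ≤ φ y) → (∀ y, φ y ≤ 1) →
      ∑ y, (p y).toReal * φ y ≤ ∑ y, (q y).toReal * φ y + δ) : statDist p q ≤ δ := by
  classical
  have hsum : ∀ r : PMF Y, ∑ y, (r y).toReal = 1 := fun r => by
    rw [← ENNReal.toReal_sum fun y _ => r.apply_ne_top y, ← tsum_fintype (L := .unconditional _),
      r.tsum_coe, ENNReal.toReal_one]
  have h1 := h (fun y => if (q y).toReal ≤ (p y).toReal then 1 else 0)
    (fun y => by split_ifs <;> norm_num) fun y => by split_ifs <;> norm_num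
  have h2 : ∀ y, |(p y).toReal - (q y).toReal| =
      2 * ((p y).toReal * (if (q y).toReal ≤ (p y).toReal then 1 else 0)
        - (q y).toReal * (if (q y).toReal ≤ (p y).toReal then 1 else 0))
        - ((p y).toReal - (q y).toReal) := fun y => by
    split_ifs with hy
    · rw [abs_of_nonneg (by linarith)]; ring
    · rw [abs_of_neg (by linarith)]; ring
  unfold statDist
  simp_rw [h2]
  rw [Finset.sum_sub_distrib, Finset.sum_sub_distrib, hsum, hsum, ← Finset.mul_sum,
    Finset.sum_sub_distrib]
  linarith

theorem sum_map_uniform {Seed Y : Type*} [Fintype Seed] [Fintype Y] [DecidableEq Y]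
    (h : (Finset.univ : Finset Seed).Nonempty) (f : Seed → Y) (φ : Y → ℝ) :
    ∑ y, (((PMF.uniformOfFinset Finset.univ h).map f) y).toReal * φ y = 𝔼 s, φ (f s) := by
  have : Nonempty Seed := ⟨h.choose⟩
  have h1 : ∀ y, (((PMF.uniformOfFinset Finset.univ h).map f) y).toReal
      = ∑ s, if y = f s then ((Fintype.card Seed : ℝ))⁻¹ else 0 := fun y => by
    rw [PMF.map_apply, tsum_fintype, ENNReal.toReal_sum]
    · refine Finset.sum_congr rfl fun s _ => ?_
      split_ifs <;> simp
    · intro s _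
      split_ifs <;> simp
  simp_rw [h1, Finset.sum_mul]
  rw [Finset.sum_comm, Fintype.expect_eq_sum_div_card, Finset.sum_div]
  refine Finset.sum_congr rfl fun s _ => ?_
  simp [div_eq_inv_mul]

theorem statDist_valuesOn_le {w : ℕ} {Seed : Type*} [Fintype Seed]
    (h : (Finset.univ : Finset Seed).Nonempty) (π : Seed → Equiv.Perm (BitVec w))
    (S : Finset (BitVec w)) {δ : ℝ}
    (hδ : ∀ φ : (S → BitVec w) → ℝ, (∀ y, 0 ≤ φ y) → (∀ y, φ y ≤ 1) →
      𝔼 s, φ (fun x => π s x) ≤ (𝔼 σ : Equiv.Perm (BitVec w), φ fun x => σ x) + δ) :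
    statDist (valuesOn π Finset.univ h S) (trulyRandomValuesOn S) ≤ δ := by
  refine statDist_le _ _ fun φ h0 h1 => ?_
  unfold trulyRandomValuesOn valuesOn
  rw [sum_map_uniform h, sum_map_uniform Finset.univ_nonempty]
  exact hδ φ h0 h1

theorem statDist_le_one {Y : Type*} [Fintype Y] (p q : PMF Y) : statDist p q ≤ 1 :=
  statDist_le p q fun φ h0 h1 => by
    have hsum : ∑ y, (p y).toReal = 1 := by
      rw [← ENNReal.toReal_sum fun y _ => p.apply_ne_top y, ← tsum_fintype (L := .unconditional _),
        p.tsum_coe, ENNReal.toReal_one]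
    have ha : ∑ y, (p y).toReal * φ y ≤ ∑ y, (p y).toReal :=
      Finset.sum_le_sum fun y _ => mul_le_of_le_one_right ENNReal.toReal_nonneg (h1 y)
    have hb : 0 ≤ ∑ y, (q y).toReal * φ y :=
      Finset.sum_nonneg fun y _ => mul_nonneg ENNReal.toReal_nonneg (h0 y)
    linarith

/-- The number of collisions that the analysis of the network charges is covered by the
distance that is allowed; in the odd case the two parts have `w / 2` bits rounded down, and the
extra bit makes up for the loss. The term `ε` is the error of the hash functions. -/
theorem error_le {w k : ℕ} (hw : 2 ≤ w) (hk : 1 ≤ k) {ε : ℝ} (hε0 : 0 ≤ ε)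
    (hε : (3 + k * k) * ε ≤ k * (1 / 2) ^ w * (1 / 10)) :
    3 * ε + (k * (k - 1)) / 2 * (2 * (1 / 2) ^ (w - w / 2) + 2 * ε
      + (1 / 2) ^ (w / 2) * (1 / 2) ^ (w / 2))
      + (k * (k - 1)) / 2 * (1 / 2 ^ w)
      ≤ (k : ℝ) ^ 2 / 2 ^ ((w : ℝ) / 2) + (k : ℝ) ^ 2 / 2 ^ (w : ℝ) := by
  have hk1 : (1 : ℝ) ≤ k := by exact_mod_cast hk
  have hkk : (0 : ℝ) ≤ k * (k - 1) := mul_nonneg (by linarith) (by linarith)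
  -- `r` is `2 ^ (-w / 2)`
  set r : ℝ := (2 : ℝ) ^ (-((w : ℝ) / 2)) with hr
  have hr0 : 0 < r := by positivity
  have hr2 : r * r = (1 / 2) ^ w := by
    rw [hr, ← Real.rpow_add (by norm_num), show -((w : ℝ) / 2) + -((w : ℝ) / 2) = -(w : ℝ) by ring,
      Real.rpow_neg (by norm_num), Real.rpow_natCast, one_div, inv_pow]
  have e1 : (k : ℝ) ^ 2 / 2 ^ ((w : ℝ) / 2) = k ^ 2 * r := by
    rw [hr, Real.rpow_neg (by norm_num)]; rfl
  have e2 : (k : ℝ) ^ 2 / 2 ^ (w : ℝ) = k ^ 2 * (r * r) := by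
    rw [hr2, Real.rpow_natCast, one_div, inv_pow]; rfl
  have e3 : (1 : ℝ) / 2 ^ w = r * r := by rw [hr2, one_div, one_div, inv_pow]
  have hr1 : r ≤ 1 / 2 := by
    have h4 : r * r ≤ (1 / 2) ^ 2 := by
      rw [hr2]; exact pow_le_pow_of_le_one (by norm_num) (by norm_num) hw
    nlinarith
  rw [e1, e2, e3]
  rw [← hr2] at hε
  have herr : 3 * ε + (k * (k - 1)) / 2 * (2 * ε) ≤ (k : ℝ) * r * (1 / 10) := by
    have : (k : ℝ) * (r * r) * (1 / 10) ≤ k * r * (1 / 10) := by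
      have : r * r ≤ r := by nlinarith
      gcongr
    nlinarith
  rcases Nat.even_or_odd' w with ⟨a, rfl | rfl⟩
  · rw [show 2 * a / 2 = a by omega, show 2 * a - a = a by omega]
    have hra : r = (1 / 2) ^ a := by
      have : r ^ 2 = ((1 / 2) ^ a) ^ 2 := by rw [sq, hr2, ← pow_mul, mul_comm]
      exact (pow_left_inj₀ hr0.le (by positivity) (by norm_num)).1 this
    rw [← hra]
    have hkr : 0 ≤ (k : ℝ) * r := by positivity
    have hkrr : 0 ≤ (k : ℝ) * (r * r) := by positivity
    nlinarith
  · rw [show (2 * a + 1) / 2 = a by omega, show 2 * a + 1 - a = a + 1 by omega]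
    set s : ℝ := (1 / 2) ^ a with hs
    have hs0 : 0 < s := by positivity
    have hrs : r * r = s * s / 2 := by
      rw [hr2, hs, pow_succ, pow_mul', sq]; ring
    have hs1 : s ≤ 1 / 2 := by
      rw [hs]
      calc ((1 : ℝ) / 2) ^ a ≤ (1 / 2) ^ 1 :=
            pow_le_pow_of_le_one (by norm_num) (by norm_num) (by omega)
        _ = _ := by norm_num
    -- `r = s / √2`, and `√2 ≥ 7 / 5`
    have hrs' : 7 / 10 * s ≤ r := by
      by_contra hlt
      push Not at hlt
      nlinarith
    have hp : ((1 : ℝ) / 2) ^ (a + 1) = s / 2 := by rw [hs, pow_succ]; ring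
    rw [hp, hrs]
    have hmain : s + s * s + s * s / 2 ≤ 2 * r + 2 * (s * s / 2) := by nlinarith
    have hkr : 0 ≤ (k : ℝ) * r := by positivity
    have hkrr : 0 ≤ (k : ℝ) * (s * s) := by positivity
    have := mul_le_mul_of_nonneg_left hmain hkk
    nlinarith

end Distance

/-! ### Compilation of expressions -/

namespace WordRAM

variable {B : ℕ}

/-- Execution of a list of instructions one after the other. -/
def run (code : Program) (c : Config B) : Config B := code.foldl (fun c i => i.exec c) c

theorem run_append (code code' : Program) (c : Config B) :
    run (code ++ code') c = run code' (run code c) := List.foldl_append ..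

/-- A program without jumps. -/
def IsStraight (code : Program) : Prop :=
  ∀ i ∈ code, ∀ (B : ℕ) (c : Config B), (i.exec c).pc = c.pc + 1

theorem IsStraight.append {code code' : Program} (h : IsStraight code) (h' : IsStraight code') :
    IsStraight (code ++ code') := fun i hi => (List.mem_append.1 hi).elim (h i) (h' i)

theorem step_eq {P : Program} {c : Config B} {i : Instr} (h : [i] <+: P.drop c.pc) :
    step P c = i.exec c := by
  obtain ⟨r, hr⟩ := h
  have : P[c.pc]? = some i := by
    rw [← List.head?_drop, ← hr]; rfl
  simp only [step, this]

/-- If the program `P` contains the list `code` without jumps from the current position on, then it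
executes this list. -/
theorem iterate_step {P code : Program} (hcode : IsStraight code) (c : Config B)
    (h : code <+: P.drop c.pc) :
    (step P)^[code.length] c = run code c ∧ (run code c).pc = c.pc + code.length := by
  induction code generalizing c with
  | nil => exact ⟨rfl, rfl⟩
  | cons i code ih =>
    have hpc := hcode i (by simp) B c
    have h' : code <+: P.drop (i.exec c).pc := by
      rw [hpc, ← List.drop_drop]
      obtain ⟨r, hr⟩ := h
      exact ⟨r, by rw [← hr]; rfl⟩
    obtain ⟨h1, h2⟩ := ih (fun j hj => hcode j (by simp [hj])) (i.exec c) h'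
    have hs : step P c = i.exec c := step_eq (((List.prefix_append [i] code)).trans h)
    rw [List.length_cons, Function.iterate_succ_apply, hs]
    exact ⟨h1, by rw [show run (i :: code) c = run code (i.exec c) from rfl, h2, hpc]; ring⟩

theorem step_iterate_of_length_le {P : Program} {c : Config B} (h : P.length ≤ c.pc) (t : ℕ) :
    (step P)^[t] c = c := by
  refine Function.iterate_fixed ?_ t
  simp only [step, List.getElem?_eq_none h]

theorem StopsWithin.mono {P : Program} {t t' : ℕ} {c c' : Config B} (h : StopsWithin P t c c')
    (ht : t ≤ t') : StopsWithin P t' c c' := by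
  refine ⟨?_, h.2⟩
  rw [← Nat.sub_add_cancel ht, Function.iterate_add_apply, h.1, step_iterate_of_length_le h.2]

/-- Expressions over the registers and the memory. -/
inductive Expr where
  | var (i : ℕ)
  | const (v : ℕ)
  | bin (op : BinOp) (e₁ e₂ : Expr)
  | load (e : Expr)

namespace Expr

instance : Add Expr := ⟨bin .add⟩
instance : Sub Expr := ⟨bin .sub⟩
instance : Mul Expr := ⟨bin .mul⟩
instance : Div Expr := ⟨bin .div⟩
instance : Mod Expr := ⟨bin .mod⟩
instance : XorOp Expr := ⟨bin .xor⟩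
instance : AndOp Expr := ⟨bin .and⟩

/-- The value of an expression. -/
def eval (reg : ℕ → BitVec B) (mem : BitVec B → BitVec B) : Expr → BitVec B
  | var i => reg i
  | const v => BitVec.ofNat B v
  | bin op e₁ e₂ => op.eval (e₁.eval reg mem) (e₂.eval reg mem)
  | load e => mem (e.eval reg mem)

/-- All registers that occur in the expression have numbers less than `d`. -/
def Below (d : ℕ) : Expr → Prop
  | var i => i < d
  | const _ => True
  | bin _ e₁ e₂ => e₁.Below d ∧ e₂.Below d
  | load e => e.Below d

theorem Below.mono {d d' : ℕ} (hd : d ≤ d') {e : Expr} (h : e.Below d) : e.Below d' := by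
  induction e with
  | var i => exact lt_of_lt_of_le h hd
  | const v => trivial
  | bin op e₁ e₂ ih₁ ih₂ => exact ⟨ih₁ h.1, ih₂ h.2⟩
  | load e ih => exact ih h

theorem eval_congr {d : ℕ} {reg reg' : ℕ → BitVec B} (mem : BitVec B → BitVec B)
    (h : ∀ i < d, reg i = reg' i) : ∀ {e : Expr}, e.Below d → e.eval reg mem = e.eval reg' mem
  | var _, he => h _ he
  | const _, _ => rfl
  | bin op _ _, he => congrArg₂ op.eval (eval_congr mem h he.1) (eval_congr mem h he.2)
  | load e, he => congrArg mem (eval_congr (e := e) mem h he)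

/-- Instructions that compute the value of an expression in register `d`; they use the registers
from `d` on as a stack. -/
def compile : Expr → ℕ → Program
  | var i, d => [.bin .or d i i]
  | const v, d => [.const d v]
  | bin op e₁ e₂, d => e₁.compile d ++ (e₂.compile (d + 1) ++ [.bin op d d (d + 1)])
  | load e, d => e.compile d ++ [.load d d]

theorem isStraight_compile : ∀ (e : Expr) (d : ℕ), IsStraight (e.compile d)
  | var i, d => by intro i hi B c; rw [List.mem_singleton.1 hi]; rfl
  | const v, d => by intro i hi B c; rw [List.mem_singleton.1 hi]; rfl
  | bin op e₁ e₂, d =>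
    (isStraight_compile e₁ d).append ((isStraight_compile e₂ (d + 1)).append fun i hi B c => by
      rw [List.mem_singleton.1 hi]; rfl)
  | load e, d => (isStraight_compile e d).append fun i hi B c => by
      rw [List.mem_singleton.1 hi]; rfl

theorem run_compile (e : Expr) (d : ℕ) (he : e.Below d) (c : Config B) :
    (run (e.compile d) c).mem = c.mem ∧ (run (e.compile d) c).reg d = e.eval c.reg c.mem ∧
      ∀ i < d, (run (e.compile d) c).reg i = c.reg i := by
  induction e generalizing d c with
  | var i =>
    refine ⟨rfl, ?_, fun j hj => Function.update_of_ne hj.ne _ _⟩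
    exact (Function.update_self ..).trans (BitVec.or_self (x := c.reg i))
  | const v => exact ⟨rfl, Function.update_self .., fun j hj => Function.update_of_ne hj.ne _ _⟩
  | load e ih =>
    obtain ⟨h1, h2, h3⟩ := ih d he c
    rw [compile, run_append]
    refine ⟨h1, (Function.update_self ..).trans ?_,
      fun j hj => (Function.update_of_ne hj.ne _ _).trans (h3 j hj)⟩
    rw [h1, h2, eval]
  | bin op e₁ e₂ ih₁ ih₂ =>
    obtain ⟨h1, h2, h3⟩ := ih₁ d he.1 c
    rw [compile, run_append, run_append]
    obtain ⟨k1, k2, k3⟩ := ih₂ (d + 1) (he.2.mono (Nat.le_succ d)) (run (e₁.compile d) c)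
    refine ⟨k1.trans h1, (Function.update_self ..).trans ?_,
      fun j hj => (Function.update_of_ne hj.ne _ _).trans ((k3 j (by omega)).trans (h3 j hj))⟩
    rw [k2, k3 d (by omega), h1, h2, eval, eval_congr c.mem h3 he.2]

/-- A program that replaces the content of register `0` by the value of an expression. -/
def toProgram (e : Expr) : Program := e.compile 1 ++ [.bin .or 0 1 1]

theorem stopsWithin_toProgram (e : Expr) (he : e.Below 1) (c : Config B) (hc : c.pc = 0) :
    ∃ c', StopsWithin e.toProgram e.toProgram.length c c' ∧ c'.reg 0 = e.eval c.reg c.mem := by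
  have hstr : IsStraight e.toProgram := (isStraight_compile e 1).append fun i hi B c => by
    rw [List.mem_singleton.1 hi]; rfl
  obtain ⟨h1, h2⟩ := iterate_step (P := e.toProgram) hstr c (by rw [hc]; exact List.prefix_rfl)
  refine ⟨_, ⟨h1, by rw [h2, hc, zero_add]⟩, ?_⟩
  rw [toProgram, run_append]
  rw [← (run_compile e 1 he c).2.1]
  generalize run (e.compile 1) c = c₁
  exact (Function.update_self 0 (c₁.reg 1 ||| c₁.reg 1) c₁.reg).trans BitVec.or_self

/-- Instructions that store the values of expressions in the memory cells from `j` on, using the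
registers from `d` on. -/
def storeAll (d : ℕ) : ℕ → List Expr → Program
  | _, [] => []
  | j, e :: es => (e.compile d ++ [.const (d + 1) j, .store (d + 1) d]) ++ storeAll d (j + 1) es

theorem isStraight_storeAll (d : ℕ) : ∀ (j : ℕ) (es : List Expr), IsStraight (storeAll d j es)
  | _, [] => fun i hi => absurd hi List.not_mem_nil
  | j, e :: es => ((isStraight_compile e d).append fun i hi B c => by
      rcases List.mem_cons.1 hi with rfl | hi
      · rfl
      · rw [List.mem_singleton.1 hi]; rfl).append (isStraight_storeAll d (j + 1) es)

theorem run_storeAll {d : ℕ} (es : List Expr) (j : ℕ) (hes : ∀ e ∈ es, e.Below d)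
    (hes' : ∀ e ∈ es, ∀ (reg : ℕ → BitVec B) (mem mem' : BitVec B → BitVec B),
      e.eval reg mem = e.eval reg mem')
    (hj : j + es.length ≤ 2 ^ B) (c : Config B) :
    (∀ i < d, (run (storeAll d j es) c).reg i = c.reg i) ∧
      (∀ a : BitVec B, a.toNat < j → (run (storeAll d j es) c).mem a = c.mem a) ∧
      ∀ (i : ℕ) (hi : i < es.length),
        (run (storeAll d j es) c).mem (BitVec.ofNat B (j + i)) = es[i].eval c.reg c.mem := by
  induction es generalizing j c with
  | nil => exact ⟨fun _ _ => rfl, fun _ _ => rfl, fun i hi => absurd hi (Nat.not_lt_zero i)⟩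
  | cons e es ih =>
    rw [List.length_cons] at hj
    obtain ⟨h1, h2, h3⟩ := run_compile e d (hes e (by simp)) c
    set c₁ := run (e.compile d) c with hc₁
    set c₂ : Config B := run [.const (d + 1) j, .store (d + 1) d] c₁ with hc₂
    have hrun : run (storeAll d j (e :: es)) c = run (storeAll d (j + 1) es) c₂ := by
      rw [storeAll, run_append, run_append]
    have hreg : ∀ i < d, c₂.reg i = c.reg i := fun i hi =>
      (Function.update_of_ne (by omega) _ _).trans (h3 i hi)
    have hmem : c₂.mem = Function.update c.mem (BitVec.ofNat B j) (e.eval c.reg c.mem) := by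
      change Function.update c₁.mem (Function.update c₁.reg (d + 1) (BitVec.ofNat B j) (d + 1))
        (Function.update c₁.reg (d + 1) (BitVec.ofNat B j) d) = _
      rw [Function.update_self, Function.update_of_ne (by omega), h1, h2]
    have hj' : (BitVec.ofNat B j).toNat = j := by
      rw [BitVec.toNat_ofNat, Nat.mod_eq_of_lt (by omega)]
    obtain ⟨k1, k2, k3⟩ := ih (j + 1) (fun e he => hes e (by simp [he]))
      (fun e he => hes' e (by simp [he])) (by omega) c₂
    rw [hrun]
    refine ⟨fun i hi => (k1 i hi).trans (hreg i hi), fun a ha => ?_, fun i hi => ?_⟩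
    · rw [k2 a (by omega), hmem, Function.update_of_ne]
      rintro rfl
      omega
    · cases i with
      | zero =>
        rw [k2 _ (by rw [add_zero, hj']; omega), hmem, add_zero, Function.update_self]
        rfl
      | succ i =>
        have hi' : i < es.length := by simpa using hi
        rw [show j + (i + 1) = j + 1 + i by ring, k3 i hi', List.getElem_cons_succ]
        have hmem' : es[i] ∈ e :: es := by simp
        rw [hes' _ hmem' _ _ c.mem, eval_congr _ hreg (hes _ hmem')]

end Expr

end WordRAM

/-! ### Evaluation of the permutations -/

section Seeds

variable {B τ L : ℕ}

/-- The parts of the seed of one copy of the hash function: the coefficients for the bucket, those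
for the arguments of the position tables, the position tables, and the tables of the values. -/
abbrev BlockKind : Type := Unit ⊕ (Fin 4 × Fin 4) ⊕ (Fin 4 × Fin 4) ⊕ Fin 4

/-- The blocks of the seed, by round, copy of the hash function, and part. -/
abbrev BlockIndex (L : ℕ) : Type := Fin 4 × Fin L × BlockKind

/-- A numbering of the blocks. -/
noncomputable def blockNumber (L : ℕ) : BlockIndex L ≃ Fin (Fintype.card (BlockIndex L)) :=
  Fintype.equivFin _

/-- The seeds of the rounds that consist of given blocks. -/
def roundSeeds : (BlockIndex L → Block B τ) ≃ (Fin 4 → WordSeed B τ L) where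
  toFun T r l := ((T (r, l, .inl ()), fun j i => T (r, l, .inr (.inl (j, i))),
    fun j i => T (r, l, .inr (.inr (.inl (j, i))))), fun j => T (r, l, .inr (.inr (.inr j))))
  invFun ω
    | (r, l, .inl ()) => (ω r l).1.1
    | (r, l, .inr (.inl (j, i))) => (ω r l).1.2.1 j i
    | (r, l, .inr (.inr (.inl (j, i)))) => (ω r l).1.2.2 j i
    | (r, l, .inr (.inr (.inr j))) => (ω r l).2 j
  left_inv T := by
    funext β
    rcases β with ⟨r, l, ⟨⟩ | ⟨j, i⟩ | ⟨j, i⟩ | j⟩ <;> rfl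
  right_inv ω := rfl

/-- The blocks in a list of words; they stand there one after the other. -/
noncomputable def seedBlocks : (Fin (Fintype.card (BlockIndex L) * (32 * τ ^ 5)) → BitVec B) ≃
    (BlockIndex L → Block B τ) where
  toFun s β i := XorWord.ofBits (s (finProdFinEquiv (blockNumber L β, i)))
  invFun T i :=
    (T ((blockNumber L).symm (finProdFinEquiv.symm i).1) (finProdFinEquiv.symm i).2).toBits
  left_inv s := by
    funext i
    simp only [Equiv.apply_symm_apply, Prod.mk.eta]
    rfl
  right_inv T := by
    funext β i
    simp only [Equiv.symm_apply_apply]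
    rfl

end Seeds

section Permutation

open XorWord

variable {w : ℕ}

theorem feistelRound_involutive (P Q f : XorWord w → XorWord w)
    (hPQ : ∀ x y, P (x + Q y) = P x) : Function.Involutive (feistelRound P Q f) := fun x => by
  simp only [feistelRound, hPQ, add_assoc, XorWord.add_self, add_zero]

/-- Four Feistel rounds form a permutation, whatever the functions are. -/
def feistelPerm (f : Fin 4 → XorWord w → XorWord w) : Equiv.Perm (XorWord w) :=
  let σ := splitting w
  (((feistelRound_involutive σ.L (σ.R + σ.E) (f 0) fun x y => by simp [σ.LR, σ.LE]).toPerm.trans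
    (feistelRound_involutive (σ.R + σ.E) σ.L (f 1) fun x y => by simp [σ.RL, σ.EL]).toPerm).trans
    (feistelRound_involutive (σ.L + σ.E) σ.R (f 2) fun x y => by simp [σ.LR, σ.ER]).toPerm).trans
    (feistelRound_involutive (σ.L + σ.R) σ.E (f 3) fun x y => by simp [σ.LE, σ.RE]).toPerm

theorem feistelPerm_apply (f : Fin 4 → XorWord w → XorWord w) (x : XorWord w) :
    feistelPerm f x = feistel (splitting w) (f 0) (f 1) (f 2) (f 3) x := rfl

end Permutation

/-- The words that are common to all members of the family: the divisor and the moduli of the hash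
functions, and masks for the lowest bits. -/
def parameters (τ w : ℕ) : List ℕ :=
  [2 ^ (3 * w), τ ^ 3, 16 * τ ^ 2, 32 * τ ^ 5, 2 ^ w - 1, 2 ^ (w / 2) - 1, 2 ^ (2 * (w / 2)) - 1]

/-- The family of the permutations that are given by four Feistel rounds with hash functions. -/
def feistelFamily (B τ L w : ℕ) : SeededFamily B where
  params := (parameters τ w).map (BitVec.ofNat B)
  seedLength := Fintype.card (BlockIndex L) * (32 * τ ^ 5)

/-- The member with seed `s`; a word of `w` bits has the same bits as an element of the group. -/
noncomputable def familyPerm (B τ L w : ℕ) [NeZero τ] (s : (feistelFamily B τ L w).Seed) :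
    Equiv.Perm (BitVec w) :=
  feistelPerm fun r x => XorWord.truncate w (wordHash (roundSeeds (seedBlocks s) r) x)

namespace WordRAM.Expr

open XorWord

variable {B τ L w : ℕ}

/-- The exclusive or of several expressions. -/
def sum : {n : ℕ} → (Fin n → Expr) → Expr
  | 0, _ => const 0
  | _ + 1, f => f 0 ^^^ sum fun i => f i.succ

theorem eval_sum {reg : ℕ → BitVec B} {mem : BitVec B → BitVec B} {n : ℕ} {f : Fin n → Expr}
    {v : Fin n → XorWord B} (h : ∀ i, (f i).eval reg mem = (v i).toBits) :
    (sum f).eval reg mem = (∑ i, v i).toBits := by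
  induction n with
  | zero => rfl
  | succ n ih =>
    rw [Fin.sum_univ_succ, toBits_add, ← ih fun i => h i.succ, ← h 0]
    rfl

theorem below_sum {d n : ℕ} {f : Fin n → Expr} (h : ∀ i, (f i).Below d) : (sum f).Below d := by
  induction n with
  | zero => trivial
  | succ n ih => exact ⟨h 0, ih fun i => h i.succ⟩

/-- The expression for the common word number `i`; see `parameters`. -/
def param (i : ℕ) : Expr := load (const i)

/-- The expression for the word number `e` of a block; the blocks follow the seven common words. -/
noncomputable def cell (β : BlockIndex L) (e : Expr) : Expr :=
  load (const 7 + (param 3 * const (blockNumber L β) + e))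

theorem below_cell {d : ℕ} (β : BlockIndex L) {e : Expr} (he : e.Below d) : (cell β e).Below d :=
  ⟨trivial, ⟨trivial, trivial⟩, he⟩

/-- The expression for `blockHash`. -/
noncomputable def hash (β : BlockIndex L) (N x : Expr) : Expr :=
  (cell β (const 0) + x * (cell β (const 1) + x * (cell β (const 2) + x * cell β (const 3))))
    / param 0 % N

theorem below_hash {d : ℕ} (β : BlockIndex L) {N x : Expr} (hN : N.Below d) (hx : x.Below d) :
    (hash β N x).Below d :=
  ⟨⟨⟨below_cell β trivial, hx, below_cell β trivial, hx, below_cell β trivial, hx,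
    below_cell β trivial⟩, trivial⟩, hN⟩

/-- The expression for the `tableSum` that determines the `j`-th position. -/
noncomputable def innerSum (r : Fin 4) (l : Fin L) (j : Fin 4) (x : Expr) : Expr :=
  sum fun i => cell (r, l, .inr (.inr (.inl (j, i)))) (hash (r, l, .inr (.inl (j, i))) (param 3) x)

/-- The expression for `position`. -/
noncomputable def tablePosition (r : Fin 4) (l : Fin L) (j : Fin 4) (x : Expr) : Expr :=
  hash (r, l, .inl ()) (param 1) x * param 2 + innerSum r l j x % param 2

/-- The expression for `wordHash`. -/
noncomputable def roundFunction (L : ℕ) (r : Fin 4) (x : Expr) : Expr :=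
  sum fun l : Fin L => sum fun j => cell (r, l, .inr (.inr (.inr j))) (tablePosition r l j x)

theorem below_roundFunction {d : ℕ} (r : Fin 4) {x : Expr} (hx : x.Below d) :
    (roundFunction L r x).Below d :=
  below_sum fun _ => below_sum fun _ => below_cell _ ⟨⟨below_hash _ trivial hx, trivial⟩,
    below_sum fun _ => below_cell _ (below_hash _ trivial hx), trivial⟩

/-- The expression for the left part of a word; the other masks are differences of those of the
lowest bits. -/
def leftPart (x : Expr) : Expr := x &&& param 5

/-- The expression for the right part of a word. -/
def rightPart (x : Expr) : Expr := x &&& (param 5 ^^^ param 6)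

/-- The expression for the extra part of a word. -/
def extraPart (x : Expr) : Expr := x &&& (param 4 ^^^ param 6)

/-- The expression for `feistelRound`. -/
noncomputable def feistelRound (L : ℕ) (r : Fin 4) (P Q : Expr → Expr) (x : Expr) : Expr :=
  x ^^^ Q (roundFunction L r (P x))

/-- The expression for `feistel`. -/
noncomputable def feistel (L : ℕ) (x : Expr) : Expr :=
  feistelRound L 3 (fun y => leftPart y ^^^ rightPart y) extraPart
    (feistelRound L 2 (fun y => leftPart y ^^^ extraPart y) rightPart
      (feistelRound L 1 (fun y => rightPart y ^^^ extraPart y) leftPart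
        (feistelRound L 0 leftPart (fun y => rightPart y ^^^ extraPart y) x)))

theorem below_feistel {d : ℕ} {x : Expr} (hx : x.Below d) : (feistel L x).Below d := by
  have h : ∀ (r : Fin 4) (P Q : Expr → Expr), (∀ y : Expr, y.Below d → (P y).Below d) →
      (∀ y : Expr, y.Below d → (Q y).Below d) →
      ∀ y : Expr, y.Below d → (feistelRound L r P Q y).Below d :=
    fun r P Q hP hQ y hy => ⟨hy, hQ _ (below_roundFunction r (hP y hy))⟩
  have hl : ∀ y : Expr, y.Below d → (leftPart y).Below d := fun y hy => ⟨hy, trivial⟩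
  have hr : ∀ y : Expr, y.Below d → (rightPart y).Below d := fun y hy => ⟨hy, trivial, trivial⟩
  have he : ∀ y : Expr, y.Below d → (extraPart y).Below d := fun y hy => ⟨hy, trivial, trivial⟩
  have hlr : ∀ y : Expr, y.Below d → (leftPart y ^^^ rightPart y).Below d :=
    fun y hy => ⟨hl y hy, hr y hy⟩
  have hle : ∀ y : Expr, y.Below d → (leftPart y ^^^ extraPart y).Below d :=
    fun y hy => ⟨hl y hy, he y hy⟩
  have hre : ∀ y : Expr, y.Below d → (rightPart y ^^^ extraPart y).Below d :=
    fun y hy => ⟨hr y hy, he y hy⟩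
  exact h 3 _ _ hlr he _ (h 2 _ _ hle hr _ (h 1 _ _ hre hl _ (h 0 _ _ hl hre x hx)))

/-- The memory `mem` contains the common words and the blocks `T`. -/
structure Represents (mem : BitVec B → BitVec B) (w : ℕ) (T : BlockIndex L → Block B τ) :
    Prop where
  param : ∀ (i : ℕ) (hi : i < 7), mem (BitVec.ofNat B i) = BitVec.ofNat B ((parameters τ w)[i])
  cell : ∀ (β : BlockIndex L) (i : Fin (32 * τ ^ 5)),
    mem (BitVec.ofNat B (7 + (32 * τ ^ 5 * blockNumber L β + i))) = (T β i).toBits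

section Eval

variable {reg : ℕ → BitVec B} {mem : BitVec B → BitVec B} {T : BlockIndex L → Block B τ}

theorem eval_cell (hT : Represents mem w T) (β : BlockIndex L) {e : Expr} {i : Fin (32 * τ ^ 5)}
    (he : e.eval reg mem = BitVec.ofNat B i) : (cell β e).eval reg mem = (T β i).toBits := by
  rw [← hT.cell β i, BitVec.ofNat_add, BitVec.ofNat_add, BitVec.ofNat_mul, ← he,
    show BitVec.ofNat B (32 * τ ^ 5) = _ from (hT.param 3 (by norm_num)).symm]
  rfl

theorem eval_param (hT : Represents mem w T) (i : ℕ) (hi : i < 7) :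
    (param i).eval reg mem = BitVec.ofNat B ((parameters τ w)[i]) := hT.param i hi

theorem eval_hash [NeZero τ] (hT : Represents mem w T) (hw : 3 * w < B) (β : BlockIndex L)
    {N x : Expr} {m : ℕ} [NeZero m] (hm : m < 2 ^ B) (hN : N.eval reg mem = BitVec.ofNat B m)
    {y : XorWord w} (hx : x.eval reg mem = y.toBits.setWidth B) :
    (hash β N x).eval reg mem = BitVec.ofNat B (blockHash w m (T β) y) := by
  have hτ : 0 < τ := Nat.pos_of_ne_zero (NeZero.ne τ)
  have hc : ∀ i : Fin 4, (cell β (const i)).eval reg mem = coefficients (T β) i := fun i => by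
    refine eval_cell hT β (i := Fin.ofNat (32 * τ ^ 5) i) ?_
    have h4 : 4 ≤ 32 * τ ^ 5 := by
      have : 0 < τ ^ 5 := by positivity
      omega
    rw [Fin.val_ofNat, Nat.mod_eq_of_lt (by omega)]
    rfl
  have hx' : x.eval reg mem = (y.toBits.toNat : BitVec B) := by
    rw [hx, BitVec.natCast_eq_ofNat, BitVec.ofNat_toNat]
  have h2 : 2 ^ (3 * w) < 2 ^ B := Nat.pow_lt_pow_right (by norm_num) hw
  have hev : (hash β N x).eval reg mem = cubic (coefficients (T β)) (y.toBits.toNat : BitVec B)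
      / BitVec.ofNat B (2 ^ (3 * w)) % BitVec.ofNat B m := by
    rw [cubic, ← hN, show BitVec.ofNat B (2 ^ (3 * w)) = _ from (hT.param 0 (by norm_num)).symm,
      ← hx', ← hc, ← hc, ← hc, ← hc]
    rfl
  rw [hev]
  apply BitVec.eq_of_toNat_eq
  have hlt := (blockHash w m (T β) y).isLt
  rw [BitVec.toNat_umod, BitVec.toNat_udiv, BitVec.toNat_ofNat, BitVec.toNat_ofNat,
    BitVec.toNat_ofNat, Nat.mod_eq_of_lt h2, Nat.mod_eq_of_lt hm,
    Nat.mod_eq_of_lt (hlt.trans hm)]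
  rfl

theorem eval_innerSum [NeZero τ] (hT : Represents mem w T) (hw : 3 * w < B)
    (hτ : 32 * τ ^ 5 < 2 ^ B) (r : Fin 4) (l : Fin L) (j : Fin 4) {x : Expr} {y : XorWord w}
    (hx : x.eval reg mem = y.toBits.setWidth B) :
    (innerSum r l j x).eval reg mem = (tableSum (blockHash w (32 * τ ^ 5))
      ((roundSeeds T r l).1.2.1 j) ((roundSeeds T r l).1.2.2 j) y).toBits :=
  eval_sum fun _ => eval_cell hT _ (eval_hash hT hw _ hτ (eval_param hT 3 (by norm_num)) hx)

theorem eval_tablePosition [NeZero τ] (hT : Represents mem w T) (hw : 3 * w < B)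
    (hτ : 32 * τ ^ 5 < 2 ^ B) (r : Fin 4) (l : Fin L) (j : Fin 4) {x : Expr} {y : XorWord w}
    (hx : x.eval reg mem = y.toBits.setWidth B) :
    (tablePosition r l j x).eval reg mem = BitVec.ofNat B (position (blockHash w (τ ^ 3))
      (blockHash w (32 * τ ^ 5)) (residue (16 * τ ^ 2)) bucketCell
        (roundSeeds T r l).1 j y).val := by
  have h0 : 0 < τ := Nat.pos_of_ne_zero (NeZero.ne τ)
  have h3 : τ ^ 3 < 2 ^ B := lt_of_le_of_lt (by
    have : τ ^ 3 ≤ τ ^ 5 := Nat.pow_le_pow_right h0 (by norm_num)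
    omega) hτ
  have h2 : 16 * τ ^ 2 < 2 ^ B := lt_of_le_of_lt (by
    have : τ ^ 2 ≤ τ ^ 5 := Nat.pow_le_pow_right h0 (by norm_num)
    omega) hτ
  set u := tableSum (blockHash w (32 * τ ^ 5)) ((roundSeeds T r l).1.2.1 j)
    ((roundSeeds T r l).1.2.2 j) y with hu
  have hmod : u.toBits % BitVec.ofNat B (16 * τ ^ 2)
      = BitVec.ofNat B (residue (16 * τ ^ 2) u).val := by
    apply BitVec.eq_of_toNat_eq
    have hlt := (residue (16 * τ ^ 2) u).isLt
    rw [BitVec.toNat_umod, BitVec.toNat_ofNat, BitVec.toNat_ofNat, Nat.mod_eq_of_lt h2,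
      Nat.mod_eq_of_lt (hlt.trans h2)]
    rfl
  rw [position, bucketCell_val, BitVec.ofNat_add, BitVec.ofNat_mul, ← hu, ← hmod,
    ← eval_innerSum hT hw hτ r l j hx]
  have hh := eval_hash hT hw (r, l, .inl ()) h3 (eval_param hT 1 (by norm_num)) hx
  rw [show BitVec.ofNat B (16 * τ ^ 2) = _ from (hT.param 2 (by norm_num)).symm]
  exact congrArg (fun z => z * mem (BitVec.ofNat B 2) + _) hh

theorem eval_roundFunction [NeZero τ] (hT : Represents mem w T) (hw : 3 * w < B)
    (hτ : 32 * τ ^ 5 < 2 ^ B) (r : Fin 4) {x : Expr} {y : XorWord w}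
    (hx : x.eval reg mem = y.toBits.setWidth B) :
    (roundFunction L r x).eval reg mem = (wordHash (roundSeeds T r) y).toBits :=
  eval_sum fun l => eval_sum fun j => eval_cell hT _ (eval_tablePosition hT hw hτ r l j hx)

/-- Masking a word of `B` bits also removes the bits beyond the lowest `w`. -/
theorem setWidth_mask {m x : XorWord w} {y : BitVec B} (hy : y.setWidth w = x.toBits) :
    (mask m x).toBits.setWidth B = y &&& m.toBits.setWidth B := by
  apply BitVec.eq_of_getLsbD_eq
  intro i hi
  have h1 : (mask m x).toBits = x.toBits &&& m.toBits := rfl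
  rw [h1, ← hy, BitVec.getLsbD_and, BitVec.getLsbD_setWidth, BitVec.getLsbD_setWidth,
    BitVec.getLsbD_and, BitVec.getLsbD_setWidth]
  by_cases h : i < w
  · simp [h, hi]
  · simp [BitVec.getLsbD_of_ge _ _ (not_lt.1 h)]

theorem setWidth_lowMask {a : ℕ} (ha : a ≤ w) :
    (lowMask w a).toBits.setWidth B = BitVec.ofNat B (2 ^ a - 1) := by
  apply BitVec.eq_of_toNat_eq
  have h1 : 2 ^ a - 1 < 2 ^ w := by
    have := Nat.pow_le_pow_right (n := 2) (by norm_num) ha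
    have : 0 < 2 ^ a := by positivity
    omega
  change (BitVec.setWidth B (BitVec.ofNat w (2 ^ a - 1))).toNat = _
  rw [BitVec.toNat_setWidth, BitVec.toNat_ofNat, BitVec.toNat_ofNat, Nat.mod_eq_of_lt h1]

theorem setWidth_add (x y : XorWord w) :
    (x + y).toBits.setWidth B = x.toBits.setWidth B ^^^ y.toBits.setWidth B := by
  rw [toBits_add, BitVec.setWidth_xor]

theorem eval_leftPart (hT : Represents mem w T) {x : Expr} {y : XorWord w}
    (hx : (x.eval reg mem).setWidth w = y.toBits) :
    (leftPart x).eval reg mem = ((splitting w).L y).toBits.setWidth B := by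
  refine Eq.trans ?_ (setWidth_mask hx).symm
  rw [setWidth_lowMask (by omega),
    show BitVec.ofNat B (2 ^ (w / 2) - 1) = _ from (hT.param 5 (by norm_num)).symm]
  rfl

theorem eval_rightPart (hT : Represents mem w T) {x : Expr} {y : XorWord w}
    (hx : (x.eval reg mem).setWidth w = y.toBits) :
    (rightPart x).eval reg mem = ((splitting w).R y).toBits.setWidth B := by
  refine Eq.trans ?_ (setWidth_mask hx).symm
  rw [setWidth_add, setWidth_lowMask (by omega), setWidth_lowMask (by omega),
    show BitVec.ofNat B (2 ^ (w / 2) - 1) = _ from (hT.param 5 (by norm_num)).symm,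
    show BitVec.ofNat B (2 ^ (2 * (w / 2)) - 1) = _ from (hT.param 6 (by norm_num)).symm]
  rfl

theorem eval_extraPart (hT : Represents mem w T) {x : Expr} {y : XorWord w}
    (hx : (x.eval reg mem).setWidth w = y.toBits) :
    (extraPart x).eval reg mem = ((splitting w).E y).toBits.setWidth B := by
  refine Eq.trans ?_ (setWidth_mask hx).symm
  rw [setWidth_add, setWidth_lowMask le_rfl, setWidth_lowMask (by omega),
    show BitVec.ofNat B (2 ^ w - 1) = _ from (hT.param 4 (by norm_num)).symm,
    show BitVec.ofNat B (2 ^ (2 * (w / 2)) - 1) = _ from (hT.param 6 (by norm_num)).symm]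
  rfl

theorem eval_xor {x x' : Expr} {y y' : XorWord w}
    (hx : x.eval reg mem = y.toBits.setWidth B) (hx' : x'.eval reg mem = y'.toBits.setWidth B) :
    (x ^^^ x').eval reg mem = (y + y').toBits.setWidth B := by
  rw [setWidth_add, ← hx, ← hx']
  rfl

/-- Intermediate results are words of `w` bits, extended by zeros; the values of hash functions have
more bits, which the masks remove. -/
theorem eval_feistelRound [NeZero τ] (hT : Represents mem w T) (hw : 3 * w < B)
    (hτ : 32 * τ ^ 5 < 2 ^ B) (r : Fin 4) {P Q : Expr → Expr} {P' Q' : XorWord w → XorWord w}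
    (hP : ∀ {x : Expr} {y : XorWord w}, (x.eval reg mem).setWidth w = y.toBits →
      (P x).eval reg mem = (P' y).toBits.setWidth B)
    (hQ : ∀ {x : Expr} {y : XorWord w}, (x.eval reg mem).setWidth w = y.toBits →
      (Q x).eval reg mem = (Q' y).toBits.setWidth B)
    {x : Expr} {y : XorWord w} (hx : x.eval reg mem = y.toBits.setWidth B) :
    (feistelRound L r P Q x).eval reg mem = (_root_.feistelRound P' Q'
      (fun z => truncate w (wordHash (roundSeeds T r) z)) y).toBits.setWidth B := by
  refine eval_xor hx (hQ ?_)
  rw [eval_roundFunction hT hw hτ r (hP ?_)]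
  · rfl
  · rw [hx, BitVec.setWidth_setWidth_of_le _ (by omega), BitVec.setWidth_eq]

theorem eval_feistel [NeZero τ] (hT : Represents mem w T) (hw : 3 * w < B)
    (hτ : 32 * τ ^ 5 < 2 ^ B) {x : Expr} {y : XorWord w}
    (hx : x.eval reg mem = y.toBits.setWidth B) :
    (feistel L x).eval reg mem = (feistelPerm
      (fun r z => truncate w (wordHash (roundSeeds T r) z)) y).toBits.setWidth B := by
  rw [feistelPerm_apply]
  refine eval_feistelRound hT hw hτ 3 (P' := (splitting w).L + (splitting w).R)
    (fun h => eval_xor (eval_leftPart hT h) (eval_rightPart hT h))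
    (eval_extraPart hT) ?_
  refine eval_feistelRound hT hw hτ 2 (P' := (splitting w).L + (splitting w).E)
    (fun h => eval_xor (eval_leftPart hT h) (eval_extraPart hT h))
    (eval_rightPart hT) ?_
  refine eval_feistelRound hT hw hτ 1 (P' := (splitting w).R + (splitting w).E)
    (fun h => eval_xor (eval_rightPart hT h) (eval_extraPart hT h))
    (eval_leftPart hT) ?_
  exact eval_feistelRound hT hw hτ 0 (Q' := (splitting w).R + (splitting w).E)
    (eval_leftPart hT)
    (fun h => eval_xor (eval_rightPart hT h) (eval_extraPart hT h)) hx

end Eval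

end WordRAM.Expr

section Evaluation

variable {B τ L w : ℕ}

open WordRAM WordRAM.Expr

theorem represents_description
    (hsize : 7 + Fintype.card (BlockIndex L) * (32 * τ ^ 5) ≤ 2 ^ B)
    (s : (feistelFamily B τ L w).Seed) (args : List (BitVec B)) :
    Represents (initial args ((feistelFamily B τ L w).description s)).mem w (seedBlocks s) where
  param i hi := by
    have h1 : (BitVec.ofNat B i).toNat = i := by
      rw [BitVec.toNat_ofNat, Nat.mod_eq_of_lt (by omega)]
    have hi' : i < ((parameters τ w).map (BitVec.ofNat B)).length := by simpa [parameters] using hi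
    change (((parameters τ w).map (BitVec.ofNat B)) ++ List.ofFn s).getD (BitVec.ofNat B i).toNat 0
      = _
    rw [h1, List.getD_append _ _ _ _ hi', List.getD_eq_getElem _ _ hi', List.getElem_map]
    rfl
  cell β i := by
    set e := finProdFinEquiv (blockNumber L β, i) with he
    have hev : (e : ℕ) = i + 32 * τ ^ 5 * blockNumber L β := rfl
    have hlt := e.isLt
    have h1 : (BitVec.ofNat B (7 + (32 * τ ^ 5 * blockNumber L β + i))).toNat = 7 + e := by
      rw [BitVec.toNat_ofNat, Nat.mod_eq_of_lt (by omega), hev]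
      ring
    change (((parameters τ w).map (BitVec.ofNat B)) ++ List.ofFn s).getD (BitVec.toNat _) 0 = _
    have hlen : ((parameters τ w).map (BitVec.ofNat B)).length = 7 := rfl
    rw [h1, List.getD_append_right _ _ _ _ (by omega), hlen, Nat.add_sub_cancel_left,
      List.getD_eq_getElem _ _ (by rw [List.length_ofFn]; exact hlt),
      List.getElem_ofFn]
    rfl

/-- The program that evaluates the expression for the permutation. -/
noncomputable def evalProgram (L : ℕ) : Program := (feistel L (var 0)).toProgram

theorem evaluates_feistelFamily [NeZero τ] (hw : 3 * w < B)
    (hsize : 7 + Fintype.card (BlockIndex L) * (32 * τ ^ 5) ≤ 2 ^ B) (hτ : 32 * τ ^ 5 < 2 ^ B) :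
    (feistelFamily B τ L w).Evaluates (evalProgram L) (evalProgram L).length
      (familyPerm B τ L w) := fun s x => by
  obtain ⟨c, hc, hc'⟩ := stopsWithin_toProgram (feistel L (var 0))
    (below_feistel (d := 1) (x := var 0) Nat.zero_lt_one)
    (initial [BitVec.ofNat B x.toNat] ((feistelFamily B τ L w).description s)) rfl
  refine ⟨c, hc, ?_⟩
  have hev := eval_feistel (reg := (initial [BitVec.ofNat B x.toNat] []).reg) (x := var 0)
    (represents_description hsize s [BitVec.ofNat B x.toNat]) hw hτ (y := XorWord.ofBits x)
    (BitVec.ofNat_toNat B x)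
  rw [hc']
  refine (congrArg BitVec.toNat hev).trans ?_
  exact BitVec.toNat_setWidth_of_le (by omega)

end Evaluation

/-! ### Construction of the family -/

section Setup

open WordRAM WordRAM.Expr

variable {B : ℕ}

theorem BitVec.ofNat_one_shiftLeft_ofNat {v : ℕ} (hv : v < 2 ^ B) :
    BitVec.ofNat B 1 <<< BitVec.ofNat B v = BitVec.ofNat B (2 ^ v) := by
  apply BitVec.eq_of_toNat_eq
  rw [BitVec.shiftLeft_eq', BitVec.toNat_shiftLeft, BitVec.toNat_ofNat, BitVec.toNat_ofNat,
    BitVec.toNat_ofNat, Nat.mod_eq_of_lt hv, Nat.shiftLeft_eq, Nat.mod_mul_mod, one_mul]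

theorem BitVec.ofNat_sub_ofNat_one {v : ℕ} (hv : 1 ≤ v) :
    BitVec.ofNat B v - BitVec.ofNat B 1 = BitVec.ofNat B (v - 1) := by
  rw [sub_eq_iff_eq_add, ← BitVec.ofNat_add, Nat.sub_add_cancel hv]

theorem BitVec.ofNat_div_ofNat {u v : ℕ} (hu : u < 2 ^ B) (hv : v < 2 ^ B) :
    BitVec.ofNat B u / BitVec.ofNat B v = BitVec.ofNat B (u / v) := by
  apply BitVec.eq_of_toNat_eq
  rw [BitVec.toNat_udiv, BitVec.toNat_ofNat, BitVec.toNat_ofNat, BitVec.toNat_ofNat,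
    Nat.mod_eq_of_lt hu, Nat.mod_eq_of_lt hv,
    Nat.mod_eq_of_lt (lt_of_le_of_lt (Nat.div_le_self u v) hu)]

/-- Expressions for the words of `parameters`, if the registers `2`, `3` and `4` contain `w`,
`τ ^ 5` and `τ`. -/
def parameterExprs : List Expr :=
  let pow2 (e : Expr) : Expr := bin .shl (const 1) e
  let half : Expr := var 2 / const 2
  [pow2 (const 3 * var 2), var 4 * var 4 * var 4, const 16 * (var 4 * var 4), const 32 * var 3,
    pow2 (var 2) - const 1, pow2 half - const 1, pow2 (const 2 * half) - const 1]

theorem below_parameterExprs : ∀ e ∈ parameterExprs, e.Below 5 := by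
  simp only [parameterExprs, List.forall_mem_cons]
  have h : ∀ i < 5, (var i).Below 5 := fun i hi => hi
  have h2 := h 2 (by norm_num)
  have h3 := h 3 (by norm_num)
  have h4 := h 4 (by norm_num)
  exact ⟨⟨trivial, trivial, h2⟩, ⟨⟨h4, h4⟩, h4⟩, ⟨trivial, h4, h4⟩, ⟨trivial, h3⟩,
    ⟨⟨trivial, h2⟩, trivial⟩, ⟨⟨trivial, h2, trivial⟩, trivial⟩,
    ⟨⟨trivial, trivial, h2, trivial⟩, trivial⟩, fun _ h => absurd h List.not_mem_nil⟩

theorem eval_parameterExprs_congr : ∀ e ∈ parameterExprs, ∀ (reg : ℕ → BitVec B)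
    (mem mem' : BitVec B → BitVec B), e.eval reg mem = e.eval reg mem' := by
  simp only [parameterExprs, List.forall_mem_cons]
  exact ⟨fun _ _ _ => rfl, fun _ _ _ => rfl, fun _ _ _ => rfl, fun _ _ _ => rfl,
    fun _ _ _ => rfl, fun _ _ _ => rfl, fun _ _ _ => rfl, fun _ h => absurd h List.not_mem_nil⟩

theorem eval_parameterExprs {reg : ℕ → BitVec B} (mem : BitVec B → BitVec B) {w τ : ℕ}
    (hw : 3 * w < B) (hB : 2 ≤ B) (h2 : reg 2 = BitVec.ofNat B w)
    (h3 : reg 3 = BitVec.ofNat B (τ ^ 5)) (h4 : reg 4 = BitVec.ofNat B τ) :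
    parameterExprs.map (fun e => e.eval reg mem) = (parameters τ w).map (BitVec.ofNat B) := by
  have hB' : B < 2 ^ B := Nat.lt_two_pow_self
  have hhalf : reg 2 / BitVec.ofNat B 2 = BitVec.ofNat B (w / 2) := by
    rw [h2, BitVec.ofNat_div_ofNat (by omega) (by omega)]
  have hpow : ∀ v < B, BitVec.ofNat B 1 <<< BitVec.ofNat B v = BitVec.ofNat B (2 ^ v) :=
    fun v hv => BitVec.ofNat_one_shiftLeft_ofNat (by omega)
  have hsub : ∀ v, BitVec.ofNat B (2 ^ v) - BitVec.ofNat B 1 = BitVec.ofNat B (2 ^ v - 1) :=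
    fun v => BitVec.ofNat_sub_ofNat_one Nat.one_le_two_pow
  have e0 : BitVec.ofNat B 1 <<< (BitVec.ofNat B 3 * reg 2) = BitVec.ofNat B (2 ^ (3 * w)) := by
    rw [h2, ← BitVec.ofNat_mul, hpow _ (by omega)]
  have e1 : reg 4 * reg 4 * reg 4 = BitVec.ofNat B (τ ^ 3) := by
    rw [h4, ← BitVec.ofNat_mul, ← BitVec.ofNat_mul]
    congr 1
    ring
  have e2 : BitVec.ofNat B 16 * (reg 4 * reg 4) = BitVec.ofNat B (16 * τ ^ 2) := by
    rw [h4, ← BitVec.ofNat_mul, ← BitVec.ofNat_mul]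
    congr 1
    ring
  have e3 : BitVec.ofNat B 32 * reg 3 = BitVec.ofNat B (32 * τ ^ 5) := by
    rw [h3, ← BitVec.ofNat_mul]
  have e4 : BitVec.ofNat B 1 <<< reg 2 - BitVec.ofNat B 1 = BitVec.ofNat B (2 ^ w - 1) := by
    rw [h2, hpow _ (by omega), hsub]
  have e5 : BitVec.ofNat B 1 <<< (reg 2 / BitVec.ofNat B 2) - BitVec.ofNat B 1
      = BitVec.ofNat B (2 ^ (w / 2) - 1) := by
    rw [hhalf, hpow _ (by omega), hsub]
  have e6 : BitVec.ofNat B 1 <<< (BitVec.ofNat B 2 * (reg 2 / BitVec.ofNat B 2)) - BitVec.ofNat B 1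
      = BitVec.ofNat B (2 ^ (2 * (w / 2)) - 1) := by
    rw [hhalf, ← BitVec.ofNat_mul, hpow _ (by omega), hsub]
  change [_, _, _, _, _, _, _] = [_, _, _, _, _, _, _]
  rw [← e0, ← e1, ← e2, ← e3, ← e4, ← e5, ← e6]
  rfl

/-- The part of the setup after `τ` has been found: it stores the common words, and returns their
number and the seed length. -/
def setupOutput (L : ℕ) : Program :=
  storeAll 5 0 parameterExprs ++
    ((const (Fintype.card (BlockIndex L)) * (const 32 * var 3)).compile 5 ++
      [.bin .or 1 5 5, .const 0 7])

/-- The setup program. It finds the least `τ = 2 ^ t` with `t ≥ 1` and `k ≤ τ ^ 5` by trial, with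
`τ ^ 5` in register `3` and `τ` in register `4`. -/
def setupProgram (L : ℕ) : Program :=
  [.const 3 1, .const 4 1, .const 5 32, .const 6 2, .bin .mul 3 3 5, .bin .mul 4 4 6, .jlt 3 1 4]
    ++ setupOutput L

/-- The contents of the registers after `i` passes through the loop of the setup program. -/
structure LoopState (k w i : ℕ) (c : Config B) : Prop where
  reg1 : c.reg 1 = BitVec.ofNat B k
  reg2 : c.reg 2 = BitVec.ofNat B w
  reg3 : c.reg 3 = BitVec.ofNat B (32 ^ i)
  reg4 : c.reg 4 = BitVec.ofNat B (2 ^ i)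
  reg5 : c.reg 5 = BitVec.ofNat B 32
  reg6 : c.reg 6 = BitVec.ofNat B 2

/-- One pass through the loop. -/
theorem loopState_succ {L k w i : ℕ} {c : Config B} (hc : LoopState k w i c) (hpc : c.pc = 4)
    (hk : k < 2 ^ B) (hi : 32 ^ (i + 1) < 2 ^ B) :
    LoopState k w (i + 1) ((step (setupProgram L))^[3] c) ∧
      ((step (setupProgram L))^[3] c).pc = if 32 ^ (i + 1) < k then 4 else 7 := by
  let c₂ : Config B := run [.bin .mul 3 3 5, .bin .mul 4 4 6] c
  have h1 : (step (setupProgram L))^[3] c = (Instr.jlt 3 1 4).exec c₂ := by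
    obtain ⟨h1, h2⟩ := iterate_step (P := setupProgram L)
      (code := [.bin .mul 3 3 5, .bin .mul 4 4 6])
      (fun i hi B c => by
        rcases List.mem_cons.1 hi with rfl | hi
        · rfl
        · rw [List.mem_singleton.1 hi]; rfl) c
      (by rw [hpc]; exact ⟨.jlt 3 1 4 :: setupOutput L, rfl⟩)
    rw [Function.iterate_succ_apply',
      show 2 = [Instr.bin .mul 3 3 5, .bin .mul 4 4 6].length from rfl, h1]
    exact step_eq (by rw [h2, hpc]; exact ⟨setupOutput L, rfl⟩)
  have r1 : c₂.reg 1 = BitVec.ofNat B k := hc.reg1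
  have r3 : c₂.reg 3 = BitVec.ofNat B (32 ^ (i + 1)) := by
    rw [pow_succ, BitVec.ofNat_mul, ← hc.reg3, ← hc.reg5]
    rfl
  rw [h1]
  refine ⟨⟨r1, hc.reg2, r3, ?_, hc.reg5, hc.reg6⟩, ?_⟩
  · rw [pow_succ, BitVec.ofNat_mul, ← hc.reg4, ← hc.reg6]
    rfl
  · change (if (c₂.reg 3).toNat < (c₂.reg 1).toNat then 4 else c.pc + 1 + 1 + 1) = _
    rw [r1, r3, BitVec.toNat_ofNat, BitVec.toNat_ofNat, Nat.mod_eq_of_lt hk, Nat.mod_eq_of_lt hi,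
      hpc]

theorem exists_loopState {L k w t : ℕ} {c : Config B} (hc : LoopState k w 0 c) (hpc : c.pc = 4)
    (hk : k < 2 ^ B) (ht : 32 ^ t < 2 ^ B) (ht1 : 1 ≤ t) (hkt : k ≤ 32 ^ t)
    (hlt : ∀ i, 1 ≤ i → i < t → 32 ^ i < k) :
    LoopState k w t ((step (setupProgram L))^[3 * t] c) ∧
      ((step (setupProgram L))^[3 * t] c).pc = 7 := by
  have key : ∀ i ≤ t, LoopState k w i ((step (setupProgram L))^[3 * i] c) ∧
      ((step (setupProgram L))^[3 * i] c).pc = if i < t then 4 else 7 := by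
    intro i
    induction i with
    | zero => exact fun _ => ⟨hc, by rw [if_pos (by omega)]; exact hpc⟩
    | succ i ih =>
      intro hi
      obtain ⟨h1, h2⟩ := ih (by omega)
      rw [if_pos (by omega)] at h2
      have h3 : 32 ^ (i + 1) < 2 ^ B :=
        lt_of_le_of_lt (Nat.pow_le_pow_right (by norm_num) hi) ht
      obtain ⟨h4, h5⟩ := loopState_succ (L := L) h1 h2 hk h3
      rw [show 3 * (i + 1) = 3 + 3 * i by ring, Function.iterate_add_apply]
      refine ⟨h4, h5.trans ?_⟩
      congr 1
      refine propext ⟨fun h => ?_, fun h => hlt _ (by omega) h⟩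
      by_contra hcon
      rw [show i + 1 = t by omega] at h
      omega
  have := key t le_rfl
  rwa [if_neg (lt_irrefl t)] at this

theorem SeededFamily.eq_ofConfig {F : SeededFamily B} {c : Config B}
    (h0 : (c.reg 0).toNat = F.params.length) (h1 : (c.reg 1).toNat = F.seedLength)
    (hmem : ∀ (i : ℕ) (hi : i < F.params.length), c.mem (BitVec.ofNat B i) = F.params[i]) :
    F = ofConfig c := by
  obtain ⟨p, l⟩ := F
  simp only at h0 h1 hmem
  rw [ofConfig, h1]
  congr 1
  refine List.ext_getElem (by rw [List.length_ofFn, h0]) fun i hi hi' => ?_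
  rw [List.getElem_ofFn, hmem i hi]

theorem isOutput_feistelFamily {L n k w t : ℕ} (hw : 3 * w < B) (hB : 3 ≤ B) (hk : k < 2 ^ B)
    (hsize : 7 + Fintype.card (BlockIndex L) * (32 * (2 ^ t) ^ 5) < 2 ^ B) (ht : 32 ^ t < 2 ^ B)
    (ht1 : 1 ≤ t) (hkt : k ≤ 32 ^ t) (hlt : ∀ i, 1 ≤ i → i < t → 32 ^ i < k) :
    (feistelFamily B (2 ^ t) L w).IsOutput (setupProgram L) (4 + 3 * t + (setupOutput L).length)
      n k w := by
  set P := setupProgram L with hP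
  set c₀ : Config B :=
    initial [BitVec.ofNat B n, BitVec.ofNat B k, BitVec.ofNat B w] [] with hc₀
  have hstr : IsStraight [.const 3 1, .const 4 1, .const 5 32, .const 6 2] := by
    simp only [IsStraight, List.forall_mem_cons]
    exact ⟨fun _ _ => rfl, fun _ _ => rfl, fun _ _ => rfl, fun _ _ => rfl,
      fun _ h => absurd h List.not_mem_nil⟩
  obtain ⟨a1, a2⟩ := iterate_step (P := P) hstr c₀
    ⟨[.bin .mul 3 3 5, .bin .mul 4 4 6, .jlt 3 1 4] ++ setupOutput L, rfl⟩
  set c₁ := run [.const 3 1, .const 4 1, .const 5 32, .const 6 2] c₀ with hc₁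
  obtain ⟨b1, b2⟩ := exists_loopState (L := L) (c := c₁) ⟨rfl, rfl, rfl, rfl, rfl, rfl⟩ a2 hk ht ht1
    hkt hlt
  set c₂ := (step (setupProgram L))^[3 * t] c₁ with hc₂
  have hstr' : IsStraight (setupOutput L) :=
    (isStraight_storeAll 5 0 parameterExprs).append <|
      (isStraight_compile _ 5).append fun i hi B c => by
      rcases List.mem_cons.1 hi with rfl | hi
      · rfl
      · rw [List.mem_singleton.1 hi]; rfl
  obtain ⟨d1, d2⟩ := iterate_step (P := P) hstr' c₂ (by
    rw [b2]; exact List.prefix_rfl)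
  have hB8 : 2 ^ 3 ≤ 2 ^ B := Nat.pow_le_pow_right (by norm_num) hB
  obtain ⟨s1, -, s3⟩ := run_storeAll (d := 5) parameterExprs 0 below_parameterExprs
    eval_parameterExprs_congr (show 0 + 7 ≤ 2 ^ B by omega) c₂
  set c₃ := run (storeAll 5 0 parameterExprs) c₂ with hc₃
  obtain ⟨e1, e2, -⟩ := run_compile (const (Fintype.card (BlockIndex L)) * (const 32 * var 3)) 5
    ⟨trivial, trivial, show 3 < 5 by norm_num⟩ c₃
  set c₄ := run ((const (Fintype.card (BlockIndex L)) * (const 32 * var 3)).compile 5) c₃ with hc₄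
  have hrun : run (setupOutput L) c₂ = run [.bin .or 1 5 5, .const 0 7] c₄ := by
    rw [setupOutput, run_append, run_append]
  have hpow : (32 : ℕ) ^ t = (2 ^ t) ^ 5 := by
    rw [← pow_mul, mul_comm, pow_mul]
    norm_num
  refine ⟨run (setupOutput L) c₂, ⟨?_, ?_⟩, SeededFamily.eq_ofConfig ?_ ?_ ?_⟩
  · rw [show 4 + 3 * t + (setupOutput L).length = (setupOutput L).length + (3 * t + 4) by ring,
      Function.iterate_add_apply, Function.iterate_add_apply,
      show 4 = [Instr.const 3 1, .const 4 1, .const 5 32, .const 6 2].length from rfl, a1,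
      ← d1]
  · rw [d2, b2, hP, setupProgram, List.length_append]
    rfl
  · rw [hrun]
    change (BitVec.ofNat B 7).toNat = 7
    rw [BitVec.toNat_ofNat, Nat.mod_eq_of_lt (by omega)]
  · rw [hrun]
    change (c₄.reg 5 ||| c₄.reg 5).toNat = Fintype.card (BlockIndex L) * (32 * (2 ^ t) ^ 5)
    have h3 : c₃.reg 3 = BitVec.ofNat B ((2 ^ t) ^ 5) := by
      rw [s1 3 (by norm_num), b1.reg3, hpow]
    have h5 : c₄.reg 5 = BitVec.ofNat B (Fintype.card (BlockIndex L) * (32 * (2 ^ t) ^ 5)) := by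
      rw [e2, BitVec.ofNat_mul, BitVec.ofNat_mul, ← h3]
      rfl
    rw [BitVec.or_self, h5, BitVec.toNat_ofNat, Nat.mod_eq_of_lt (by omega)]
  · intro i hi
    rw [hrun]
    change c₄.mem (BitVec.ofNat B i) = ((parameters (2 ^ t) w).map (BitVec.ofNat B))[i]
    have hi7 : i < parameterExprs.length := hi
    have h := s3 i hi7
    rw [zero_add] at h
    rw [e1, h]
    have hmap := eval_parameterExprs c₂.mem hw (by omega) b1.reg2 (b1.reg3.trans (by rw [hpow]))
      b1.reg4
    simp only [← hmap, List.getElem_map]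

end Setup

/-! ### Distance of the family from random permutations -/

section Distance

open XorWord

theorem expect_fin_four {Ω : Type*} [Fintype Ω] (f : (Fin 4 → Ω) → ℝ) :
    𝔼 ω, f ω = 𝔼 ω₀, 𝔼 ω₁, 𝔼 ω₂, 𝔼 ω₃, f ![ω₀, ω₁, ω₂, ω₃] := by
  let e : Ω × Ω × Ω × Ω ≃ (Fin 4 → Ω) :=
    { toFun := fun p => ![p.1, p.2.1, p.2.2.1, p.2.2.2]
      invFun := fun ω => (ω 0, ω 1, ω 2, ω 3)
      left_inv := fun p => rfl
      right_inv := fun ω => by funext i; fin_cases i <;> rfl }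
  rw [← Fintype.expect_equiv e (fun p => f (e p)) f fun p => rfl]
  simp only [expect_prod]
  rfl

variable {B τ L w : ℕ}

theorem expect_familyPerm [NeZero τ] (φ : (XorWord w → XorWord w) → ℝ) :
    𝔼 s, φ (familyPerm B τ L w s) = 𝔼 ω₀ : WordSeed B τ L, 𝔼 ω₁ : WordSeed B τ L,
      𝔼 ω₂ : WordSeed B τ L, 𝔼 ω₃ : WordSeed B τ L,
      φ (feistel (splitting w) (fun x => truncate w (wordHash ω₀ x))
        (fun x => truncate w (wordHash ω₁ x)) (fun x => truncate w (wordHash ω₂ x))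
        fun x => truncate w (wordHash ω₃ x)) := by
  refine (Fintype.expect_equiv (seedBlocks.trans roundSeeds) _
    (fun ω : Fin 4 → WordSeed B τ L => φ (feistelPerm fun r x => truncate w (wordHash (ω r) x)))
    fun s => rfl).trans ((expect_fin_four _).trans rfl)

/-- On a set of `k` points the random member of the family is as good as a random permutation, for
all seeds together, so that no event has to be excluded. -/
theorem statDist_familyPerm_le [NeZero τ] {t k : ℕ} (ht : τ = 2 ^ t)
    (hB : 3 * w + 5 * t + 5 ≤ B) (hw : 2 ≤ w) (hk : 2 ≤ k) (hkτ : k ≤ τ ^ 5)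
    (hε : (3 + (k : ℝ) * k) * (1 / τ) ^ L ≤ k * (1 / 2) ^ w * (1 / 10))
    (h : (Finset.univ : Finset (feistelFamily B τ L w).Seed).Nonempty) (S : Finset (BitVec w))
    (hS : S.card = k) :
    statDist (valuesOn (familyPerm B τ L w) Finset.univ h S) (trulyRandomValuesOn S) ≤
      (k : ℝ) ^ 2 / 2 ^ ((w : ℝ) / 2) + (k : ℝ) ^ 2 / 2 ^ (w : ℝ) := by
  have hτ : 0 < τ := Nat.pos_of_ne_zero (NeZero.ne τ)
  have hε0 : (0 : ℝ) ≤ (1 / τ) ^ L := by positivity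
  refine statDist_valuesOn_le h _ S fun φ h0 h1 => ?_
  let S' : Finset (XorWord w) := S
  let φ' : (S' → XorWord w) → ℝ := φ
  have hF := almostUniform_wordHash (B := B) (w := w) ht hB hkτ L
  have hmid := hF.expect_feistel_le (splitting w) hε0 hk S' hS (κ := 2 * (1 / 2) ^ (w - w / 2))
    ?_ ?_ (by positivity) (pow_le_one₀ (by norm_num) (by norm_num)) φ' h0 h1
  · have hperm := expect_le_expect_perm S' hS φ' h0 h1
    rw [XorWord.card_eq] at hperm
    have herr := error_le hw (by omega : 1 ≤ k) hε0 hε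
    have hfam := expect_familyPerm (B := B) (τ := τ) (L := L) (w := w) fun p => φ' fun x => p x
    push_cast at hperm
    have hfin := hfam.trans_le hmid
    have hsum : 𝔼 s, φ' (fun x => familyPerm B τ L w s x.1)
        ≤ (𝔼 σ : Equiv.Perm (XorWord w), φ' fun x => σ x)
          + ((k : ℝ) ^ 2 / 2 ^ ((w : ℝ) / 2) + (k : ℝ) ^ 2 / 2 ^ (w : ℝ)) := by linarith
    exact hsum
  · calc ((1 : ℝ) / 2) ^ (w / 2) ≤ 2 * (1 / 2) ^ (w / 2 + 1) := by rw [pow_succ]; linarith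
      _ ≤ _ := by
        gcongr 2 * ?_
        exact pow_le_pow_of_le_one (by norm_num) (by norm_num) (by omega)
  · rw [← pow_add, show w / 2 + (w - 2 * (w / 2)) = w - w / 2 by omega]
    linarith

/-- The allowed distance is trivial if there are at most two words to permute. -/
theorem one_le_distance {w k : ℕ} (hw : w ≤ 1) (hk : 2 ≤ k) :
    1 ≤ (k : ℝ) ^ 2 / 2 ^ ((w : ℝ) / 2) + (k : ℝ) ^ 2 / 2 ^ (w : ℝ) := by
  have hk' : (2 : ℝ) ≤ k := by exact_mod_cast hk
  have h1 : (2 : ℝ) ^ (w : ℝ) ≤ 2 := by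
    rw [Real.rpow_natCast]
    calc (2 : ℝ) ^ w ≤ 2 ^ 1 := pow_le_pow_right₀ (by norm_num) hw
      _ = 2 := pow_one 2
  have h2 : 1 ≤ (k : ℝ) ^ 2 / 2 ^ (w : ℝ) := by
    rw [one_le_div (by positivity)]
    nlinarith
  have h3 : 0 ≤ (k : ℝ) ^ 2 / 2 ^ ((w : ℝ) / 2) := by positivity
  linarith

end Distance

/-! ### Choice of the constants -/

section Sizes

/-- The exponent `t` that is found by the setup. -/
theorem exists_exponent {k : ℕ} (hk : 1 ≤ k) :
    ∃ t, 1 ≤ t ∧ k ≤ 32 ^ t ∧ (∀ i, 1 ≤ i → i < t → 32 ^ i < k) ∧ 32 ^ t ≤ 32 * k ∧ t ≤ k := by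
  classical
  have hex : ∃ t, 1 ≤ t ∧ k ≤ 32 ^ t := ⟨k, hk, (Nat.lt_pow_self (by norm_num)).le⟩
  set t := Nat.find hex with ht
  obtain ⟨h1, h2⟩ := Nat.find_spec hex
  have h3 : ∀ i, 1 ≤ i → i < t → 32 ^ i < k := fun i hi hit => by
    have := Nat.find_min hex hit
    omega
  refine ⟨t, h1, h2, h3, ?_⟩
  rcases h1.eq_or_lt with h | h
  · rw [← ht] at h
    rw [← h]
    omega
  · have h4 := h3 (t - 1) (by omega) (by omega)
    have h5 : t - 1 < 32 ^ (t - 1) := Nat.lt_pow_self (by norm_num)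
    have h6 : 32 ^ t = 32 * 32 ^ (t - 1) := by
      rw [← pow_succ', Nat.sub_add_cancel (by omega)]
    omega

theorem two_pow_le_pow_ceil {A : ℝ} {n w : ℕ} (hn : 2 ≤ n) (hw : (w : ℝ) ≤ A * Real.log n) :
    2 ^ w ≤ n ^ ⌈A⌉₊ := by
  have hlog : 0 ≤ Real.log n := Real.log_natCast_nonneg n
  have hn0 : (0 : ℝ) < n := by positivity
  have h : (2 : ℝ) ^ w ≤ (n : ℝ) ^ ⌈A⌉₊ := by
    rw [← Real.log_le_log_iff (by positivity) (by positivity), Real.log_pow, Real.log_pow]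
    calc (w : ℝ) * Real.log 2 ≤ w * 1 := by
          gcongr
          linarith [Real.log_two_lt_d9]
      _ ≤ A * Real.log n := by linarith
      _ ≤ ⌈A⌉₊ * Real.log n := by gcongr; exact Nat.le_ceil A
  exact_mod_cast h

theorem log_le_size (n : ℕ) (hn : 2 ≤ n) : Real.log n ≤ Nat.size n := by
  have h : (n : ℝ) ≤ 2 ^ Nat.size n := by exact_mod_cast (Nat.lt_size_self n).le
  calc Real.log n ≤ Real.log (2 ^ Nat.size n) := Real.log_le_log (by positivity) h
    _ = Nat.size n * Real.log 2 := Real.log_pow _ _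
    _ ≤ Nat.size n * 1 := by
        gcongr
        linarith [Real.log_two_lt_d9]
    _ = _ := mul_one _

theorem two_le_size {n : ℕ} (hn : 2 ≤ n) : 2 ≤ Nat.size n :=
  Nat.lt_size.2 (by simpa using hn)

theorem size_le_log {n : ℕ} (hn : 2 ≤ n) : (Nat.size n : ℝ) ≤ 4 * Real.log n := by
  have h2 := two_le_size hn
  have h : 2 ^ (Nat.size n - 1) ≤ n := Nat.lt_size.1 (by omega)
  have h' : (2 : ℝ) ^ (Nat.size n - 1) ≤ n := by exact_mod_cast h
  have h3 := Real.log_le_log (by positivity) h'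
  rw [Real.log_pow, Nat.cast_sub (by omega), Nat.cast_one] at h3
  have h4 : (2 : ℝ) ≤ Nat.size n := by exact_mod_cast h2
  nlinarith [Real.log_two_gt_d9]

/-- With sufficiently many copies the error of the hash functions is negligible. -/
theorem hash_error_le {α : ℝ} {A' n k w τ : ℕ} (hα : 0 < α) (hn : 2 ≤ n) (hkα : (n : ℝ) ^ α ≤ k)
    (hkn : k ≤ n) (hk : 2 ≤ k) (hkτ : k ≤ τ ^ 5) (hw : 2 ^ w ≤ n ^ A') :
    (3 + (k : ℝ) * k) * (1 / τ) ^ (5 * ⌈(A' + 6) / α⌉₊) ≤ k * (1 / 2) ^ w * (1 / 10) := by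
  set j := ⌈(A' + 6) / α⌉₊ with hj
  have hn1 : (1 : ℝ) ≤ n := by exact_mod_cast (by omega : 1 ≤ n)
  have hn0 : (0 : ℝ) ≤ n := by linarith
  have h1 : (n : ℝ) ^ (A' + 6) ≤ ((τ : ℝ) ^ (5 * j)) := by
    calc (n : ℝ) ^ (A' + 6) = (n : ℝ) ^ ((A' + 6 : ℕ) : ℝ) := (Real.rpow_natCast _ _).symm
      _ ≤ (n : ℝ) ^ (α * j) := by
          refine Real.rpow_le_rpow_of_exponent_le hn1 ?_
          have := Nat.le_ceil ((A' + 6) / α)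
          rw [div_le_iff₀ hα] at this
          push_cast
          linarith
      _ = ((n : ℝ) ^ α) ^ j := by rw [Real.rpow_mul hn0, Real.rpow_natCast]
      _ ≤ (k : ℝ) ^ j := by gcongr
      _ ≤ ((τ : ℝ) ^ 5) ^ j := by
          gcongr
          exact_mod_cast hkτ
      _ = _ := (pow_mul _ _ _).symm
  have h2 : 20 * (k : ℝ) * 2 ^ w ≤ (τ : ℝ) ^ (5 * j) := by
    refine le_trans ?_ h1
    have h3 : (2 : ℝ) ^ 5 ≤ (n : ℝ) ^ 5 := by
      gcongr
      exact_mod_cast hn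
    calc 20 * (k : ℝ) * 2 ^ w ≤ (n : ℝ) ^ 5 * n * n ^ A' := by
          gcongr
          · linarith
          · exact_mod_cast hw
      _ = _ := by ring
  have hk' : (2 : ℝ) ≤ k := by exact_mod_cast hk
  have hpos : (0 : ℝ) < (τ : ℝ) ^ (5 * j) := lt_of_lt_of_le (by positivity) h2
  rw [one_div, inv_pow, one_div, inv_pow, ← div_eq_mul_inv, div_le_iff₀ hpos]
  have h4 : 3 + (k : ℝ) * k ≤ 2 * (k * k) := by nlinarith
  calc 3 + (k : ℝ) * k ≤ 2 * (k * k) := h4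
    _ = k * (2 ^ w)⁻¹ * (1 / 10) * (20 * k * 2 ^ w) := by
        field_simp
        ring
    _ ≤ _ := by gcongr

end Sizes

theorem mainTheorem7 (A c α : ℝ) (hA : 0 < A) (hc : 1 < c) (hα : 0 < α) :
    ∃ (setup eval : WordRAM.Program) (b C D T : ℕ),
      ∀ n k w : ℕ, 2 ≤ n → (n : ℝ) ^ α ≤ k → k ≤ n → (w : ℝ) ≤ A * Real.log n →
        ∃ (F : SeededFamily (b * Nat.size n)) (π : F.Seed → Equiv.Perm (BitVec w)),
          F.IsOutput setup (D * n ^ D) n k w ∧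
          (∀ S : Finset (BitVec w), S.card = k →
            ∃ (G : Finset F.Seed) (hG : G.Nonempty),
              1 - (n : ℝ) ^ (-c) ≤ (G.card : ℝ) / Fintype.card F.Seed ∧
              statDist (valuesOn π G hG S) (trulyRandomValuesOn S) ≤
                (k : ℝ) ^ 2 / 2 ^ ((w : ℝ) / 2) + (k : ℝ) ^ 2 / 2 ^ (w : ℝ)) ∧
          (F.descriptionBits : ℝ) ≤ C * k * Real.log n ∧
          F.Evaluates eval T π := by
  -- `2 ^ w ≤ n ^ A'`, and `L` copies reduce the error of the hash functions to `n ^ (-(A' + 6))`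
  set A' := ⌈A⌉₊ with hA'
  set L := 5 * ⌈(A' + 6) / α⌉₊ with hL
  set N := Fintype.card (BlockIndex L) with hN
  -- words with room for `2 ^ (3 * w)` times the number of cells of a table, and for all addresses
  set b := 3 * A' + N + 20 with hb
  set D := 7 + (setupOutput L).length with hD
  refine ⟨setupProgram L, evalProgram L, b, 4 * ((7 + 1024 * N) * b), D, (evalProgram L).length,
    fun n k w hn hkα hkn hw => ?_⟩
  have hk : 2 ≤ k := by
    have h1 : (1 : ℝ) < k :=
      lt_of_lt_of_le (Real.one_lt_rpow (by exact_mod_cast hn) hα) hkα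
    exact_mod_cast h1
  obtain ⟨t, ht1, hkt, hlt, htk, htk'⟩ := exists_exponent (by omega : 1 ≤ k)
  have hτ5 : (2 ^ t) ^ 5 = 32 ^ t := by
    rw [← pow_mul, mul_comm, pow_mul]
    norm_num
  set m := Nat.size n with hm
  have hm2 : 2 ≤ m := two_le_size hn
  have hnm : n < 2 ^ m := Nat.lt_size_self n
  set B := b * m with hB
  have hwm : w ≤ A' * m := by
    have h1 : (w : ℝ) ≤ (A' * m : ℕ) := by
      push_cast
      exact hw.trans (mul_le_mul (Nat.le_ceil A) (log_le_size n hn) (Real.log_natCast_nonneg n)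
        (by positivity))
    exact_mod_cast h1
  have h5t : 5 * t < 5 + m := by
    refine (Nat.pow_lt_pow_iff_right (a := 2) (by norm_num)).1 ?_
    calc 2 ^ (5 * t) = 32 ^ t := by rw [pow_mul]; norm_num
      _ ≤ 32 * k := htk
      _ < 2 ^ 5 * 2 ^ m := by omega
      _ = _ := (pow_add _ _ _).symm
  have hBm : B = 3 * (A' * m) + N * m + 20 * m := by rw [hB, hb]; ring
  have hNm : N ≤ N * m := Nat.le_mul_of_pos_right N (by omega)
  have hsize5 : 3 * w + 5 * t + 5 ≤ B := by omega
  have hpow : 2 ^ (N + 11 + m) ≤ 2 ^ B := Nat.pow_le_pow_right (by norm_num) (by omega)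
  have hpow' : 1024 * k * 2 ^ N + 1024 ≤ 2 ^ (N + 11 + m) := by
    have e : 2 ^ (N + 11 + m) = 1024 * 2 ^ m * 2 ^ N + 1024 * 2 ^ m * 2 ^ N := by
      rw [pow_add, pow_add]; ring
    have h1 : 1024 * k * 2 ^ N ≤ 1024 * 2 ^ m * 2 ^ N := by
      gcongr
      omega
    have h2 : 1 ≤ 2 ^ m * 2 ^ N := Nat.mul_pos (by positivity) (by positivity)
    rw [e]
    nlinarith
  have hN2 : N < 2 ^ N := Nat.lt_two_pow_self
  have hblocks : N * (32 * (2 ^ t) ^ 5) ≤ 1024 * N * k := by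
    rw [hτ5]
    calc N * (32 * 32 ^ t) ≤ N * (32 * (32 * k)) := by gcongr
      _ = _ := by ring
  have hsize : 7 + N * (32 * (2 ^ t) ^ 5) < 2 ^ B := by
    have : 1024 * N * k ≤ 1024 * k * 2 ^ N := by
      calc 1024 * N * k = 1024 * k * N := by ring
        _ ≤ _ := by gcongr
    omega
  have hk2 : 1024 * k < 2 ^ B := by
    have : 1024 * k * 1 ≤ 1024 * k * 2 ^ N := by gcongr; exact Nat.one_le_two_pow
    omega
  have : NeZero (2 ^ t) := ⟨by positivity⟩
  refine ⟨feistelFamily B (2 ^ t) L w, familyPerm B (2 ^ t) L w, ?_, fun S hS => ?_, ?_, ?_⟩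
  · obtain ⟨c', h1, h2⟩ := isOutput_feistelFamily (L := L) (n := n) (k := k) (w := w) (B := B)
      (by omega) (by omega) (by omega) hsize (by omega) ht1 hkt hlt
    refine ⟨c', h1.mono ?_, h2⟩
    calc 4 + 3 * t + (setupOutput L).length ≤ D * n := by
          rw [hD, add_mul]
          have := Nat.le_mul_of_pos_right (setupOutput L).length (by omega : 0 < n)
          omega
      _ ≤ D * n ^ D := by
          gcongr
          exact Nat.le_self_pow (by omega) n
  · have hG : (Finset.univ : Finset (feistelFamily B (2 ^ t) L w).Seed).Nonempty :=
      ⟨fun _ => 0, Finset.mem_univ _⟩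
    -- the event consists of all seeds
    refine ⟨Finset.univ, hG, ?_, ?_⟩
    · rw [Finset.card_univ, div_self (Nat.cast_ne_zero.2 (Finset.card_pos.2 hG).ne')]
      have : (0 : ℝ) ≤ (n : ℝ) ^ (-c) := by positivity
      linarith
    · rcases le_or_gt w 1 with hw1 | hw2
      · exact (statDist_le_one _ _).trans (one_le_distance hw1 hk)
      · exact statDist_familyPerm_le rfl hsize5 hw2 hk (by rw [hτ5]; exact hkt)
          (hash_error_le hα hn hkα hkn hk (by rw [hτ5]; exact hkt)
            (two_pow_le_pow_ceil hn hw)) hG S hS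
  · have hbits : (feistelFamily B (2 ^ t) L w).descriptionBits ≤ (7 + 1024 * N) * b * k * m := by
      change (7 + N * (32 * (2 ^ t) ^ 5)) * B ≤ _
      calc (7 + N * (32 * (2 ^ t) ^ 5)) * B ≤ (7 * k + 1024 * N * k) * B := by
            gcongr
            omega
        _ = _ := by rw [hB]; ring
    calc ((feistelFamily B (2 ^ t) L w).descriptionBits : ℝ)
        ≤ ((7 + 1024 * N) * b * k * m : ℕ) := by exact_mod_cast hbits
      _ = ((7 + 1024 * N) * b : ℕ) * k * (m : ℝ) := by push_cast; ring
      _ ≤ ((7 + 1024 * N) * b : ℕ) * k * (4 * Real.log n) := by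
          gcongr
          exact size_le_log hn
      _ = _ := by push_cast; ring
  · exact evaluates_feistelFamily (by omega) hsize.le (by rw [hτ5]; omega)
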